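/- **Setting.** Let $y=\sum_{i\ge 1}x_i\beta_i+u$, where the error $u$ has mean $0$ and variance $\sigma^2>0$, the explanatory variables $x=(x_i)_{i\ge1}$ are centered and square integrable such that the variance-covariance matrix of every finite family of distinct $x_i$'s is positive definite, $u$ is independent of $x$, the series converges in squared mean, and $(y,x)$ is jointly Gaussian. Let $(y^{(j)},x^{(j)})$, $0\le j\le n$, be i.i.d. copies of $(y,x)$; those with $1\le j\le n$ form the training sample $Y=(y^{(1)},\dots,y^{(n)})'$, $X=(x^{(1)},\dots,x^{(n)})'$, and $(y^{(0)},x^{(0)})$ is a new observation. A model $m$ is a finite set of indices which is the disjoint union of two blocks $m_1,m_2$ with $|m_1|\ge3$, $|m_2|\ge3$ and $|m|=|m_1|+|m_2|<n$. Let $x(m)$ be the subvector of $x$ with indices in $m$, $\Sigma(m)$ its variance-covariance matrix, and let $X(m)$, $X_1$, $X_2$ be the submatrices of columns of $X$ with indices in $m$, $m_1$, $m_2$. By Gaussianity there are a unique vector $\theta$ and $\sigma^2(m)>0$ such that ${\mathbb E}[y\,\|\,x(m)]=x(m)'\theta$ and $\mathrm{Var}[y\,\|\,x(m)]=\sigma^2(m)$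 almost surely; put $\mu(m)=\theta'\Sigma(m)\theta/\sigma^2(m)$. **Estimator.** Let $M_1=I_n-X_1(X_1'X_1)^{-1}X_1'$, $X_2^*=M_1X_2$, $\hat\theta_1^*=(X_1'X_1)^{-1}X_1'Y$, $\hat\theta_2=(X_2'M_1X_2)^{-1}X_2'M_1Y$, and let $\hat\sigma^2(m)$ be the residual sum of squares of the least-squares regression of $Y$ on $X(m)$ divided by $n-|m|$ (with Moore--Penrose inverses on the null event where an inverse does not exist). For fixed tuning parameters $c_1,c_2\ge0$ let $$a_1=\min\Big\{1,\ \frac{c_1\hat\sigma^2(m)|m_1|}{\hat\theta_1^{*\prime}X_1'X_1\hat\theta_1^*}\Big\},\qquad a_2=\min\Big\{1,\ \frac{c_2\hat\sigma^2(m)|m_2|}{\hat\theta_2'X_2^{*\prime}X_2^*\hat\theta_2}\Big\},$$ $\hat\theta_2^{JS}=(1-a_2)\hat\theta_2$ and $\hat\theta_1^{JS}=(1-a_1)\hat\theta_1^*-(X_1'X_1)^{-1}X_1'X_2\hat\theta_2^{JS}$. Let $\hat\beta^B(m)$ be the sequence whose components with indices in $m_1$ and $m_2$ are those of $\hat\theta_1^{JS}$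 and $\hat\theta_2^{JS}$, and whose other components are $0$. Let $$\rho^2(m)={\mathbb E}\Big[\Big(\sum_{i\ge1}x_i^{(0)}\hat\beta^B_i(m)-y^{(0)}\Big)^2\,\Big\|\,X,Y\Big],$$ where the expectation is over $(y^{(0)},x^{(0)})$ with the training sample held fixed, and let $$\hat\rho^2(m)=w_1\hat\sigma^2(m)+w_2\frac{Y'(I_n-M_1)Y}{n}+w_3\frac{Y'M_1Y}{n-|m_1|}$$ with weights $$w_1=(1-a_2)^2\frac{|m|}{n-|m|+1}+1-a_2^2-(a_1-a_2)^2\frac{|m_1|}{n-|m_1|+1}+(a_2-a_1)(2-a_1-a_2)\frac{|m_1|}{n-|m_1|+1},$$ $$w_2=a_1^2,\qquad w_3=a_2^2-a_1^2\frac{|m_1|}{n}+(a_2-a_1)^2\frac{|m_1|}{n-|m_1|+1}.$$ **Theorem.** For every $\varepsilon>0$, $${\mathbb P}\left(\left|\log\frac{\hat\rho^2(m)}{\rho^2(m)}\right|\ge\varepsilon\right)\le 31|m|\exp\left(-n\Big(\frac{|m_1|}{n}\Big)^2\Big(1-\frac{|m|}{n}\Big)^5\frac{\varepsilon^2}{14397(1+\varepsilon)^2}\right),$$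 and the same probability is also at most $$31|m|\exp\left(-n\Big(1-\frac{|m|}{n}\Big)^5\frac{\varepsilon^2}{28279(1+\mu(m))^2(1+\varepsilon)^2}\right),$$ where $|\log(\hat\rho^2(m)/\rho^2(m))|$ is read as $\infty$ when $\hat\rho^2(m)\le0$. -/

import Mathlib

open MeasureTheory ProbabilityTheory Filter Matrix
open scoped Topology ENNReal Matrix

noncomputable section

namespace BlockShrinkage

/-! ### Moore–Penrose inverse -/

/-- The four Penrose equations: `B` is the Moore–Penrose inverse of the real matrix `A`. -/
structure IsMoorePenrose {ι κ : Type*} [Fintype ι] [Fintype κ]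
    (A : Matrix ι κ ℝ) (B : Matrix κ ι ℝ) : Prop where
  mul_mul_left : A * B * A = A
  mul_mul_right : B * A * B = B
  symm_left : (A * B)ᵀ = A * B
  symm_right : (B * A)ᵀ = B * A

open Classical in
/-- The Moore–Penrose inverse of a real matrix (the usual inverse if the matrix is invertible). -/
def pinv {ι κ : Type*} [Fintype ι] [Fintype κ] (A : Matrix ι κ ℝ) : Matrix κ ι ℝ :=
  if h : ∃ B, IsMoorePenrose A B then h.choose else 0

/-! ### The data-generating process -/

/-- The matrix of second moments `E[x_i x_j]`, `i, j ∈ s`, which is the variance-covariance matrix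
of `(x_i)_{i ∈ s}` when the `x_i` are centered. -/
def covMatrix {Ω : Type*} [MeasurableSpace Ω] (P : Measure Ω) (x : ℕ → Ω → ℝ) (s : Finset ℕ) :
    Matrix s s ℝ :=
  Matrix.of fun i j => ∫ ω, x i ω * x j ω ∂P

/-- The (possibly infinite dimensional) Gaussian linear model `y = ∑ i, x i * β i + u`. -/
structure IsLinearModel {Ω : Type*} [MeasurableSpace Ω] (P : Measure Ω)
    (y : Ω → ℝ) (x : ℕ → Ω → ℝ) (u : Ω → ℝ) (β : ℕ → ℝ) (σsq : ℝ) : Prop where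
  measurable_y : Measurable y
  measurable_x : ∀ i, Measurable (x i)
  measurable_u : Measurable u
  /-- the error is square integrable and centered with variance `σsq > 0` -/
  memLp_u : MemLp u 2 P
  mean_u : ∫ ω, u ω ∂P = 0
  var_u : Var[u; P] = σsq
  σsq_pos : 0 < σsq
  /-- the explanatory variables are square integrable, centered and not perfectly correlated -/
  memLp_x : ∀ i, MemLp (x i) 2 P
  mean_x : ∀ i, ∫ ω, x i ω ∂P = 0
  posDef_cov : ∀ s : Finset ℕ, (covMatrix P x s).PosDef
  /-- the error is independent of the whole sequence of explanatory variables -/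
  indep : IndepFun u (fun ω i => x i ω) P
  /-- the series converges to `y - u` in squared mean -/
  tendsto_series : Tendsto
    (fun N : ℕ => eLpNorm (fun ω => y ω - u ω - ∑ i ∈ Finset.range N, x i ω * β i) 2 P)
    atTop (𝓝 0)
  /-- `(y, x)` is jointly Gaussian -/
  gaussian : IsGaussianProcess (fun o : Option ℕ => o.elim y x) P

/-- `θ` and `τsq` are the parameters of the submodel with regressors `(x_i)_{i ∈ m}`: the
conditional mean of `y` given `(x_i)_{i ∈ m}` is `∑ i ∈ m, x_i θ_i`, and the conditional variance
is the constant `τsq`. -/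
structure IsSubmodelParam {Ω : Type*} [mΩ : MeasurableSpace Ω] (P : Measure Ω)
    (y : Ω → ℝ) (x : ℕ → Ω → ℝ) (m : Finset ℕ) (θ : m → ℝ) (τsq : ℝ) : Prop where
  condMean : P[y | MeasurableSpace.comap (fun ω (i : m) => x i ω) inferInstance]
    =ᵐ[P] fun ω => ∑ i : m, x i ω * θ i
  condVariance : Var[y; P | MeasurableSpace.comap (fun ω (i : m) => x i ω) inferInstance]
    =ᵐ[P] fun _ => τsq

/-- The signal-to-noise ratio `μ(m) = θ' Σ(m) θ / σ²(m)`. -/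
def snr {Ω : Type*} [MeasurableSpace Ω] (P : Measure Ω) (x : ℕ → Ω → ℝ) (m : Finset ℕ)
    (θ : m → ℝ) (τsq : ℝ) : ℝ :=
  (θ ⬝ᵥ (covMatrix P x m *ᵥ θ)) / τsq

/-! ### Block James–Stein estimation from a realized sample `(Y, X)`

`m₁` and `m₂` are the sets of indices of the two blocks; the model is `m = m₁ ∪ m₂`. -/

section Estimators

variable {n : ℕ}

/-- The `n × |s|` matrix of those columns of `X` with index in `s`. -/
def design (X : Fin n → ℕ → ℝ) (s : Finset ℕ) : Matrix (Fin n) s ℝ :=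
  Matrix.of fun j i => X j i

/-- `M(s) = I - X(s) (X(s)'X(s))⁻¹ X(s)'`. -/
def residProj (X : Fin n → ℕ → ℝ) (s : Finset ℕ) : Matrix (Fin n) (Fin n) ℝ :=
  1 - design X s * pinv ((design X s)ᵀ * design X s) * (design X s)ᵀ

/-- The least-squares estimator `(X(s)'X(s))⁻¹ X(s)'Y`. -/
def lsEst (Y : Fin n → ℝ) (X : Fin n → ℕ → ℝ) (s : Finset ℕ) : s → ℝ :=
  pinv ((design X s)ᵀ * design X s) *ᵥ ((design X s)ᵀ *ᵥ Y)

/-- The usual unbiased variance estimator `σ̂²(m)`: residual sum of squares over `n - |m|`. -/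
def sigmaHatSq (Y : Fin n → ℝ) (X : Fin n → ℕ → ℝ) (m : Finset ℕ) : ℝ :=
  (∑ j, (Y j - (design X m *ᵥ lsEst Y X m) j) ^ 2) / ((n : ℝ) - (m.card : ℝ))

/-- `X₂*(m) = M₁(m) X₂(m)`. -/
def design₂Star (X : Fin n → ℕ → ℝ) (m₁ m₂ : Finset ℕ) : Matrix (Fin n) m₂ ℝ :=
  residProj X m₁ * design X m₂

/-- `θ̂₁* = (X₁'X₁)⁻¹ X₁'Y`. -/
def thetaHat₁Star (Y : Fin n → ℝ) (X : Fin n → ℕ → ℝ) (m₁ : Finset ℕ) : m₁ → ℝ :=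
  lsEst Y X m₁

/-- `θ̂₂ = (X₂'M₁X₂)⁻¹ X₂'M₁Y`. -/
def thetaHat₂ (Y : Fin n → ℝ) (X : Fin n → ℕ → ℝ) (m₁ m₂ : Finset ℕ) : m₂ → ℝ :=
  pinv ((design X m₂)ᵀ * residProj X m₁ * design X m₂) *ᵥ
    ((design X m₂)ᵀ *ᵥ (residProj X m₁ *ᵥ Y))

/-- `c₁ σ̂²(m) |m₁| / (θ̂₁*'X₁'X₁θ̂₁*)`. -/
def shrink₁ (c₁ : ℝ) (Y : Fin n → ℝ) (X : Fin n → ℕ → ℝ) (m₁ m₂ : Finset ℕ) : ℝ :=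
  c₁ * sigmaHatSq Y X (m₁ ∪ m₂) * ((m₁.card : ℝ) /
    (thetaHat₁Star Y X m₁ ⬝ᵥ (((design X m₁)ᵀ * design X m₁) *ᵥ thetaHat₁Star Y X m₁)))

/-- `c₂ σ̂²(m) |m₂| / (θ̂₂'X₂*'X₂*θ̂₂)`. -/
def shrink₂ (c₂ : ℝ) (Y : Fin n → ℝ) (X : Fin n → ℕ → ℝ) (m₁ m₂ : Finset ℕ) : ℝ :=
  c₂ * sigmaHatSq Y X (m₁ ∪ m₂) * ((m₂.card : ℝ) /
    (thetaHat₂ Y X m₁ m₂ ⬝ᵥ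
      (((design₂Star X m₁ m₂)ᵀ * design₂Star X m₁ m₂) *ᵥ thetaHat₂ Y X m₁ m₂)))

/-- The shrinkage factor `a₁(m)`. -/
def a₁ (c₁ : ℝ) (Y : Fin n → ℝ) (X : Fin n → ℕ → ℝ) (m₁ m₂ : Finset ℕ) : ℝ :=
  min 1 (shrink₁ c₁ Y X m₁ m₂)

/-- The shrinkage factor `a₂(m)`. -/
def a₂ (c₂ : ℝ) (Y : Fin n → ℝ) (X : Fin n → ℕ → ℝ) (m₁ m₂ : Finset ℕ) : ℝ :=
  min 1 (shrink₂ c₂ Y X m₁ m₂)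

/-- The positive part James–Stein estimator of `θ₁*`. -/
def thetaJS₁Star (c₁ : ℝ) (Y : Fin n → ℝ) (X : Fin n → ℕ → ℝ) (m₁ m₂ : Finset ℕ) : m₁ → ℝ :=
  max (1 - shrink₁ c₁ Y X m₁ m₂) 0 • thetaHat₁Star Y X m₁

/-- The positive part James–Stein estimator of `θ₂`. -/
def thetaJS₂ (c₂ : ℝ) (Y : Fin n → ℝ) (X : Fin n → ℕ → ℝ) (m₁ m₂ : Finset ℕ) : m₂ → ℝ :=
  max (1 - shrink₂ c₂ Y X m₁ m₂) 0 • thetaHat₂ Y X m₁ m₂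

/-- The estimator of `θ₁`: `θ̂₁*ᴶˢ - (X₁'X₁)⁻¹ X₁'X₂ θ̂₂ᴶˢ`. -/
def thetaJS₁ (c₁ c₂ : ℝ) (Y : Fin n → ℝ) (X : Fin n → ℕ → ℝ) (m₁ m₂ : Finset ℕ) : m₁ → ℝ :=
  thetaJS₁Star c₁ Y X m₁ m₂ -
    pinv ((design X m₁)ᵀ * design X m₁) *ᵥ
      ((design X m₁)ᵀ *ᵥ (design X m₂ *ᵥ thetaJS₂ c₂ Y X m₁ m₂))

/-- The block shrinkage estimator `β̂ᴮ(m)` of the whole sequence `β`; its components outside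
`m₁ ∪ m₂` are zero. -/
def betaHat (c₁ c₂ : ℝ) (Y : Fin n → ℝ) (X : Fin n → ℕ → ℝ) (m₁ m₂ : Finset ℕ) (i : ℕ) : ℝ :=
  if h₁ : i ∈ m₁ then thetaJS₁ c₁ c₂ Y X m₁ m₂ ⟨i, h₁⟩
  else if h₂ : i ∈ m₂ then thetaJS₂ c₂ Y X m₁ m₂ ⟨i, h₂⟩
  else 0

/-- The weight `w₁` as a function of the shrinkage factors `a, b` of the two blocks, the sample
size `n`, and the dimensions `k₁ = |m₁|`, `k = |m|`. -/
def w₁ (a b n k₁ k : ℝ) : ℝ :=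
  (1 - b) ^ 2 * (k / (n - k + 1)) + 1 - b ^ 2 - (a - b) ^ 2 * (k₁ / (n - k₁ + 1))
    + (b - a) * (2 - a - b) * (k₁ / (n - k₁ + 1))

/-- The weight `w₂`. -/
def w₂ (a : ℝ) : ℝ := a ^ 2

/-- The weight `w₃`. -/
def w₃ (a b n k₁ : ℝ) : ℝ :=
  b ^ 2 - a ^ 2 * (k₁ / n) + (b - a) ^ 2 * (k₁ / (n - k₁ + 1))

/-- The empirical mean-squared prediction error `ρ̂²(m)`. -/
def rhoHatSq (c₁ c₂ : ℝ) (Y : Fin n → ℝ) (X : Fin n → ℕ → ℝ) (m₁ m₂ : Finset ℕ) : ℝ :=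
  w₁ (a₁ c₁ Y X m₁ m₂) (a₂ c₂ Y X m₁ m₂) n m₁.card (m₁ ∪ m₂).card * sigmaHatSq Y X (m₁ ∪ m₂)
    + w₂ (a₁ c₁ Y X m₁ m₂) * ((Y ⬝ᵥ ((1 - residProj X m₁) *ᵥ Y)) / (n : ℝ))
    + w₃ (a₁ c₁ Y X m₁ m₂) (a₂ c₂ Y X m₁ m₂) n m₁.card *
        ((Y ⬝ᵥ (residProj X m₁ *ᵥ Y)) / ((n : ℝ) - (m₁.card : ℝ)))

/-- The conditional mean-squared prediction error `ρ²(m)`: the expectation over a new observation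
`(y₀, x₀)` (which is independent of the training sample) of the squared error of the predictor
`∑ᵢ x₀ᵢ β̂ᴮᵢ(m)`, where the training sample `(Y, X)` is held fixed. -/
def rhoSq {Ω : Type*} [MeasurableSpace Ω] (P : Measure Ω) (y₀ : Ω → ℝ) (x₀ : ℕ → Ω → ℝ)
    (c₁ c₂ : ℝ) (Y : Fin n → ℝ) (X : Fin n → ℕ → ℝ) (m₁ m₂ : Finset ℕ) : ℝ :=
  ∫ ω, ((∑' i, x₀ i ω * betaHat c₁ c₂ Y X m₁ m₂ i) - y₀ ω) ^ 2 ∂P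

end Estimators

/-- `|log r|`, with value `∞` if `r ≤ 0`. -/
def absLog (r : ℝ) : ℝ≥0∞ := (ENNReal.log (ENNReal.ofReal r)).abs

/-- The event `|log (ρ̂²(m) / ρ²(m))| ≥ ε`, where observation `0` is the new one and observations
`1, …, n` form the training sample. -/
def deviationEvent {Ω : Type*} [MeasurableSpace Ω] (P : Measure Ω) {n : ℕ}
    (y : Fin (n + 1) → Ω → ℝ) (x : Fin (n + 1) → ℕ → Ω → ℝ) (c₁ c₂ : ℝ) (m₁ m₂ : Finset ℕ)
    (ε : ℝ) : Set Ω :=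
  {ω | ENNReal.ofReal ε ≤ absLog
    (rhoHatSq c₁ c₂ (fun j : Fin n => y j.succ ω) (fun j i => x j.succ i ω) m₁ m₂ /
      rhoSq P (y 0) (x 0) c₁ c₂ (fun j : Fin n => y j.succ ω) (fun j i => x j.succ i ω) m₁ m₂)}

end BlockShrinkage

end

open MeasureTheory ProbabilityTheory Filter Matrix
open scoped Topology ENNReal Matrix

noncomputable section

namespace BlockShrinkage

open scoped RealInnerProductSpace
open Module

/-! ### Chi-square distributions and their tails -/

/-! The second-moment matrix Γ of (x(m₁), x(m₂), y) is positive definite, and a block lower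
triangular factorization Γ = L Lᵀ expresses each observation through independent standard normal
coordinates: one per index of m₁, one per index of m₂, and a last one, independent of the regressors
in m, for the error. Read by columns, the sample becomes independent standard Gaussian vectors `z
i`, `G (some k)`, `G none` in ℝⁿ, with Y = σ (∑ s i • z i + ∑ t k • G (some k) + G none). Least
squares and residuals are equivariant under this change of regressors, so ρ² and ρ̂² are σ² times
`canonRisk` and `canonEstimate`, evaluated at a = a₁ and b = a₂ (`IsWhitened.rhoSq_eq`,
`IsWhitened.rhoHatSq_eq`), while μ(m) = ‖s‖² + ‖t‖² (`IsLinearModel.snr_eq`).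

Besides s and t, the canonical risk involves only the error e of the second-block estimator
(`blockErr`) and the coefficients on z of two combinations of the vectors G, with weights (1, -e)
and (1, t). Regression coefficients of an independent Gaussian vector follow a multivariate
t-distribution (`map_coef_eq`): a standard Gaussian vector divided by the root of an independent
chi-square variable. The weights (1, -e) are random, but they depend on G only through the residuals
after regression on z. These are independent of the components in the span of z, which alone
determine the coefficients, so the weights may be treated as constants
(`coef_random_combination_le`). Inner products of two coefficient vectors follow by polarization.
Normal and chi-square tails then give all the bounds of `IsTypical` outside an event of probability
at most 38 exp(-u) (`measure_not_isTypical_le`).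

On that event the argument is deterministic and uniform in the shrinkage factors: although these
depend on the sample, only 0 ≤ a, b ≤ 1 is used. Both quantities are compared with R = `refRisk`.
Let u = n η² x³ with x = 1 - |m|/n, and let L ≥ 1 satisfy a² (1 + ‖t‖²) ≤ L R. Then the risk is
within 46 η L R of R (`abs_risk_sub_refRisk_le`) and the estimate within 8.2 η L R
(`abs_estimate_sub_refRisk_le`). If 119 η L ≤ ε/(1+ε), the logarithm of their ratio is smaller than
ε in absolute value.

The two bounds come from two choices of L. One is 1 + n/|m₁|, because shrinking the first block but
not the second is penalized in R by (b - a)² q₁ ‖t‖² (`sq_mul_le_mul_refRisk_of_ratio`). The other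
is 1 + μ(m), because R ≥ 1 (`sq_mul_le_mul_refRisk_of_signal`). The prefactor 38 is below 31 |m|. -/

/-- The chi-square distribution with `k` degrees of freedom. -/
def chiSq (k : ℕ) : Measure ℝ :=
  (stdGaussian (EuclideanSpace ℝ (Fin k))).map (fun x => ‖x‖ ^ 2)

instance isProbabilityMeasure_chiSq (k : ℕ) : IsProbabilityMeasure (chiSq k) :=
  Measure.isProbabilityMeasure_map (Measurable.aemeasurable (by fun_prop))

lemma gaussianPDFReal_mul_exp_sq (l x : ℝ) :
    gaussianPDFReal 0 1 x • Real.exp (l * x ^ 2) =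
      (√(2 * Real.pi))⁻¹ * Real.exp (-(1 / 2 - l) * x ^ 2) := by
  rw [gaussianPDFReal_def, smul_eq_mul]
  simp only [NNReal.coe_one, mul_one, sub_zero]
  rw [mul_assoc, ← Real.exp_add]
  congr 2
  ring

lemma integral_exp_mul_sq_gaussianReal {l : ℝ} (hl : l < 1 / 2) :
    ∫ x, Real.exp (l * x ^ 2) ∂(gaussianReal 0 1) = (√(1 - 2 * l))⁻¹ := by
  rw [integral_gaussianReal_eq_integral_smul one_ne_zero]
  simp_rw [gaussianPDFReal_mul_exp_sq]
  rw [integral_const_mul, integral_gaussian, ← Real.sqrt_inv, ← Real.sqrt_inv,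
    ← Real.sqrt_mul (by positivity)]
  congr 1
  have : 1 / 2 - l ≠ 0 := by linarith
  have h2 : 1 - 2 * l ≠ 0 := by linarith
  have := Real.pi_pos.ne'
  field_simp

lemma integrable_exp_mul_sq_gaussianReal {l : ℝ} (hl : l < 1 / 2) :
    Integrable (fun x => Real.exp (l * x ^ 2)) (gaussianReal 0 1) := by
  -- A non-integrable function has Bochner integral 0, whereas the closed form of the integral is
  -- positive.
  by_contra h
  have h1 := integral_undef h
  rw [integral_exp_mul_sq_gaussianReal hl] at h1
  have : 0 < √(1 - 2 * l) := Real.sqrt_pos.2 (by linarith)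
  exact (inv_pos.2 this).ne' h1

lemma exp_mul_norm_sq_eq_prod {k : ℕ} (l : ℝ) (x : Fin k → ℝ) :
    Real.exp (l * ‖(WithLp.toLp 2 x : EuclideanSpace ℝ (Fin k))‖ ^ 2) =
      ∏ i, Real.exp (l * (x i) ^ 2) := by
  rw [EuclideanSpace.real_norm_sq_eq, Finset.mul_sum, Real.exp_sum]

lemma integrable_exp_mul_chiSq {l : ℝ} (hl : l < 1 / 2) (k : ℕ) :
    Integrable (fun x => Real.exp (l * x)) (chiSq k) := by
  rw [chiSq, ← map_pi_eq_stdGaussian, Measure.map_map (by fun_prop) (by fun_prop),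
    integrable_map_measure (Measurable.aestronglyMeasurable (by fun_prop))
      (Measurable.aemeasurable (by fun_prop))]
  simp only [Function.comp_def, exp_mul_norm_sq_eq_prod]
  exact Integrable.fintype_prod (f := fun (_ : Fin k) (x : ℝ) => Real.exp (l * x ^ 2))
    fun _ => integrable_exp_mul_sq_gaussianReal hl

lemma mgf_chiSq {l : ℝ} (hl : l < 1 / 2) (k : ℕ) :
    mgf id (chiSq k) l = Real.exp (-(k * Real.log (1 - 2 * l) / 2)) := by
  rw [mgf, chiSq, ← map_pi_eq_stdGaussian, Measure.map_map (by fun_prop) (by fun_prop),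
    integral_map (Measurable.aemeasurable (by fun_prop))
      (Measurable.aestronglyMeasurable (by fun_prop))]
  simp only [Function.comp_def, id, exp_mul_norm_sq_eq_prod]
  rw [integral_fintype_prod_eq_prod (fun (_ : Fin k) (x : ℝ) => Real.exp (l * x ^ 2))]
  simp only [integral_exp_mul_sq_gaussianReal hl, Finset.prod_const, Finset.card_univ,
    Fintype.card_fin]
  have h : 0 < 1 - 2 * l := by linarith
  have h2 : (√(1 - 2 * l))⁻¹ = Real.exp (-(Real.log (1 - 2 * l) / 2)) := by
    rw [Real.exp_neg, ← Real.log_sqrt h.le, Real.exp_log (Real.sqrt_pos.2 h)]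
  rw [h2, ← Real.exp_nat_mul]
  congr 1
  ring

/-- The deviation of a chi-square variable with `k` degrees of freedom from its mean that is
exceeded, on either side, with probability at most `exp (-u)`. -/
def dev (u : ℝ) (k : ℕ) : ℝ := 2 * √(k * u) + 2 * u

/-- For w = exp v this is v ≤ sinh v. It puts the Chernoff exponent of the upper chi-square tail
into closed form. -/
lemma log_le_half_sub_inv {w : ℝ} (hw : 1 ≤ w) : Real.log w ≤ (w - w⁻¹) / 2 := by
  have h := Real.self_le_sinh_iff.2 (Real.log_nonneg hw)
  rwa [Real.sinh_log (by linarith)] at h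

lemma chiSq_upper_tail {u : ℝ} (hu : 0 < u) (k : ℕ) :
    (chiSq k).real {x | k + dev u k ≤ x} ≤ Real.exp (-u) := by
  set s := √(k : ℝ) with hs
  set v := √u with hv
  have hs0 : 0 ≤ s := Real.sqrt_nonneg _
  have hv0 : 0 < v := Real.sqrt_pos.2 hu
  have hk : (k : ℝ) = s ^ 2 := (Real.sq_sqrt (Nat.cast_nonneg k)).symm
  have huv : u = v ^ 2 := (Real.sq_sqrt hu.le).symm
  have hdev : dev u k = 2 * s * v + 2 * v ^ 2 := by
    rw [dev, Real.sqrt_mul (Nat.cast_nonneg k), ← hs, ← hv, ← huv]; ring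
  -- The quotient (s + 2v)/s below needs s > 0. For k = 0 the variable is identically 0 while `dev u
  -- 0` = 2u > 0, so the event is empty.
  rcases hs0.eq_or_lt with hs1 | hs1
  · have hk0 : k = 0 := by
      have : (k : ℝ) = 0 := by rw [hk, ← hs1]; ring
      exact_mod_cast this
    subst hk0
    have : (chiSq 0).real {x | ((0 : ℕ) : ℝ) + dev u 0 ≤ x} = 0 := by
      have hm : MeasurableSet {x : ℝ | ((0 : ℕ) : ℝ) + dev u 0 ≤ x} := measurableSet_Ici
      rw [measureReal_def, chiSq, Measure.map_apply (by fun_prop) hm]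
      have : (fun x : EuclideanSpace ℝ (Fin 0) => ‖x‖ ^ 2) ⁻¹'
          {x | ((0 : ℕ) : ℝ) + dev u 0 ≤ x} = ∅ := by
        ext x
        have : x = 0 := Subsingleton.elim _ _
        simp [this, dev, hu]
      rw [this]; simp
    rw [this]; positivity
  -- This is not the optimal Chernoff parameter. It is chosen so that, after log w ≤ (w - w⁻¹)/2 at
  -- w = (s + 2v)/s = 1/(1 - 2l), the exponent is exactly -v² = -u.
  set l := v / (s + 2 * v) with hl
  have hd : 0 < s + 2 * v := by positivity
  have hl0 : 0 ≤ l := by positivity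
  have h12 : 1 - 2 * l = s / (s + 2 * v) := by rw [hl]; field_simp; ring
  have hl2 : l < 1 / 2 := by
    have : 0 < 1 - 2 * l := by rw [h12]; positivity
    linarith
  refine (measure_ge_le_exp_mul_mgf (X := id) _ hl0 (integrable_exp_mul_chiSq hl2 k)).trans ?_
  rw [mgf_chiSq hl2, ← Real.exp_add]
  apply Real.exp_le_exp.2
  have hw : 1 ≤ (s + 2 * v) / s := by rw [le_div_iff₀ hs1]; linarith
  have hlog := log_le_half_sub_inv hw
  have e : Real.log (1 - 2 * l) = -Real.log ((s + 2 * v) / s) := by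
    rw [h12, ← Real.log_inv, inv_div]
  rw [e, hdev, hk, huv]
  have : s ^ 2 * Real.log ((s + 2 * v) / s) / 2 ≤
      s ^ 2 * (((s + 2 * v) / s - ((s + 2 * v) / s)⁻¹) / 2) / 2 := by gcongr
  have e2 : -l * (s ^ 2 + (2 * s * v + 2 * v ^ 2)) +
      s ^ 2 * (((s + 2 * v) / s - ((s + 2 * v) / s)⁻¹) / 2) / 2 = -v ^ 2 := by
    rw [hl]; field_simp; ring
  linarith

lemma chiSq_lower_tail {u : ℝ} (hu : 0 < u) (k : ℕ) :
    (chiSq k).real {x | x ≤ k - dev u k} ≤ Real.exp (-u) := by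
  set s := √(k : ℝ) with hs
  set v := √u with hv
  have hs0 : 0 ≤ s := Real.sqrt_nonneg _
  have hv0 : 0 < v := Real.sqrt_pos.2 hu
  have hk : (k : ℝ) = s ^ 2 := (Real.sq_sqrt (Nat.cast_nonneg k)).symm
  have huv : u = v ^ 2 := (Real.sq_sqrt hu.le).symm
  have hdev : dev u k = 2 * s * v + 2 * v ^ 2 := by
    rw [dev, Real.sqrt_mul (Nat.cast_nonneg k), ← hs, ← hv, ← huv]; ring
  have h1 : (0 : ℝ) < s + v := by positivity
  -- The Chernoff parameter is -l. With log(1 + 2l) ≥ 2l - 2l² the exponent becomes -v² minus a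
  -- nonnegative remainder.
  set l := v / (s + v) with hl
  have hl0 : 0 ≤ l := by positivity
  have hl2 : -l < 1 / 2 := by linarith
  refine (measure_le_le_exp_mul_mgf (X := id) _ (neg_nonpos.2 hl0)
    (integrable_exp_mul_chiSq hl2 k)).trans ?_
  rw [mgf_chiSq hl2, ← Real.exp_add]
  apply Real.exp_le_exp.2
  have hlog := Real.le_log_one_add_of_nonneg (show 0 ≤ 2 * l by positivity)
  rw [show 1 - 2 * -l = 1 + 2 * l by ring, hdev, hk, huv]
  have h3 : 2 * l - 2 * l ^ 2 ≤ 2 * (2 * l) / (2 * l + 2) := by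
    rw [le_div_iff₀ (by positivity)]
    nlinarith [pow_nonneg hl0 3]
  have h4 : s ^ 2 * (2 * l - 2 * l ^ 2) / 2 ≤ s ^ 2 * Real.log (1 + 2 * l) / 2 := by
    have := h3.trans hlog
    gcongr
  have e2 : - -l * (s ^ 2 - (2 * s * v + 2 * v ^ 2)) - s ^ 2 * (2 * l - 2 * l ^ 2) / 2 + v ^ 2
      = -(v ^ 2 * (2 * s * v + v ^ 2) / (s + v) ^ 2) := by
    rw [hl]; field_simp; ring
  have : 0 ≤ v ^ 2 * (2 * s * v + v ^ 2) / (s + v) ^ 2 := by positivity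
  linarith

/-- A chi-square variable deviates from its mean by more than `dev u k` with probability at
most `2 exp (-u)`. -/
lemma chiSq_two_sided {u : ℝ} (hu : 0 < u) (k : ℕ) :
    (chiSq k).real {x | ¬ |x - k| < dev u k} ≤ 2 * Real.exp (-u) := by
  have : {x : ℝ | ¬ |x - k| < dev u k} ⊆ {x | k + dev u k ≤ x} ∪ {x | x ≤ k - dev u k} := by
    intro x hx
    simp only [Set.mem_ofPred_eq, not_lt, le_abs, Set.mem_union] at hx ⊢
    rcases hx with h | h
    · left; linarith
    · right; linarith
  refine (measureReal_mono this).trans ((measureReal_union_le _ _).trans ?_)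
  linarith [chiSq_upper_tail hu k, chiSq_lower_tail hu k]

/-- Two-sided tail bound for a standard Gaussian variable. -/
lemma gaussianReal_two_sided {u : ℝ} (hu : 0 < u) :
    (gaussianReal 0 1).real {x | ¬ |x| < √(2 * u)} ≤ 2 * Real.exp (-u) := by
  set s := √(2 * u) with hs
  have hs0 : 0 ≤ s := Real.sqrt_nonneg _
  have hsu : u = s ^ 2 / 2 := by rw [hs, Real.sq_sqrt (by positivity)]; ring
  have hsub : {x : ℝ | ¬ |x| < s} ⊆ {x | s ≤ id x} ∪ {x | id x ≤ -s} := by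
    intro x hx
    simp only [Set.mem_ofPred_eq, not_lt, le_abs, Set.mem_union, id] at hx ⊢
    rcases hx with h | h
    · left; linarith
    · right; linarith
  have hm : ∀ t, mgf id (gaussianReal 0 1) t = Real.exp (t ^ 2 / 2) := fun t => by
    rw [mgf_gaussianReal (μ := 0) (v := 1) Measure.map_id]; simp
  have hint : ∀ t, Integrable (fun x => Real.exp (t * id x)) (gaussianReal 0 1) := fun t =>
    integrable_exp_mul_gaussianReal t
  have h1 := measure_ge_le_exp_mul_mgf s hs0 (hint s)
  have h2 := measure_le_le_exp_mul_mgf (-s) (neg_nonpos.2 hs0) (hint (-s))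
  rw [hm, ← Real.exp_add] at h1 h2
  have e1 : -s * s + s ^ 2 / 2 = -u := by rw [hsu]; ring
  have e2 : - -s * -s + (-s) ^ 2 / 2 = -u := by rw [hsu]; ring
  rw [e1] at h1; rw [e2] at h2
  refine (measureReal_mono hsub).trans ((measureReal_union_le _ _).trans ?_)
  linarith

section Gaussian

variable {E : Type*} [NormedAddCommGroup E] [InnerProductSpace ℝ E] [FiniteDimensional ℝ E]
  [MeasurableSpace E] [BorelSpace E]
variable {ι κ : Type*} [Fintype ι] [Fintype κ]

/-! ### Families of independent standard Gaussian vectors -/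

variable (ι E) in
/-- The law of a family of independent standard Gaussian vectors in `E`. -/
def gaussFamily : Measure (ι → E) := Measure.pi fun _ : ι => stdGaussian E

instance isProbabilityMeasure_gaussFamily : IsProbabilityMeasure (gaussFamily E ι) := by
  unfold gaussFamily; infer_instance

lemma integral_exp_inner_stdGaussian (t : E) :
    ∫ x, Complex.exp ((⟪x, t⟫ : ℝ) * Complex.I) ∂(stdGaussian E) =
      Complex.exp (-(‖t‖ ^ 2 : ℝ) / 2) := by
  rw [← charFun_apply, charFun_stdGaussian]; simp

lemma integral_exp_sum_inner_gaussFamily (t : ι → E) :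
    ∫ z, Complex.exp ((∑ i, ⟪z i, t i⟫ : ℝ) * Complex.I) ∂(gaussFamily E ι) =
      Complex.exp (-(∑ i, ‖t i‖ ^ 2 : ℝ) / 2) := by
  simp_rw [Complex.ofReal_sum, Finset.sum_mul, Complex.exp_sum]
  rw [gaussFamily, integral_fintype_prod_eq_prod
    (fun (i : ι) (z : E) => Complex.exp ((⟪z, t i⟫ : ℝ) * Complex.I))]
  simp_rw [integral_exp_inner_stdGaussian]
  rw [← Complex.exp_sum]
  congr 1
  rw [← Finset.sum_div, Finset.sum_neg_distrib]

/-- A linear combination of independent standard Gaussian vectors is a multiple of a standard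
Gaussian vector. -/
lemma map_sum_smul_gaussFamily (c : κ → ℝ) {s : ℝ} (hs : ∑ k, c k ^ 2 = s ^ 2) :
    (gaussFamily E κ).map (fun g => ∑ k, c k • g k) = (stdGaussian E).map (fun w => s • w) := by
  have : IsFiniteMeasure ((gaussFamily E κ).map (fun g => ∑ k, c k • g k)) :=
    Measure.isFiniteMeasure_map _ _
  have : IsFiniteMeasure ((stdGaussian E).map (fun w => s • w)) :=
    Measure.isFiniteMeasure_map _ _
  apply Measure.ext_of_charFun
  ext t
  rw [charFun_map_smul, charFun_apply, integral_map (Measurable.aemeasurable (by fun_prop))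
    (Measurable.aestronglyMeasurable (by fun_prop)), charFun_apply,
    integral_exp_inner_stdGaussian]
  have h := integral_exp_sum_inner_gaussFamily (E := E) (fun k => c k • t)
  simp only [sum_inner, real_inner_smul_left]
  simp only [real_inner_smul_right, norm_smul, mul_pow, Real.norm_eq_abs, sq_abs] at h ⊢
  rw [h, ← Finset.sum_mul, hs]

/-- A standard Gaussian vector is the sum of the components in a subspace and in its orthogonal
complement of two independent standard Gaussian vectors. -/
lemma map_proj_add_proj_stdGaussian (U : Submodule ℝ E) :
    ((stdGaussian E).prod (stdGaussian E)).map
      (fun p => U.starProjection p.1 + Uᗮ.starProjection p.2) = stdGaussian E := by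
  have : IsFiniteMeasure (((stdGaussian E).prod (stdGaussian E)).map
      (fun p => U.starProjection p.1 + Uᗮ.starProjection p.2)) :=
    Measure.isFiniteMeasure_map _ _
  apply Measure.ext_of_charFun
  ext t
  rw [charFun_apply, integral_map (Measurable.aemeasurable (by fun_prop))
    (Measurable.aestronglyMeasurable (by fun_prop)), charFun_apply,
    integral_exp_inner_stdGaussian]
  simp only [inner_add_left, Submodule.inner_starProjection_left_eq_right, Complex.ofReal_add,
    add_mul, Complex.exp_add]
  rw [integral_prod_mul (fun x : E => Complex.exp ((⟪x, U.starProjection t⟫ : ℝ) * Complex.I))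
    (fun x : E => Complex.exp ((⟪x, Uᗮ.starProjection t⟫ : ℝ) * Complex.I)),
    integral_exp_inner_stdGaussian, integral_exp_inner_stdGaussian, ← Complex.exp_add]
  congr 1
  have h := Submodule.norm_sq_eq_add_norm_sq_starProjection t U
  rw [h]; push_cast; ring

lemma map_proj_add_proj_gaussFamily (U : Submodule ℝ E) :
    ((gaussFamily E κ).prod (gaussFamily E κ)).map
      (fun p k => U.starProjection (p.1 k) + Uᗮ.starProjection (p.2 k)) = gaussFamily E κ := by
  have h1 := measurePreserving_arrowProdEquivProdArrow E E κ (fun _ => stdGaussian E)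
    (fun _ => stdGaussian E)
  have h2 : MeasurePreserving (fun (p : κ → E × E) k =>
      U.starProjection (p k).1 + Uᗮ.starProjection (p k).2)
      (Measure.pi fun _ : κ => (stdGaussian E).prod (stdGaussian E)) (gaussFamily E κ) :=
    measurePreserving_pi _ _ fun _ => ⟨by fun_prop, map_proj_add_proj_stdGaussian U⟩
  rw [gaussFamily, ← h1.map_eq, Measure.map_map (by fun_prop) (by fun_prop)]
  exact h2.map_eq

/-- The law of the squared length of the projection of a standard Gaussian vector. -/
lemma map_norm_sq_starProjection_stdGaussian (U : Submodule ℝ E) :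
    (stdGaussian E).map (fun w => ‖U.starProjection w‖ ^ 2) = chiSq (finrank ℝ U) := by
  have h1 : (stdGaussian E).map (fun w => U.orthogonalProjectionOnto w) = stdGaussian U := by
    have : IsFiniteMeasure ((stdGaussian E).map (fun w => U.orthogonalProjectionOnto w)) :=
      Measure.isFiniteMeasure_map _ _
    apply Measure.ext_of_charFun
    ext t
    rw [charFun_stdGaussian, charFun_apply,
      integral_map (Measurable.aemeasurable (by fun_prop))
        (Measurable.aestronglyMeasurable (by fun_prop))]
    simp only [Submodule.inner_orthogonalProjectionOnto_eq_of_mem_right]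
    rw [integral_exp_inner_stdGaussian]
    simp
  rw [chiSq, ← stdGaussian_map (stdOrthonormalBasis ℝ U).repr, ← h1,
    Measure.map_map (by fun_prop) (by fun_prop), Measure.map_map (by fun_prop) (by fun_prop)]
  congr 1
  ext w
  simp

/-- Orthogonal recombinations preserve the law of a family of independent standard Gaussian
vectors. -/
lemma map_orthonormalBasis_gaussFamily (b : OrthonormalBasis ι ℝ (EuclideanSpace ℝ ι)) :
    (gaussFamily E ι).map (fun z i => ∑ l, b i l • z l) = gaussFamily E ι := by
  have : IsFiniteMeasure ((gaussFamily E ι).map (fun z i => ∑ l, b i l • z l)) :=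
    Measure.isFiniteMeasure_map _ _
  rw [eq_comm, gaussFamily, eq_comm]
  refine charFun_eq_pi_iff.1 fun t => ?_
  rw [charFun_apply, integral_map (Measurable.aemeasurable (by fun_prop))
    (Measurable.aestronglyMeasurable (by fun_prop)),
    integral_map (Measurable.aemeasurable (by fun_prop))
    (Measurable.aestronglyMeasurable (by fun_prop))]
  have h := integral_exp_sum_inner_gaussFamily (E := E) (fun l => ∑ i, b i l • t i)
  simp only [inner_sum, real_inner_smul_right] at h
  simp only [PiLp.inner_apply, sum_inner, real_inner_smul_left]
  rw [gaussFamily] at h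
  simp_rw [Finset.sum_comm (s := (Finset.univ : Finset ι)) (t := (Finset.univ : Finset ι))
    (f := fun i l => b i l * ⟪_, t i⟫)]
  rw [h]
  simp only [charFun_stdGaussian, ← Complex.exp_sum]
  congr 1
  classical
  have key : ∑ l, ‖∑ i, b i l • t i‖ ^ 2 = ∑ i, ‖t i‖ ^ 2 := by
    have hb : ∀ i j, ∑ l, b i l * b j l = if i = j then 1 else 0 := fun i j => by
      have := orthonormal_iff_ite.1 b.orthonormal i j
      rw [PiLp.inner_apply] at this
      simpa [mul_comm] using this
    simp_rw [← real_inner_self_eq_norm_sq, sum_inner, inner_sum, real_inner_smul_left,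
      real_inner_smul_right]
    rw [Finset.sum_comm]
    refine Finset.sum_congr rfl fun i _ => ?_
    rw [Finset.sum_comm]
    have : ∀ j, ∑ l, b i l * (b j l * ⟪t i, t j⟫) = if i = j then ⟪t i, t j⟫ else 0 := fun j => by
      simp_rw [← mul_assoc, ← Finset.sum_mul, hb]; split_ifs <;> simp
    simp [this]
  rw [key]
  push_cast
  rw [← Finset.sum_div, Finset.sum_neg_distrib]

/-! ### Resampling one vector of the family -/

variable [DecidableEq ι]

omit [NormedAddCommGroup E] [InnerProductSpace ℝ E] [FiniteDimensional ℝ E] [BorelSpace E]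
  [Fintype ι] in
lemma measurable_update_prod (i : ι) :
    Measurable fun p : (ι → E) × E => Function.update p.1 i p.2 := by
  refine measurable_pi_iff.2 fun j => ?_
  by_cases h : j = i
  · subst h; simpa using measurable_snd
  · simp only [Function.update_of_ne h]; fun_prop

/-- Replacing one member by an independent copy preserves the product law. This is how one
conditions on all vectors of the family but one. -/
lemma map_update_gaussFamily (i : ι) :
    ((gaussFamily E ι).prod (stdGaussian E)).map (fun p => Function.update p.1 i p.2) =
      gaussFamily E ι := by
  refine (Measure.pi_eq fun s hs => ?_).symm
  rw [Measure.map_apply (measurable_update_prod i) (MeasurableSet.univ_pi hs)]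
  have : (fun p : (ι → E) × E => Function.update p.1 i p.2) ⁻¹' (Set.univ.pi s) =
      (Set.univ.pi (Function.update s i Set.univ)) ×ˢ (s i) := by
    ext p
    simp only [Set.mem_preimage, Set.mem_pi, Set.mem_univ, true_implies, Set.mem_prod]
    constructor
    · intro h
      refine ⟨fun j => ?_, by simpa using h i⟩
      by_cases hj : j = i
      · subst hj; simp
      · simpa [Function.update_of_ne hj] using h j
    · rintro ⟨h1, h2⟩ j
      by_cases hj : j = i
      · subst hj; simpa using h2
      · simpa [Function.update_of_ne hj] using h1 j
  rw [this, Measure.prod_prod, gaussFamily, Measure.pi_pi,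
    ← Finset.mul_prod_erase _ _ (Finset.mem_univ i),
    ← Finset.mul_prod_erase Finset.univ (fun j => stdGaussian E (s j)) (Finset.mem_univ i)]
  have h3 : ∏ x ∈ Finset.univ.erase i, stdGaussian E (Function.update s i Set.univ x) =
      ∏ x ∈ Finset.univ.erase i, stdGaussian E (s x) :=
    Finset.prod_congr rfl fun x hx => by rw [Function.update_of_ne (Finset.ne_of_mem_erase hx)]
  rw [h3]
  simp [mul_comm]

lemma ae_gaussFamily_iff_ae_update (i : ι) {p : (ι → E) → Prop} (hp : MeasurableSet {z | p z}) :
    (∀ᵐ z ∂(gaussFamily E ι), p z) ↔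
      ∀ᵐ z ∂(gaussFamily E ι), ∀ᵐ w ∂(stdGaussian E), p (Function.update z i w) := by
  conv_lhs => rw [← map_update_gaussFamily i]
  rw [ae_map_iff (measurable_update_prod i).aemeasurable hp]
  exact Measure.ae_prod_iff_ae_ae ((measurable_update_prod i) hp)

/-- If the conditional law of φ given all vectors but the i-th is almost surely the fixed measure ν,
then ν is also the unconditional law. -/
lemma map_gaussFamily_eq_of_update (i : ι) {X : Type*} [MeasurableSpace X] {φ : (ι → E) → X}
    (hφ : Measurable φ) {ν : Measure X}
    (h : ∀ᵐ z ∂(gaussFamily E ι),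
      (stdGaussian E).map (fun w => φ (Function.update z i w)) = ν) :
    (gaussFamily E ι).map φ = ν := by
  ext s hs
  rw [← map_update_gaussFamily i, Measure.map_map hφ (measurable_update_prod i),
    Measure.map_apply (hφ.comp (measurable_update_prod i)) hs,
    Measure.prod_apply ((hφ.comp (measurable_update_prod i)) hs)]
  have : ∀ᵐ z ∂(gaussFamily E ι), stdGaussian E (Prod.mk z ⁻¹'
      (φ ∘ (fun p : (ι → E) × E => Function.update p.1 i p.2) ⁻¹' s)) = ν s := by
    filter_upwards [h] with z hz
    have hm : Measurable fun w => φ (Function.update z i w) :=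
      hφ.comp ((measurable_update_prod i).comp measurable_prodMk_left)
    rw [← hz, Measure.map_apply hm hs]
    rfl
  rw [lintegral_congr_ae this]
  simp

/-! ### Linear independence -/

/-- A proper subspace lies in the kernel of a nonzero linear form, which has a nondegenerate normal
law and hence no atom at 0. -/
lemma stdGaussian_submodule_eq_zero {U : Submodule ℝ E} (hU : U ≠ ⊤) :
    stdGaussian E (U : Set E) = 0 := by
  obtain ⟨v, hv, hv0⟩ : ∃ v ∈ Uᗮ, v ≠ 0 := by
    by_contra! h
    exact hU (Submodule.orthogonal_eq_bot_iff.1 ((Submodule.eq_bot_iff _).2 h))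
  have hsub : (U : Set E) ⊆ (fun x => ⟪v, x⟫) ⁻¹' {0} := fun x hx => by
    simpa using Submodule.inner_left_of_mem_orthogonal hx hv
  refine measure_mono_null hsub ?_
  rw [← Measure.map_apply (by fun_prop) (measurableSet_singleton 0)]
  have hg : HasGaussianLaw (fun x : E => ⟪v, x⟫) (stdGaussian E) :=
    (IsGaussian.hasGaussianLaw_id (μ := stdGaussian E)).map_fun (innerSL ℝ v)
  rw [hg.map_eq_gaussianReal]
  have hvar : Var[fun x : E => ⟪v, x⟫; stdGaussian E] = ‖v‖ ^ 2 := by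
    have := variance_dual_stdGaussian (E := E) (innerSL ℝ v)
    simpa using this
  rw [hvar]
  have : NullSingletonClass (gaussianReal ((stdGaussian E)[fun x : E => ⟪v, x⟫]) (‖v‖ ^ 2).toNNReal) :=
    nullSingletonClass_gaussianReal (by simpa using hv0)
  exact measure_singleton 0

lemma measurable_gram_det (P : E →L[ℝ] E) (s : Finset ι) :
    Measurable fun z : ι → E => (gram ℝ (fun i : s => P (z i))).det := by
  apply Continuous.measurable
  apply Continuous.matrix_det
  refine continuous_matrix fun i j => ?_
  simp only [gram_apply]
  fun_prop

/-- Linear independence means that the Gram determinant, a continuous function of the family, does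
not vanish. -/
lemma measurableSet_linearIndepOn (P : E →L[ℝ] E) (s : Finset ι) :
    MeasurableSet {z : ι → E | LinearIndepOn ℝ (fun i => P (z i)) (s : Set ι)} := by
  have : {z : ι → E | LinearIndepOn ℝ (fun i => P (z i)) (s : Set ι)} =
      {z | (gram ℝ (fun i : s => P (z i))).det ≠ 0} := by
    ext z
    exact (det_gram_ne_zero_iff_linearIndependent (𝕜 := ℝ) (v := fun i : s => P (z i))).symm
  rw [this]
  exact (measurable_gram_det P s) (measurableSet_singleton 0).compl

/-- Projections of independent standard Gaussian vectors onto a subspace of large enough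
dimension are linearly independent almost surely. -/
lemma ae_linearIndepOn (F : Submodule ℝ E) (s : Finset ι) (hs : s.card ≤ finrank ℝ F) :
    ∀ᵐ z ∂(gaussFamily E ι), LinearIndepOn ℝ (fun i => F.starProjection (z i)) (s : Set ι) := by
  induction s using Finset.induction_on with
  | empty => simp
  | insert i s hi ih =>
    have hc : s.card < finrank ℝ F := by
      rw [Finset.card_insert_of_notMem hi] at hs; omega
    rw [ae_gaussFamily_iff_ae_update i (measurableSet_linearIndepOn _ _)]
    filter_upwards [ih hc.le] with z hz
    set V := Submodule.span ℝ ((fun j => F.starProjection (z j)) '' (s : Set ι)) with hV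
    classical
    have hVc : finrank ℝ V ≤ s.card := by
      rw [hV, ← Finset.coe_image]
      exact (finrank_span_finset_le_card _).trans Finset.card_image_le
    -- The vectors already treated span a space V of dimension smaller than that of F, so the
    -- vectors that F projects into V form a proper subspace. The resampled vector avoids it almost
    -- surely.
    have hne : V.comap (F.starProjection : E →ₗ[ℝ] E) ≠ ⊤ := by
      intro h
      have : F ≤ V := fun x hx => by
        have h2 : x ∈ V.comap (F.starProjection : E →ₗ[ℝ] E) := by rw [h]; trivial
        have h3 : F.starProjection x ∈ V := h2
        rwa [Submodule.starProjection_eq_self_iff.2 hx] at h3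
      have := Submodule.finrank_mono this
      omega
    have h0 := stdGaussian_submodule_eq_zero hne
    rw [← compl_compl ((V.comap (F.starProjection : E →ₗ[ℝ] E) : Submodule ℝ E) : Set E)] at h0
    filter_upwards [mem_ae_iff.2 h0] with w hw
    have hw' : F.starProjection w ∉ V := hw
    have heq : Set.EqOn (fun j => F.starProjection (z j))
        (fun j => F.starProjection (Function.update z i w j)) (s : Set ι) := fun j hj => by
      have : j ≠ i := fun h => hi (h ▸ hj)
      simp [Function.update_of_ne this]
    rw [Finset.coe_insert, linearIndepOn_insert (by simpa using hi)]
    refine ⟨hz.congr heq, ?_⟩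
    rw [← heq.image_eq]
    simpa using hw'

lemma ae_linearIndependent (F : Submodule ℝ E) (h : Fintype.card ι ≤ finrank ℝ F) :
    ∀ᵐ z ∂(gaussFamily E ι), LinearIndependent ℝ (fun i => F.starProjection (z i)) := by
  filter_upwards [ae_linearIndepOn F Finset.univ (by simpa using h)] with z hz
  simpa [linearIndepOn_univ_iff] using hz

end Gaussian

section Coef

variable {E : Type*} [NormedAddCommGroup E] [InnerProductSpace ℝ E]
variable {ι : Type*} [Fintype ι] [DecidableEq ι]

/-! ### Least-squares coefficients -/

/-- The coefficients of the least-squares approximation of `w` by linear combinations of `z`. -/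
def coef (z : ι → E) (w : E) : EuclideanSpace ℝ ι :=
  WithLp.toLp 2 ((gram ℝ z)⁻¹ *ᵥ fun i => ⟪z i, w⟫)

lemma coef_add (z : ι → E) (v w : E) : coef z (v + w) = coef z v + coef z w := by
  have : (fun i => ⟪z i, v + w⟫) = (fun i => ⟪z i, v⟫) + fun i => ⟪z i, w⟫ := by
    ext i; simp [inner_add_right]
  rw [coef, this, mulVec_add]; rfl

lemma coef_smul (z : ι → E) (c : ℝ) (w : E) : coef z (c • w) = c • coef z w := by
  have : (fun i => ⟪z i, c • w⟫) = c • fun i => ⟪z i, w⟫ := by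
    ext i; simp [real_inner_smul_right]
  rw [coef, this, mulVec_smul]; rfl

lemma coef_sub (z : ι → E) (v w : E) : coef z (v - w) = coef z v - coef z w := by
  rw [sub_eq_add_neg, ← neg_one_smul ℝ w, coef_add, coef_smul, neg_one_smul, sub_eq_add_neg]

lemma coef_eq_of_inner_eq {z : ι → E} {v w : E} (h : ∀ i, ⟪z i, v⟫ = ⟪z i, w⟫) :
    coef z v = coef z w := by
  rw [coef, coef, funext h]

lemma coef_eq_zero {z : ι → E} {w : E} (h : ∀ i, ⟪z i, w⟫ = 0) : coef z w = 0 := by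
  have : (fun i => ⟪z i, w⟫) = 0 := funext h
  rw [coef, this, mulVec_zero]; rfl

omit [DecidableEq ι] in
lemma gram_mulVec_apply (z : ι → E) (c : ι → ℝ) (i : ι) :
    (gram ℝ z *ᵥ c) i = ⟪z i, ∑ j, c j • z j⟫ := by
  simp [mulVec, dotProduct, gram_apply, inner_sum, real_inner_smul_right, mul_comm]

lemma isUnit_det_gram {z : ι → E} (hz : LinearIndependent ℝ z) : IsUnit (gram ℝ z).det :=
  isUnit_iff_ne_zero.2 (det_gram_ne_zero_iff_linearIndependent.2 hz)

lemma gram_mul_inv {z : ι → E} (hz : LinearIndependent ℝ z) : gram ℝ z * (gram ℝ z)⁻¹ = 1 :=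
  mul_nonsing_inv _ (isUnit_det_gram hz)

lemma inv_mul_gram {z : ι → E} (hz : LinearIndependent ℝ z) : (gram ℝ z)⁻¹ * gram ℝ z = 1 :=
  nonsing_inv_mul _ (isUnit_det_gram hz)

lemma coef_sum_smul {z : ι → E} (hz : LinearIndependent ℝ z) (c : ι → ℝ) :
    coef z (∑ j, c j • z j) = WithLp.toLp 2 c := by
  have : (fun i => ⟪z i, ∑ j, c j • z j⟫) = gram ℝ z *ᵥ c :=
    funext fun i => (gram_mulVec_apply z c i).symm
  rw [coef, this, mulVec_mulVec, inv_mul_gram hz, one_mulVec]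

lemma inner_sum_coef {z : ι → E} (hz : LinearIndependent ℝ z) (w : E) (i : ι) :
    ⟪z i, ∑ j, coef z w j • z j⟫ = ⟪z i, w⟫ := by
  rw [← gram_mulVec_apply z (fun j => coef z w j)]
  change (gram ℝ z *ᵥ ((gram ℝ z)⁻¹ *ᵥ fun i => ⟪z i, w⟫)) i = _
  rw [mulVec_mulVec, gram_mul_inv hz, one_mulVec]

lemma gram_inv_transpose (z : ι → E) : ((gram ℝ z)⁻¹)ᵀ = (gram ℝ z)⁻¹ := by
  rw [transpose_nonsing_inv]
  congr 1
  ext i j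
  simp [gram_apply, real_inner_comm]

/-- The adjoint of the coefficient map. For fixed independent z and standard Gaussian w it shows,
with `norm_sq_sum_gram_inv`, that the inner product of the coefficients with g is centered normal
with variance `gramInvForm z g`. -/
lemma inner_coef (z : ι → E) (w : E) (g : EuclideanSpace ℝ ι) :
    ⟪coef z w, g⟫ = ⟪w, ∑ i, ((gram ℝ z)⁻¹ *ᵥ g.ofLp) i • z i⟫ := by
  simp only [inner_sum, real_inner_smul_right]
  have h1 : ⟪coef z w, g⟫ = g.ofLp ⬝ᵥ ((gram ℝ z)⁻¹ *ᵥ fun i => ⟪z i, w⟫) := by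
    simp [coef, EuclideanSpace.inner_eq_star_dotProduct]
  rw [h1, dotProduct_mulVec, ← mulVec_transpose, gram_inv_transpose]
  simp [dotProduct, real_inner_comm]

/-- The value at `g` of the quadratic form of the inverse Gram matrix. -/
def gramInvForm (z : ι → E) (g : EuclideanSpace ℝ ι) : ℝ :=
  g.ofLp ⬝ᵥ ((gram ℝ z)⁻¹ *ᵥ g.ofLp)

lemma norm_sq_sum_gram_inv {z : ι → E} (hz : LinearIndependent ℝ z) (g : EuclideanSpace ℝ ι) :
    ‖∑ i, ((gram ℝ z)⁻¹ *ᵥ g.ofLp) i • z i‖ ^ 2 = gramInvForm z g := by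
  rw [← real_inner_self_eq_norm_sq]
  have h := star_dotProduct_gram_mulVec (𝕜 := ℝ) z ((gram ℝ z)⁻¹ *ᵥ g.ofLp)
    ((gram ℝ z)⁻¹ *ᵥ g.ofLp)
  rw [← h, mulVec_mulVec, gram_mul_inv hz, one_mulVec, gramInvForm, star_trivial,
    dotProduct_comm]

lemma gramInvForm_smul (z : ι → E) (c : ℝ) (g : EuclideanSpace ℝ ι) :
    gramInvForm z (c • g) = c ^ 2 * gramInvForm z g := by
  simp [gramInvForm, mulVec_smul]; ring

/-- An orthogonal recombination B of the vectors turns the Gram matrix into B (gram z) Bᵀ, hence its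
inverse into B (gram z)⁻¹ Bᵀ. As the law of the family is invariant under B, any unit direction can
be reduced to a coordinate direction. -/
lemma gramInvForm_orthonormalBasis (z : ι → E) (b : OrthonormalBasis ι ℝ (EuclideanSpace ℝ ι))
    (i : ι) :
    gramInvForm (fun j => ∑ l, b j l • z l) (EuclideanSpace.single i 1) = gramInvForm z (b i) := by
  set B : Matrix ι ι ℝ := Matrix.of fun j l => b j l with hB
  have hBB : B * Bᵀ = 1 := by
    ext j l
    have := orthonormal_iff_ite.1 b.orthonormal j l
    rw [PiLp.inner_apply] at this
    simp only [hB, mul_apply, of_apply, transpose_apply, one_apply]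
    rw [← this]
    exact Finset.sum_congr rfl fun k _ => by simp [mul_comm]
  have hB' : Bᵀ * B = 1 := mul_eq_one_comm.1 hBB
  have hg : gram ℝ (fun j => ∑ l, b j l • z l) = B * gram ℝ z * Bᵀ := by
    ext j l
    simp only [gram_apply, mul_apply, sum_inner, inner_sum, real_inner_smul_left,
      real_inner_smul_right, transpose_apply, hB, of_apply, Finset.sum_mul]
    exact Finset.sum_congr rfl fun k _ => Finset.sum_congr rfl fun k' _ => by
      rw [real_inner_comm]; ring
  have hinv : (B * gram ℝ z * Bᵀ)⁻¹ = B * (gram ℝ z)⁻¹ * Bᵀ := by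
    rw [Matrix.mul_inv_rev, Matrix.mul_inv_rev, inv_eq_left_inv hBB, inv_eq_left_inv hB',
      Matrix.mul_assoc]
  rw [gramInvForm, hg, hinv, gramInvForm]
  have e1 : Bᵀ *ᵥ (EuclideanSpace.single i (1 : ℝ)).ofLp = (b i).ofLp := by
    ext l
    simp [mulVec, dotProduct, hB]
  rw [← mulVec_mulVec, ← mulVec_mulVec, dotProduct_mulVec, ← mulVec_transpose, e1]

/-- A diagonal entry of the inverse Gram matrix is the inverse squared distance of a vector from
the span of the other ones. -/
lemma gramInvForm_single {F : Submodule ℝ E} [FiniteDimensional ℝ E] {z : ι → E}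
    (hz : LinearIndependent ℝ fun j => F.starProjection (z j)) (i : ι) :
    gramInvForm (fun j => F.starProjection (z j)) (EuclideanSpace.single i 1) =
      (‖((Submodule.span ℝ ((fun j => F.starProjection (z j)) '' {i}ᶜ))ᗮ ⊓ F).starProjection
        (z i)‖ ^ 2)⁻¹ := by
  set y := fun j => F.starProjection (z j) with hy
  set V := Submodule.span ℝ (y '' {i}ᶜ) with hV
  -- The vector f below is the i-th element of the basis dual to y, with ‖f‖² = a i. The projection
  -- of z i onto the part of F orthogonal to the other vectors is (a i)⁻¹ • f, of squared length (a
  -- i)⁻¹.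
  set a := (gram ℝ y)⁻¹ *ᵥ (EuclideanSpace.single i (1 : ℝ)).ofLp with ha
  set f := ∑ j, a j • y j with hf
  have hq : ‖f‖ ^ 2 = gramInvForm y (EuclideanSpace.single i 1) := norm_sq_sum_gram_inv hz _
  have hqa : gramInvForm y (EuclideanSpace.single i 1) = a i := by
    rw [gramInvForm, ← ha]; simp
  have hyf : ∀ j, ⟪y j, f⟫ = if j = i then 1 else 0 := fun j => by
    rw [hf, ← gram_mulVec_apply y a, ha, mulVec_mulVec, gram_mul_inv hz, one_mulVec]
    simp
  have hyF : ∀ j, y j ∈ F := fun j => Submodule.starProjection_apply_mem _ _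
  have hfF : f ∈ F := Submodule.sum_mem _ fun j _ => F.smul_mem _ (hyF j)
  have hfV : f ∈ Vᗮ := by
    rw [hV, Submodule.mem_orthogonal]
    intro u hu
    induction hu using Submodule.span_induction with
    | mem u hu =>
      obtain ⟨j, hj, rfl⟩ := hu
      rw [hyf, if_neg (by simpa using hj)]
    | zero => simp
    | add u v _ _ hu hv => rw [inner_add_left, hu, hv, add_zero]
    | smul c u _ hu => rw [real_inner_smul_left, hu, mul_zero]
  have hai : a i ≠ 0 := by
    intro h0
    have : f = 0 := by
      have h1 : ‖f‖ ^ 2 = 0 := by rw [hq, hqa, h0]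
      simpa using h1
    have h2 := hyf i
    rw [this] at h2
    simp at h2
  have hproj : (Vᗮ ⊓ F).starProjection (z i) = (a i)⁻¹ • f := by
    refine Submodule.eq_starProjection_of_mem_of_inner_eq_zero
      (Submodule.smul_mem _ _ ⟨hfV, hfF⟩) ?_
    intro w hw
    have h1 : ⟪z i - y i, w⟫ = 0 := by
      have := Submodule.sub_starProjection_mem_orthogonal (K := F) (z i)
      exact Submodule.inner_left_of_mem_orthogonal hw.2 this
    have h2 : y i - (a i)⁻¹ • f ∈ V := by
      have : y i - (a i)⁻¹ • f = -((a i)⁻¹ • ∑ j ∈ Finset.univ.erase i, a j • y j) := by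
        rw [hf, ← Finset.add_sum_erase _ _ (Finset.mem_univ i), smul_add, smul_smul,
          inv_mul_cancel₀ hai, one_smul]
        abel
      rw [this]
      refine V.neg_mem (V.smul_mem _ (V.sum_mem fun j hj => V.smul_mem _ ?_))
      exact Submodule.subset_span ⟨j, by simpa using hj, rfl⟩
    have h3 : ⟪y i - (a i)⁻¹ • f, w⟫ = 0 := Submodule.inner_right_of_mem_orthogonal h2 hw.1
    have : z i - (a i)⁻¹ • f = (z i - y i) + (y i - (a i)⁻¹ • f) := by abel
    rw [this, inner_add_left, h1, h3, add_zero]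
  rw [hproj, norm_smul, mul_pow, hq, hqa, norm_inv, Real.norm_eq_abs, inv_pow, sq_abs]
  field_simp

end Coef

/-! ### Random inverse Gram matrices and the multivariate t-law of regression coefficients -/

section Law

variable {E : Type*} [NormedAddCommGroup E] [InnerProductSpace ℝ E] [FiniteDimensional ℝ E]
  [MeasurableSpace E] [BorelSpace E]
variable {ι : Type*} [Fintype ι] [DecidableEq ι]

lemma measurable_gram_inv (i j : ι) : Measurable fun z : ι → E => (gram ℝ z)⁻¹ i j := by
  have hc : Continuous fun z : ι → E => gram ℝ z :=
    continuous_matrix fun i j => by simp only [gram_apply]; fun_prop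
  simp only [inv_def, Matrix.smul_apply, smul_eq_mul, Ring.inverse_eq_inv']
  refine (hc.matrix_det.measurable.inv).mul ?_
  exact ((continuous_apply_apply i j).comp hc.matrix_adjugate).measurable

@[fun_prop]
lemma measurable_coef {X : Type*} [MeasurableSpace X] {z : X → ι → E} {w : X → E}
    (hz : Measurable z) (hw : Measurable w) : Measurable fun x => coef (z x) (w x) := by
  refine (PiLp.continuous_toLp 2 _).measurable.comp (measurable_pi_iff.2 fun i => ?_)
  simp only [mulVec, dotProduct]
  refine Finset.measurable_sum _ fun j _ => ?_
  have : Measurable fun x => z x j := (measurable_pi_apply j).comp hz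
  exact ((measurable_gram_inv i j).comp hz).mul (by fun_prop)

lemma measurable_gramInvForm (P : E →L[ℝ] E) (g : EuclideanSpace ℝ ι) :
    Measurable fun z : ι → E => gramInvForm (fun i => P (z i)) g := by
  simp only [gramInvForm, mulVec, dotProduct]
  have hP : Measurable fun z : ι → E => fun i => P (z i) := by fun_prop
  refine Finset.measurable_sum _ fun i _ => measurable_const.mul
    (Finset.measurable_sum _ fun j _ => ((measurable_gram_inv i j).comp hP).mul measurable_const)

/-- Given the other vectors, the form is the inverse squared length of the projection of z i onto
the orthogonal complement in F of their span. That span has dimension one less than the size of the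
family, whence the + 1 in the degrees of freedom. The conditional law does not depend on the
condition. -/
lemma map_gramInvForm_single (F : Submodule ℝ E) (h : Fintype.card ι ≤ finrank ℝ F) (i : ι) :
    (gaussFamily E ι).map
      (fun z => gramInvForm (fun j => F.starProjection (z j)) (EuclideanSpace.single i 1)) =
      (chiSq (finrank ℝ F - Fintype.card ι + 1)).map (fun x => x⁻¹) := by
  have hli := ae_linearIndependent (ι := ι) F h
  have hms : MeasurableSet {z : ι → E | LinearIndependent ℝ (fun i => F.starProjection (z i))} := by
    have := measurableSet_linearIndepOn F.starProjection (Finset.univ : Finset ι)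
    simpa [linearIndepOn_univ_iff] using this
  have hli' := (ae_gaussFamily_iff_ae_update i hms).1 hli
  refine map_gaussFamily_eq_of_update i (measurable_gramInvForm _ _) ?_
  filter_upwards [hli, hli'] with z hz hz'
  set V := Submodule.span ℝ ((fun j => F.starProjection (z j)) '' {i}ᶜ) with hV
  have himg : ∀ w, (fun j => F.starProjection (Function.update z i w j)) '' {i}ᶜ =
      (fun j => F.starProjection (z j)) '' {i}ᶜ := fun w =>
    Set.image_congr fun j hj => by
      rw [Function.update_of_ne (by simpa using hj)]
  have hVF : V ≤ F := by
    rw [hV, Submodule.span_le]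
    rintro _ ⟨j, _, rfl⟩
    exact Submodule.starProjection_apply_mem _ _
  have hVd : finrank ℝ V = Fintype.card ι - 1 := by
    have h1 := hz.comp (Subtype.val : ({i}ᶜ : Set ι) → ι) Subtype.val_injective
    have h2 := finrank_span_eq_card h1
    rw [Set.range_comp, Subtype.range_coe] at h2
    rw [hV, h2, Fintype.card_compl_set]
    simp
  have hW : finrank ℝ (Vᗮ ⊓ F : Submodule ℝ E) = finrank ℝ F - Fintype.card ι + 1 := by
    have h1 := Submodule.finrank_add_inf_finrank_orthogonal hVF
    have h2 : 0 < Fintype.card ι := Fintype.card_pos_iff.2 ⟨i⟩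
    omega
  rw [← hW, ← map_norm_sq_starProjection_stdGaussian, Measure.map_map (by fun_prop) (by fun_prop)]
  refine Measure.map_congr ?_
  filter_upwards [hz'] with w hw
  rw [gramInvForm_single hw i, himg w]
  simp [hV]

/-- Extend g to an orthonormal basis and recombine the family accordingly: the law is unchanged and
g becomes a coordinate vector. -/
lemma map_gramInvForm_unit (F : Submodule ℝ E) (h : Fintype.card ι ≤ finrank ℝ F)
    {g : EuclideanSpace ℝ ι} (hg : ‖g‖ = 1) :
    (gaussFamily E ι).map (fun z => gramInvForm (fun j => F.starProjection (z j)) g) =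
      (chiSq (finrank ℝ F - Fintype.card ι + 1)).map (fun x => x⁻¹) := by
  obtain ⟨i⟩ : Nonempty ι := by
    by_contra hne
    rw [not_nonempty_iff] at hne
    have : g = 0 := Subsingleton.elim _ _
    simp [this] at hg
  obtain ⟨b, hb⟩ := Orthonormal.exists_orthonormalBasis_extension_of_card_eq (𝕜 := ℝ)
    (E := EuclideanSpace ℝ ι) (ι := ι) (by simp) (v := fun _ => g) (s := {i}) (by
      rw [orthonormal_iff_ite]
      intro a b
      have : a = b := Subsingleton.elim _ _
      simp [this, hg])
  have hbi : b i = g := hb i rfl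
  rw [← map_gramInvForm_single F h i]
  conv_rhs => rw [← map_orthonormalBasis_gaussFamily b]
  rw [Measure.map_map (measurable_gramInvForm _ _) (by fun_prop)]
  congr 1
  ext z
  rw [← hbi, ← gramInvForm_orthonormalBasis]
  simp

lemma integrable_exp_ofReal_mul_I {X : Type*} [MeasurableSpace X] (μ : Measure X)
    [IsFiniteMeasure μ] {φ : X → ℝ} (hφ : Measurable φ) :
    Integrable (fun x => Complex.exp ((φ x : ℝ) * Complex.I)) μ := by
  refine Integrable.of_bound (C := 1) (Measurable.aestronglyMeasurable (by fun_prop)) ?_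
  exact Filter.Eventually.of_forall fun x => by rw [Complex.norm_exp_ofReal_mul_I]

lemma chiSq_ae_nonneg (k : ℕ) : ∀ᵐ x ∂(chiSq k), 0 ≤ x := by
  rw [chiSq, ae_map_iff (Measurable.aemeasurable (by fun_prop)) measurableSet_Ici]
  exact Filter.Eventually.of_forall fun x => by positivity

/-- The least-squares coefficients in a regression of an independent standard Gaussian vector on
standard Gaussian vectors, all of them projected onto a subspace, have a multivariate
`t`-distribution. -/
lemma map_coef_eq (F : Submodule ℝ E) (h : Fintype.card ι ≤ finrank ℝ F) [Nonempty ι] :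
    ((gaussFamily E ι).prod (stdGaussian E)).map
      (fun p => coef (fun i => F.starProjection (p.1 i)) p.2) =
    ((chiSq (finrank ℝ F - Fintype.card ι + 1)).prod
      (stdGaussian (EuclideanSpace ℝ ι))).map (fun p => (√p.1)⁻¹ • p.2) := by
  set K := finrank ℝ F - Fintype.card ι + 1 with hK
  have hm : Measurable fun p : (ι → E) × E => coef (fun i => F.starProjection (p.1 i)) p.2 := by
    fun_prop
  have : IsFiniteMeasure (((gaussFamily E ι).prod (stdGaussian E)).map
      (fun p => coef (fun i => F.starProjection (p.1 i)) p.2)) := Measure.isFiniteMeasure_map _ _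
  have : IsFiniteMeasure (((chiSq K).prod
      (stdGaussian (EuclideanSpace ℝ ι))).map (fun p => (√p.1)⁻¹ • p.2)) :=
    Measure.isFiniteMeasure_map _ _
  apply Measure.ext_of_charFun
  ext g
  obtain ⟨e, he, hge⟩ : ∃ e : EuclideanSpace ℝ ι, ‖e‖ = 1 ∧ g = ‖g‖ • e := by
    by_cases hg : g = 0
    · obtain ⟨e, he⟩ := exists_norm_eq (EuclideanSpace ℝ ι) (zero_le_one' ℝ)
      exact ⟨e, he, by simp [hg]⟩
    · refine ⟨‖g‖⁻¹ • g, norm_smul_inv_norm hg, ?_⟩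
      rw [smul_smul, mul_inv_cancel₀ (norm_ne_zero_iff.2 hg), one_smul]
  rw [charFun_apply, charFun_apply, integral_map hm.aemeasurable
    (Measurable.aestronglyMeasurable (by fun_prop)),
    integral_map (Measurable.aemeasurable (by fun_prop))
    (Measurable.aestronglyMeasurable (by fun_prop))]
  rw [integral_prod _ (integrable_exp_ofReal_mul_I _ (φ := fun p : (ι → E) × E =>
      ⟪coef (fun i => F.starProjection (p.1 i)) p.2, g⟫) (by fun_prop)),
    integral_prod _ (integrable_exp_ofReal_mul_I _ (φ := fun p : ℝ × EuclideanSpace ℝ ι => ⟪(√p.1)⁻¹ • p.2, g⟫)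
      (by fun_prop))]
  -- Both characteristic functions are computed conditionally. Given z, the linear form is normal
  -- with variance ‖g‖² times the inverse Gram form at e; given the chi-square variable x, with
  -- variance ‖g‖² / x. The two mixing variables have the same law by `map_gramInvForm_unit`.
  have h1 : ∀ᵐ z ∂(gaussFamily E ι), ∫ w, Complex.exp
      ((⟪coef (fun i => F.starProjection (z i)) w, g⟫ : ℝ) * Complex.I) ∂(stdGaussian E) =
      Complex.exp (-(‖g‖ ^ 2 *
        gramInvForm (fun j => F.starProjection (z j)) e : ℝ) / 2) := by
    filter_upwards [ae_linearIndependent (ι := ι) F h] with z hz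
    simp_rw [inner_coef]
    rw [integral_exp_inner_stdGaussian, norm_sq_sum_gram_inv hz, ← gramInvForm_smul, ← hge]
  have h2 : ∀ᵐ x ∂(chiSq K), ∫ w, Complex.exp
      ((⟪(√x)⁻¹ • w, g⟫ : ℝ) * Complex.I) ∂(stdGaussian (EuclideanSpace ℝ ι)) =
      Complex.exp (-(‖g‖ ^ 2 * x⁻¹ : ℝ) / 2) := by
    filter_upwards [chiSq_ae_nonneg K] with x hx
    simp_rw [real_inner_smul_left, ← real_inner_smul_right]
    rw [integral_exp_inner_stdGaussian, norm_smul, mul_pow, norm_inv, Real.norm_eq_abs, inv_pow,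
      sq_abs, Real.sq_sqrt hx, mul_comm]
  rw [integral_congr_ae h1, integral_congr_ae h2]
  have h3 : ∀ y : ℝ, Complex.exp (-(‖g‖ ^ 2 * y⁻¹ : ℝ) / 2) =
    (fun t : ℝ => Complex.exp (-(‖g‖ ^ 2 * t : ℝ) / 2)) y⁻¹ := fun _ => rfl
  have hmt : Measurable (fun t : ℝ => Complex.exp (-(‖g‖ ^ 2 * t : ℝ) / 2)) := by fun_prop
  rw [← integral_map (φ := fun x : ℝ => x⁻¹) (by fun_prop) (f := fun t : ℝ =>
      Complex.exp (-(‖g‖ ^ 2 * t : ℝ) / 2)) hmt.aestronglyMeasurable, hK,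
    ← map_gramInvForm_unit F h he,
    integral_map (measurable_gramInvForm _ _).aemeasurable hmt.aestronglyMeasurable]

end Law

/-! ### Tail bounds in Euclidean spaces -/

/-- `exp (-u)` as an extended nonnegative real. -/
def tailProb (u : ℝ) : ℝ≥0∞ := ENNReal.ofReal (Real.exp (-u))

lemma le_tailProb_of_real {X : Type*} [MeasurableSpace X] {μ : Measure X} [IsFiniteMeasure μ]
    {s : Set X} {u c : ℝ} (hc : 0 ≤ c) (h : μ.real s ≤ c * Real.exp (-u)) :
    μ s ≤ ENNReal.ofReal c * tailProb u := by
  rw [tailProb, ← ENNReal.ofReal_mul hc, ← ofReal_measureReal]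
  exact ENNReal.ofReal_le_ofReal h

lemma measurableSet_not_lt {X : Type*} [MeasurableSpace X] {f g : X → ℝ} (hf : Measurable f)
    (hg : Measurable g) : MeasurableSet {x | ¬ f x < g x} := (measurableSet_lt hf hg).compl

lemma measurableSet_not_le {X : Type*} [MeasurableSpace X] {f g : X → ℝ} (hf : Measurable f)
    (hg : Measurable g) : MeasurableSet {x | ¬ f x ≤ g x} := (measurableSet_le hf hg).compl

lemma chiSq_tail {u : ℝ} (hu : 0 < u) (k : ℕ) :
    chiSq k {x | ¬ |x - k| < dev u k} ≤ 2 * tailProb u := by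
  simpa using le_tailProb_of_real zero_le_two (chiSq_two_sided hu k)

section

variable {E : Type*} [NormedAddCommGroup E] [InnerProductSpace ℝ E] [FiniteDimensional ℝ E]
  [MeasurableSpace E] [BorelSpace E]

lemma norm_sq_starProjection_tail {u : ℝ} (hu : 0 < u) (U : Submodule ℝ E) :
    stdGaussian E {w | ¬ |‖U.starProjection w‖ ^ 2 - finrank ℝ U| < dev u (finrank ℝ U)} ≤
      2 * tailProb u := by
  have h := chiSq_tail hu (finrank ℝ U)
  have hm : MeasurableSet {x : ℝ | ¬ |x - finrank ℝ U| < dev u (finrank ℝ U)} :=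
    measurableSet_not_lt (by fun_prop) measurable_const
  rwa [← map_norm_sq_starProjection_stdGaussian, Measure.map_apply (by fun_prop) hm] at h

lemma norm_sq_tail {u : ℝ} (hu : 0 < u) :
    stdGaussian E {w | ¬ |‖w‖ ^ 2 - finrank ℝ E| < dev u (finrank ℝ E)} ≤ 2 * tailProb u := by
  have h := norm_sq_starProjection_tail (E := E) hu ⊤
  rw [finrank_top] at h
  simpa only [Submodule.starProjection_top, ContinuousLinearMap.id_apply] using h

lemma map_inner_stdGaussian {e : E} (he : ‖e‖ = 1) :
    (stdGaussian E).map (fun w => ⟪e, w⟫) = gaussianReal 0 1 := by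
  have hg : HasGaussianLaw (fun x : E => ⟪e, x⟫) (stdGaussian E) :=
    (IsGaussian.hasGaussianLaw_id (μ := stdGaussian E)).map_fun (innerSL ℝ e)
  have hvar : Var[fun x : E => ⟪e, x⟫; stdGaussian E] = 1 := by
    simpa [he] using variance_dual_stdGaussian (E := E) (innerSL ℝ e)
  have hmean : ∫ x, ⟪e, x⟫ ∂(stdGaussian E) = 0 :=
    integral_strongDual_stdGaussian (innerSL ℝ e)
  rw [hg.map_eq_gaussianReal, hvar, hmean]
  simp

lemma inner_tail {u : ℝ} (hu : 0 < u) (g : E) :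
    stdGaussian E {w | ¬ |⟪g, w⟫| ≤ ‖g‖ * √(2 * u)} ≤ 2 * tailProb u := by
  by_cases hg : g = 0
  · simp [hg]
  have h := gaussianReal_two_sided hu
  have he : ‖‖g‖⁻¹ • g‖ = 1 := norm_smul_inv_norm hg
  rw [← map_inner_stdGaussian he] at h
  have : IsFiniteMeasure ((stdGaussian E).map (fun w => ⟪‖g‖⁻¹ • g, w⟫)) :=
    Measure.isFiniteMeasure_map _ _
  have h2 := le_tailProb_of_real zero_le_two h
  have hm : MeasurableSet {x : ℝ | ¬ |x| < √(2 * u)} :=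
    measurableSet_not_lt (by fun_prop) measurable_const
  rw [Measure.map_apply (by fun_prop) hm] at h2
  refine (measure_mono ?_).trans (h2.trans (by simp))
  intro w hw hw'
  refine hw ?_
  have hg0 : 0 < ‖g‖ := norm_pos_iff.2 hg
  have h3 : |⟪‖g‖⁻¹ • g, w⟫| < √(2 * u) := hw'
  rw [real_inner_smul_left, abs_mul, abs_of_pos (inv_pos.2 hg0), inv_mul_lt_iff₀ hg0] at h3
  exact h3.le

end

/-! ### Tail bounds for regression coefficients -/

section CoefTail

variable {E : Type*} [NormedAddCommGroup E] [InnerProductSpace ℝ E] [FiniteDimensional ℝ E]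
  [MeasurableSpace E] [BorelSpace E]
variable {ι : Type*} [Fintype ι] [DecidableEq ι]

/-- Bound on the deviation from `k / K` of a ratio of chi-square variables with `k` and `K`
degrees of freedom. -/
def ratioDev (u : ℝ) (k K : ℕ) : ℝ := (dev u k + k / K * dev u K) / (K - dev u K)

/-- Bound on a standard Gaussian variable divided by the root of a chi-square variable with `K`
degrees of freedom. -/
def scoreDev (u : ℝ) (K : ℕ) : ℝ := √(2 * u) / √(K - dev u K)

lemma dev_nonneg {u : ℝ} (hu : 0 ≤ u) (k : ℕ) : 0 ≤ dev u k := by unfold dev; positivity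

lemma abs_div_sub_le_ratioDev {u A C : ℝ} {k K : ℕ} (hu : 0 ≤ u) (hK : dev u K < K)
    (hA : |A - k| < dev u k) (hC : |C - K| < dev u K) : |A / C - k / K| ≤ ratioDev u k K := by
  have hK0 : (0 : ℝ) < K := (dev_nonneg hu K).trans_lt hK
  have hC1 : K - dev u K < C := by linarith [(abs_lt.1 hC).1]
  have hC0 : 0 < C := by linarith
  have h1 : A / C - k / K = ((A - k) + k / K * (K - C)) / C := by field_simp; ring
  rw [h1, abs_div, abs_of_pos hC0, ratioDev]
  have h2 : |(A - k) + k / K * (K - C)| ≤ dev u k + k / K * dev u K := by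
    refine (abs_add_le _ _).trans (add_le_add hA.le ?_)
    rw [abs_mul, abs_of_nonneg (by positivity : (0 : ℝ) ≤ k / K), abs_sub_comm]
    gcongr
  exact div_le_div₀ ((abs_nonneg _).trans h2) h2 (by linarith) hC1.le

/-- By the t-representation the coefficients are distributed as (√C)⁻¹ • w, with C chi-square with K
degrees of freedom and w an independent standard Gaussian vector. The deviation of C and the event w
∈ t each cost 2 exp(-u); otherwise s is avoided. -/
lemma coef_tail_aux {u : ℝ} (hu : 0 < u) {K : ℕ} (s : Set (EuclideanSpace ℝ ι))
    (t : Set (EuclideanSpace ℝ ι)) (hs : MeasurableSet s)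
    (ht : stdGaussian (EuclideanSpace ℝ ι) t ≤ 2 * tailProb u)
    (F : Submodule ℝ E) (h : Fintype.card ι ≤ finrank ℝ F) [Nonempty ι]
    (hKF : finrank ℝ F - Fintype.card ι + 1 = K)
    (hst : ∀ (C : ℝ) (w : EuclideanSpace ℝ ι), |C - K| < dev u K → w ∉ t → (√C)⁻¹ • w ∉ s) :
    ((gaussFamily E ι).prod (stdGaussian E))
      {p | coef (fun i => F.starProjection (p.1 i)) p.2 ∈ s} ≤ 4 * tailProb u := by
  have hm : Measurable fun p : (ι → E) × E => coef (fun i => F.starProjection (p.1 i)) p.2 := by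
    fun_prop
  have e1 : ((gaussFamily E ι).prod (stdGaussian E))
      {p | coef (fun i => F.starProjection (p.1 i)) p.2 ∈ s} =
      (((gaussFamily E ι).prod (stdGaussian E)).map
        (fun p => coef (fun i => F.starProjection (p.1 i)) p.2)) s := by
    rw [Measure.map_apply hm hs]; rfl
  rw [e1, map_coef_eq F h, hKF, Measure.map_apply (by fun_prop) hs]
  have hsub : (fun p : ℝ × EuclideanSpace ℝ ι => (√p.1)⁻¹ • p.2) ⁻¹' s ⊆
      ({x : ℝ | ¬ |x - K| < dev u K} ×ˢ Set.univ) ∪ (Set.univ ×ˢ t) := by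
    rintro ⟨C, w⟩ hp
    by_contra hcon
    simp only [Set.mem_union, Set.mem_prod, Set.mem_ofPred_eq, Set.mem_univ, and_true, true_and,
      not_or, not_not] at hcon
    exact hst C w hcon.1 hcon.2 hp
  refine (measure_mono hsub).trans ((measure_union_le _ _).trans ?_)
  rw [Measure.prod_prod, Measure.prod_prod, measure_univ, measure_univ, one_mul, mul_one]
  refine (add_le_add (chiSq_tail hu K) ht).trans (le_of_eq ?_)
  rw [← add_mul]; norm_num

variable (F : Submodule ℝ E) (h : Fintype.card ι ≤ finrank ℝ F) [Nonempty ι] {K : ℕ}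
  (hKF : finrank ℝ F - Fintype.card ι + 1 = K)

include h hKF in
lemma norm_sq_coef_tail {u : ℝ} (hu : 0 < u) (hK : dev u K < K) :
    ((gaussFamily E ι).prod (stdGaussian E)) {p | coef (fun i => F.starProjection (p.1 i)) p.2 ∈
      {b : EuclideanSpace ℝ ι | ¬ |‖b‖ ^ 2 - (Fintype.card ι : ℝ) / K| ≤
        ratioDev u (Fintype.card ι) K}} ≤ 4 * tailProb u := by
  refine coef_tail_aux hu _ _ (measurableSet_not_le (by fun_prop) measurable_const)
    (norm_sq_tail (E := EuclideanSpace ℝ ι) hu) F h hKF ?_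
  intro C w hC hw
  simp only [Set.mem_ofPred_eq, not_not] at hw ⊢
  have hC0 : 0 < C := by linarith [(abs_lt.1 hC).1]
  rw [norm_smul, mul_pow, norm_inv, Real.norm_eq_abs, inv_pow, sq_abs, Real.sq_sqrt hC0.le,
    mul_comm, ← div_eq_mul_inv]
  rw [finrank_euclideanSpace] at hw
  exact abs_div_sub_le_ratioDev hu.le hK hw hC

include h hKF in
lemma inner_coef_tail {u : ℝ} (hu : 0 < u) (hK : dev u K < K) (g : EuclideanSpace ℝ ι) :
    ((gaussFamily E ι).prod (stdGaussian E)) {p | coef (fun i => F.starProjection (p.1 i)) p.2 ∈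
      {b : EuclideanSpace ℝ ι | ¬ |⟪g, b⟫| ≤ ‖g‖ * scoreDev u K}} ≤ 4 * tailProb u := by
  refine coef_tail_aux hu _ _ (measurableSet_not_le (by fun_prop) measurable_const)
    (inner_tail (E := EuclideanSpace ℝ ι) hu g) F h hKF ?_
  intro C w hC hw
  simp only [Set.mem_ofPred_eq, not_not] at hw ⊢
  have hC1 : K - dev u K ≤ C := by linarith [(abs_lt.1 hC).1]
  have hC2 : 0 < √(K - dev u K) := Real.sqrt_pos.2 (by linarith)
  have hC3 : √(K - dev u K) ≤ √C := Real.sqrt_le_sqrt hC1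
  rw [real_inner_smul_right, abs_mul, abs_of_nonneg (by positivity), scoreDev, ← mul_div_assoc,
    inv_mul_eq_div]
  exact div_le_div₀ (by positivity) hw hC2 hC3

end CoefTail

/-! ### Least-squares residuals as orthogonal projections -/

section Resid

variable {E : Type*} [NormedAddCommGroup E] [InnerProductSpace ℝ E] [FiniteDimensional ℝ E]
variable {ι κ : Type*} [Fintype ι] [DecidableEq ι] [Fintype κ] [DecidableEq κ]

/-- The residual of the least-squares approximation of `w` by linear combinations of `z`. -/
def resid (z : ι → E) (w : E) : E := w - ∑ j, coef z w j • z j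

lemma resid_eq_starProjection {z : ι → E} (hz : LinearIndependent ℝ z) (w : E) :
    resid z w = (Submodule.span ℝ (Set.range z))ᗮ.starProjection w := by
  rw [Submodule.starProjection_orthogonal_val, resid]
  congr 1
  symm
  refine Submodule.eq_starProjection_of_mem_of_inner_eq_zero ?_ ?_
  · exact Submodule.sum_mem _ fun j _ => Submodule.smul_mem _ _
      (Submodule.subset_span ⟨j, rfl⟩)
  · intro y hy
    induction hy using Submodule.span_induction with
    | mem y hy =>
      obtain ⟨j, rfl⟩ := hy
      rw [real_inner_comm, inner_sub_right, inner_sum_coef hz, sub_self]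
    | zero => simp
    | add x y _ _ hx hy => rw [inner_add_right, hx, hy, add_zero]
    | smul c x _ hx => rw [real_inner_smul_right, hx, mul_zero]

omit [DecidableEq ι] in
lemma finrank_orthogonal_span {z : ι → E} (hz : LinearIndependent ℝ z) :
    finrank ℝ (Submodule.span ℝ (Set.range z))ᗮ = finrank ℝ E - Fintype.card ι := by
  have h1 := Submodule.finrank_add_finrank_orthogonal (Submodule.span ℝ (Set.range z))
  rw [finrank_span_eq_card hz] at h1
  omega

omit [DecidableEq κ] in
lemma linearIndependent_sumElim {z : ι → E} {y : κ → E} (hz : LinearIndependent ℝ z)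
    (hy : LinearIndependent ℝ fun k => resid z (y k)) : LinearIndependent ℝ (Sum.elim z y) := by
  set U := Submodule.span ℝ (Set.range z) with hU
  rw [Fintype.linearIndependent_iff] at hy ⊢
  intro g hg
  rw [Fintype.sum_sum_type] at hg
  simp only [Sum.elim_inl, Sum.elim_inr] at hg
  have hmem : ∑ i, g (Sum.inl i) • z i ∈ U :=
    Submodule.sum_mem _ fun j _ => Submodule.smul_mem _ _ (Submodule.subset_span ⟨j, rfl⟩)
  have h0 := congrArg (Uᗮ.starProjection) hg
  rw [map_add, map_zero,
    Submodule.starProjection_orthogonal_apply_eq_zero hmem, zero_add] at h0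
  have hr : ∀ k, g (Sum.inr k) = 0 := by
    refine hy (fun k => g (Sum.inr k)) ?_
    rw [← h0, map_sum]
    exact Finset.sum_congr rfl fun k _ => by rw [resid_eq_starProjection hz, map_smul]
  have hl : ∀ i, g (Sum.inl i) = 0 := by
    refine (Fintype.linearIndependent_iff.1 hz) (fun i => g (Sum.inl i)) ?_
    simpa [hr] using hg
  rintro (i | k)
  · exact hl i
  · exact hr k

@[fun_prop]
lemma measurable_resid [MeasurableSpace E] [BorelSpace E] {X : Type*} [MeasurableSpace X]
    {z : X → ι → E} {w : X → E} (hz : Measurable z) (hw : Measurable w) :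
    Measurable fun x => resid (z x) (w x) := by
  unfold resid
  refine hw.sub (Finset.measurable_sum _ fun j _ => ?_)
  have h1 : Measurable fun x => z x j := (measurable_pi_apply j).comp hz
  have h2 : Measurable fun x => coef (z x) (w x) := by fun_prop
  have h3 : Measurable fun x => coef (z x) (w x) j :=
    (measurable_pi_apply j).comp ((PiLp.continuous_ofLp 2 _).measurable.comp h2)
  exact h3.smul h1

lemma measurableSet_linearIndependent [MeasurableSpace E] [BorelSpace E] :
    MeasurableSet {z : ι → E | LinearIndependent ℝ z} := by
  have := measurableSet_linearIndepOn (ContinuousLinearMap.id ℝ E) (Finset.univ : Finset ι)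
  simpa [linearIndepOn_univ_iff] using this

end Resid

lemma prod_apply_le_of_ae {X Y : Type*} [MeasurableSpace X] [MeasurableSpace Y] {μ : Measure X}
    {ν : Measure Y} [IsProbabilityMeasure μ] [SFinite ν] {s : Set (X × Y)} (hs : MeasurableSet s)
    {c : ℝ≥0∞} (h : ∀ᵐ x ∂μ, ν {y | (x, y) ∈ s} ≤ c) : (μ.prod ν) s ≤ c := by
  rw [Measure.prod_apply hs]
  calc ∫⁻ x, ν (Prod.mk x ⁻¹' s) ∂μ ≤ ∫⁻ _, c ∂μ := lintegral_mono_ae h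
    _ = c := by simp

section Canonical

variable {E : Type*} [NormedAddCommGroup E] [InnerProductSpace ℝ E] [FiniteDimensional ℝ E]
  [MeasurableSpace E] [BorelSpace E]
variable {ι κ : Type*} [Fintype ι] [DecidableEq ι] [Fintype κ]

lemma ae_linearIndependent_id (h : Fintype.card ι ≤ finrank ℝ E) :
    ∀ᵐ z ∂(gaussFamily E ι), LinearIndependent ℝ z := by
  have h1 := ae_linearIndependent (ι := ι) (⊤ : Submodule ℝ E) (by simpa using h)
  simpa only [Submodule.starProjection_top, ContinuousLinearMap.id_apply] using h1

/-! ### Regression coefficients in directions that depend on the residuals -/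

lemma measurable_sum_smul {X : Type*} [MeasurableSpace X] {c : X → κ → ℝ} {g : X → κ → E}
    (hc : Measurable c) (hg : Measurable g) : Measurable fun x => ∑ k, c x k • g x k :=
  Finset.measurable_sum _ fun k _ =>
    ((measurable_pi_apply k).comp hc).smul ((measurable_pi_apply k).comp hg)

lemma measurable_sum_sq {X : Type*} [MeasurableSpace X] {c : X → κ → ℝ}
    (hc : Measurable c) : Measurable fun x => ∑ k, c x k ^ 2 :=
  Finset.measurable_sum _ fun k _ => ((measurable_pi_apply k).comp hc).pow_const 2

/-- If the coefficients `c` of a linear combination of independent Gaussian vectors depend only on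
the residuals after regression on `z`, then the regression coefficients of the combination on `z`
behave as if `c` were constant. -/
lemma coef_random_combination_le (hle : Fintype.card ι ≤ finrank ℝ E)
    {c : (ι → E) × (κ → E) → κ → ℝ} (hcm : Measurable c)
    (hc : ∀ z G, LinearIndependent ℝ z → c (z, fun k => resid z (G k)) = c (z, G))
    {S : Set (EuclideanSpace ℝ ι)} (hS : MeasurableSet S) :
    ((gaussFamily E ι).prod (gaussFamily E κ))
      {p | ∑ k, c p k ^ 2 = 1 ∧ coef p.1 (∑ k, c p k • p.2 k) ∈ S} ≤
    ((gaussFamily E ι).prod (stdGaussian E)) {p | coef p.1 p.2 ∈ S} := by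
  have hA : MeasurableSet {p : (ι → E) × (κ → E) |
      ∑ k, c p k ^ 2 = 1 ∧ coef p.1 (∑ k, c p k • p.2 k) ∈ S} := by
    have h1 : Measurable fun p : (ι → E) × (κ → E) => coef p.1 (∑ k, c p k • p.2 k) :=
      measurable_coef measurable_fst (measurable_sum_smul hcm measurable_snd)
    exact ((measurable_sum_sq hcm) (measurableSet_singleton 1)).inter (h1 hS)
  have hB : MeasurableSet {p : (ι → E) × E | coef p.1 p.2 ∈ S} :=
    (measurable_coef measurable_fst measurable_snd) hS
  rw [Measure.prod_apply hA, Measure.prod_apply hB]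
  refine lintegral_mono_ae ?_
  filter_upwards [ae_linearIndependent_id hle] with z hz
  set U := Submodule.span ℝ (Set.range z) with hU
  have hmz : Measurable fun p : (κ → E) × (κ → E) =>
      fun k => U.starProjection (p.1 k) + Uᗮ.starProjection (p.2 k) := by fun_prop
  have hAz : MeasurableSet (Prod.mk z ⁻¹' {p : (ι → E) × (κ → E) |
      ∑ k, c p k ^ 2 = 1 ∧ coef p.1 (∑ k, c p k • p.2 k) ∈ S}) := measurable_prodMk_left hA
  -- With z fixed, G is rebuilt from independent families: its component in the span U of z comes
  -- from G', the orthogonal one from G''. The weights c depend only on G'', the coefficients on z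
  -- only on the G'-part. For fixed G'' with unit weights the combination of the G' is again a
  -- standard Gaussian vector.
  conv_lhs => rw [← map_proj_add_proj_gaussFamily U]
  rw [Measure.map_apply hmz hAz, Measure.prod_apply_symm (hmz hAz)]
  refine (lintegral_mono fun G'' => ?_).trans_eq (by simp :
    ∫⁻ _, stdGaussian E (Prod.mk z ⁻¹' {p : (ι → E) × E | coef p.1 p.2 ∈ S})
      ∂(gaussFamily E κ) = _)
  have hcz : ∀ G' : κ → E, c (z, fun k => U.starProjection (G' k) + Uᗮ.starProjection (G'' k)) =
      c (z, G'') := fun G' => by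
    rw [← hc z _ hz, ← hc z G'' hz]
    congr 2
    ext1 k
    rw [resid_eq_starProjection hz, resid_eq_starProjection hz, map_add,
      Submodule.starProjection_orthogonal_apply_eq_zero (Submodule.starProjection_apply_mem _ _),
      zero_add, Submodule.starProjection_eq_self_iff.2 (Submodule.starProjection_apply_mem _ _)]
  have hcoef : ∀ G' : κ → E, coef z (∑ k, c (z, G'') k •
      (U.starProjection (G' k) + Uᗮ.starProjection (G'' k))) =
      coef z (∑ k, c (z, G'') k • G' k) := fun G' => by
    refine coef_eq_of_inner_eq fun i => ?_
    have hzi : z i ∈ U := Submodule.subset_span ⟨i, rfl⟩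
    simp only [inner_sum, real_inner_smul_right, inner_add_right]
    refine Finset.sum_congr rfl fun k _ => ?_
    rw [Submodule.inner_right_of_mem_orthogonal hzi (Submodule.starProjection_apply_mem _ _),
      add_zero, ← Submodule.inner_starProjection_left_eq_right,
      Submodule.starProjection_eq_self_iff.2 hzi]
  by_cases h1 : ∑ k, c (z, G'') k ^ 2 = 1
  · have hm := map_sum_smul_gaussFamily (E := E) (c (z, G'')) (s := 1) (by rw [h1]; norm_num)
    have hBz : MeasurableSet (Prod.mk z ⁻¹' {p : (ι → E) × E | coef p.1 p.2 ∈ S}) :=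
      measurable_prodMk_left hB
    simp only [one_smul, Measure.map_id'] at hm
    rw [← hm, Measure.map_apply (by fun_prop) hBz]
    refine measure_mono fun G' hG' => ?_
    have h2 : coef z (∑ k, c (z, fun k => U.starProjection (G' k) + Uᗮ.starProjection (G'' k)) k •
      (U.starProjection (G' k) + Uᗮ.starProjection (G'' k))) ∈ S := hG'.2
    rw [hcz, hcoef] at h2
    exact h2
  · refine (measure_mono_null (fun G' hG' => ?_) measure_empty).trans_le zero_le
    have h2 : ∑ k, c (z, fun k => U.starProjection (G' k) + Uᗮ.starProjection (G'' k)) k ^ 2 = 1 :=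
      hG'.1
    rw [hcz] at h2
    exact (h1 h2).elim

section Directions

variable (hle : Fintype.card ι ≤ finrank ℝ E) {c : (ι → E) × (κ → E) → κ → ℝ} (hcm : Measurable c)
    (hc : ∀ z G, LinearIndependent ℝ z → c (z, fun k => resid z (G k)) = c (z, G))
    {K : ℕ} (hKE : finrank ℝ E - Fintype.card ι + 1 = K)

include hle hcm hc

/-- Dividing the weights by their length keeps them a function of the residuals, and by linearity
the factor passes through `coef`. -/
lemma coef_normalized_combination_le {S : Set (EuclideanSpace ℝ ι)} (hS : MeasurableSet S) :
    ((gaussFamily E ι).prod (gaussFamily E κ))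
      {p | ∑ k, c p k ^ 2 ≠ 0 ∧ (√(∑ k, c p k ^ 2))⁻¹ • coef p.1 (∑ k, c p k • p.2 k) ∈ S} ≤
    ((gaussFamily E ι).prod (stdGaussian E)) {p | coef p.1 p.2 ∈ S} := by
  refine (measure_mono ?_).trans (coef_random_combination_le hle
    (c := fun p k => (√(∑ k, c p k ^ 2))⁻¹ * c p k) ?_ ?_ hS)
  · rintro p ⟨h1, h2⟩
    have h0 : 0 ≤ ∑ k, c p k ^ 2 := Finset.sum_nonneg fun k _ => sq_nonneg _
    refine ⟨?_, ?_⟩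
    · simp only [mul_pow, ← Finset.mul_sum, inv_pow, Real.sq_sqrt h0]
      exact inv_mul_cancel₀ h1
    · simp only [mul_smul, ← Finset.smul_sum, coef_smul]
      exact h2
  · exact measurable_pi_iff.2 fun k => ((measurable_sum_sq hcm).sqrt.inv).mul
      ((measurable_pi_apply k).comp hcm)
  · intro z G hz
    rw [hc z G hz]

variable [Nonempty ι]

include hKE

lemma norm_sq_coef_combination_tail {u : ℝ} (hu : 0 < u) (hK : dev u K < K) :
    ((gaussFamily E ι).prod (gaussFamily E κ))
      {p | ¬ |‖coef p.1 (∑ k, c p k • p.2 k)‖ ^ 2 - (Fintype.card ι : ℝ) / K * ∑ k, c p k ^ 2| ≤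
        ratioDev u (Fintype.card ι) K * ∑ k, c p k ^ 2} ≤ 4 * tailProb u := by
  have h := norm_sq_coef_tail (ι := ι) (⊤ : Submodule ℝ E) (by simpa using hle)
    (by simpa using hKE) hu hK
  simp only [Submodule.starProjection_top, ContinuousLinearMap.id_apply] at h
  refine (measure_mono ?_).trans ((coef_normalized_combination_le hle hcm hc
    (measurableSet_not_le (by fun_prop) measurable_const)).trans h)
  intro p hp
  have h0 : 0 ≤ ∑ k, c p k ^ 2 := Finset.sum_nonneg fun k _ => sq_nonneg _
  -- If all weights vanish, both sides of the bound are 0 and it holds. Hence the normalization is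
  -- legitimate on the exceptional event.
  have h1 : ∑ k, c p k ^ 2 ≠ 0 := by
    intro h1
    have h2 : ∀ k, c p k = 0 := fun k => by
      have := (Finset.sum_eq_zero_iff_of_nonneg (fun k _ => sq_nonneg (c p k))).1 h1 k
        (Finset.mem_univ k)
      simpa using this
    refine hp ?_
    have h3 : coef p.1 (0 : E) = 0 := coef_eq_zero fun i => by simp
    simp [h2, h3]
  refine ⟨h1, fun h2 => hp ?_⟩
  have hpos : 0 < ∑ k, c p k ^ 2 := lt_of_le_of_ne h0 (Ne.symm h1)
  simp only [norm_smul, mul_pow, norm_inv, Real.norm_eq_abs, inv_pow, sq_abs,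
    Real.sq_sqrt h0] at h2
  have e : ‖coef p.1 (∑ k, c p k • p.2 k)‖ ^ 2 - (Fintype.card ι : ℝ) / K * ∑ k, c p k ^ 2 =
      ((∑ k, c p k ^ 2)⁻¹ * ‖coef p.1 (∑ k, c p k • p.2 k)‖ ^ 2 - (Fintype.card ι : ℝ) / K) *
        ∑ k, c p k ^ 2 := by
    field_simp
  rw [e, abs_mul, abs_of_pos hpos]
  exact mul_le_mul_of_nonneg_right h2 h0

lemma inner_coef_combination_tail {u : ℝ} (hu : 0 < u) (hK : dev u K < K)
    (g : EuclideanSpace ℝ ι) :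
    ((gaussFamily E ι).prod (gaussFamily E κ))
      {p | ¬ |⟪g, coef p.1 (∑ k, c p k • p.2 k)⟫| ≤
        ‖g‖ * scoreDev u K * √(∑ k, c p k ^ 2)} ≤ 4 * tailProb u := by
  have h := inner_coef_tail (ι := ι) (⊤ : Submodule ℝ E) (by simpa using hle)
    (by simpa using hKE) hu hK g
  simp only [Submodule.starProjection_top, ContinuousLinearMap.id_apply] at h
  refine (measure_mono ?_).trans ((coef_normalized_combination_le hle hcm hc
    (measurableSet_not_le (by fun_prop) measurable_const)).trans h)
  intro p hp
  have h0 : 0 ≤ ∑ k, c p k ^ 2 := Finset.sum_nonneg fun k _ => sq_nonneg _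
  have h1 : ∑ k, c p k ^ 2 ≠ 0 := by
    intro h1
    have h2 : ∀ k, c p k = 0 := fun k => by
      have := (Finset.sum_eq_zero_iff_of_nonneg (fun k _ => sq_nonneg (c p k))).1 h1 k
        (Finset.mem_univ k)
      simpa using this
    refine hp ?_
    have h3 : coef p.1 (0 : E) = 0 := coef_eq_zero fun i => by simp
    simp [h2, h3]
  refine ⟨h1, fun h2 => hp ?_⟩
  have hpos : 0 < √(∑ k, c p k ^ 2) := Real.sqrt_pos.2 (lt_of_le_of_ne h0 (Ne.symm h1))
  simp only [real_inner_smul_right, abs_mul, abs_inv, abs_of_pos hpos] at h2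
  rwa [inv_mul_le_iff₀ hpos, mul_comm] at h2

end Directions

end Canonical

/-- Subtract the two expansions: four times the inner product carries the errors r(2 + 2g) and r(2 -
2g), which add up to 4r whatever g is. -/
lemma abs_inner_sub_le_of_polarization {V : Type*} [NormedAddCommGroup V] [InnerProductSpace ℝ V]
    {x y : V} {q r g : ℝ} (h₁ : |‖x + y‖ ^ 2 - q * (2 + 2 * g)| ≤ r * (2 + 2 * g))
    (h₂ : |‖x - y‖ ^ 2 - q * (2 - 2 * g)| ≤ r * (2 - 2 * g)) : |⟪x, y⟫ - q * g| ≤ r := by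
  rw [norm_add_sq_real, abs_le] at h₁
  rw [norm_sub_sq_real, abs_le] at h₂
  rw [abs_le]
  constructor <;> nlinarith [h₁.1, h₁.2, h₂.1, h₂.2]

lemma measure_union_le_add {X : Type*} [MeasurableSpace X] {μ : Measure X} {A B : Set X}
    {a b : ℝ≥0∞} (hA : μ A ≤ a) (hB : μ B ≤ b) : μ (A ∪ B) ≤ a + b :=
  (measure_union_le A B).trans (add_le_add hA hB)

section Canonical

variable {E : Type*} [NormedAddCommGroup E] [InnerProductSpace ℝ E] [FiniteDimensional ℝ E]
variable {ι κ : Type*} [Fintype ι] [DecidableEq ι] [Fintype κ] [DecidableEq κ]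

/-! ### The canonical model

The regressors of the two blocks are the vectors `z i` and `G (some k)`, the error is `G none`. -/

/-- The error of the least-squares estimator of the coefficients of the second block. -/
def blockErr (z : ι → E) (G : Option κ → E) : EuclideanSpace ℝ κ :=
  coef (fun k => resid z (G (some k))) (G none)

/-- The coefficients `(1, v)` of a linear combination of the error and the second block. -/
def dir (v : EuclideanSpace ℝ κ) (k : Option κ) : ℝ := k.elim 1 fun i => v i

omit [FiniteDimensional ℝ E] [DecidableEq κ] in
lemma sum_dir_smul (v : EuclideanSpace ℝ κ) (G : Option κ → E) :
    ∑ k, dir v k • G k = G none + ∑ k, v k • G (some k) := by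
  simp [Fintype.sum_option, dir]

omit [DecidableEq κ] in
lemma sum_dir_sq (v : EuclideanSpace ℝ κ) : ∑ k, dir v k ^ 2 = 1 + ‖v‖ ^ 2 := by
  simp [Fintype.sum_option, dir, EuclideanSpace.real_norm_sq_eq]

omit [DecidableEq κ] in
lemma sum_dir_mul (v w : EuclideanSpace ℝ κ) : ∑ k, dir v k * dir w k = 1 + ⟪v, w⟫ := by
  simp [Fintype.sum_option, dir, PiLp.inner_apply, mul_comm]

/-- Frisch–Waugh: partialling z out of all vectors does not change the second-block error. This
makes (1, -e) an admissible random direction in `coef_random_combination_le`. -/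
lemma blockErr_resid {z : ι → E} (hz : LinearIndependent ℝ z) (G : Option κ → E) :
    blockErr z (fun k => resid z (G k)) = blockErr z G := by
  simp only [blockErr, resid_eq_starProjection hz]
  set Q := (Submodule.span ℝ (Set.range z))ᗮ
  have hQ : ∀ x, Q.starProjection (Q.starProjection x) = Q.starProjection x := fun x =>
    Submodule.starProjection_eq_self_iff.2 (Submodule.starProjection_apply_mem _ _)
  have hfun : (fun k => Q.starProjection (Q.starProjection (G (some k)))) =
      fun k => Q.starProjection (G (some k)) := funext fun k => hQ _
  rw [hfun]
  refine coef_eq_of_inner_eq fun k => ?_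
  rw [← Submodule.inner_starProjection_left_eq_right, hQ]

variable [MeasurableSpace E] [BorelSpace E]

lemma measurable_blockErr :
    Measurable fun p : (ι → E) × (Option κ → E) => blockErr p.1 p.2 := by
  unfold blockErr
  refine measurable_coef (measurable_pi_iff.2 fun k => ?_) (by fun_prop)
  exact measurable_resid (by fun_prop) (by fun_prop)

omit [DecidableEq κ] in
lemma measurable_dir {X : Type*} [MeasurableSpace X] {v : X → EuclideanSpace ℝ κ}
    (hv : Measurable v) : Measurable fun x => dir (v x) := by
  refine measurable_pi_iff.2 fun k => ?_
  cases k with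
  | none => exact measurable_const
  | some k => exact (measurable_pi_apply k).comp ((PiLp.continuous_ofLp 2 _).measurable.comp hv)

/-- Simultaneous bounds for the random quantities that determine the prediction error and its
estimate in the canonical model. -/
structure IsTypical (u : ℝ) (s : EuclideanSpace ℝ ι) (t : EuclideanSpace ℝ κ)
    (z : ι → E) (G : Option κ → E) : Prop where
  linInd : LinearIndependent ℝ z
  linInd_resid : LinearIndependent ℝ fun k => resid z (G (some k))
  rss : |‖resid (Sum.elim z fun k => G (some k)) (G none)‖ ^ 2 -
    (finrank ℝ E - (Fintype.card ι + Fintype.card κ) : ℕ)| ≤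
      dev u (finrank ℝ E - (Fintype.card ι + Fintype.card κ))
  rss₁ : |‖resid z (∑ k, dir t k • G k)‖ ^ 2 - (1 + ‖t‖ ^ 2) * (finrank ℝ E - Fintype.card ι : ℕ)| ≤
    (1 + ‖t‖ ^ 2) * dev u (finrank ℝ E - Fintype.card ι)
  total : |‖∑ i, s i • z i + ∑ k, dir t k • G k‖ ^ 2 - (1 + ‖t‖ ^ 2 + ‖s‖ ^ 2) * finrank ℝ E| ≤
    (1 + ‖t‖ ^ 2 + ‖s‖ ^ 2) * dev u (finrank ℝ E)
  norm_blockErr : |‖blockErr z G‖ ^ 2 - (Fintype.card κ : ℝ) /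
      (finrank ℝ E - (Fintype.card ι + Fintype.card κ) + 1 : ℕ)| ≤
    ratioDev u (Fintype.card κ) (finrank ℝ E - (Fintype.card ι + Fintype.card κ) + 1)
  inner_blockErr : |⟪t, blockErr z G⟫| ≤
    ‖t‖ * scoreDev u (finrank ℝ E - (Fintype.card ι + Fintype.card κ) + 1)
  norm_coef_err : |‖coef z (∑ k, dir (-blockErr z G) k • G k)‖ ^ 2 -
      (Fintype.card ι : ℝ) / (finrank ℝ E - Fintype.card ι + 1 : ℕ) * (1 + ‖blockErr z G‖ ^ 2)| ≤
    ratioDev u (Fintype.card ι) (finrank ℝ E - Fintype.card ι + 1) * (1 + ‖blockErr z G‖ ^ 2)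
  norm_coef : |‖coef z (∑ k, dir t k • G k)‖ ^ 2 -
      (Fintype.card ι : ℝ) / (finrank ℝ E - Fintype.card ι + 1 : ℕ) * (1 + ‖t‖ ^ 2)| ≤
    ratioDev u (Fintype.card ι) (finrank ℝ E - Fintype.card ι + 1) * (1 + ‖t‖ ^ 2)
  inner_coef_coef : |⟪coef z (∑ k, dir (-blockErr z G) k • G k), coef z (∑ k, dir t k • G k)⟫ -
      (Fintype.card ι : ℝ) / (finrank ℝ E - Fintype.card ι + 1 : ℕ) * (1 - ⟪t, blockErr z G⟫)| ≤
    ratioDev u (Fintype.card ι) (finrank ℝ E - Fintype.card ι + 1) *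
      (√(1 + ‖blockErr z G‖ ^ 2) * √(1 + ‖t‖ ^ 2))
  inner_coef_err : |⟪s, coef z (∑ k, dir (-blockErr z G) k • G k)⟫| ≤
    ‖s‖ * scoreDev u (finrank ℝ E - Fintype.card ι + 1) * √(1 + ‖blockErr z G‖ ^ 2)
  inner_coef : |⟪s, coef z (∑ k, dir t k • G k)⟫| ≤
    ‖s‖ * scoreDev u (finrank ℝ E - Fintype.card ι + 1) * √(1 + ‖t‖ ^ 2)

omit [DecidableEq κ] in
lemma measurePreserving_option :
    MeasurePreserving (fun G : Option κ → E => ((fun k => G (some k)), G none))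
      (gaussFamily E (Option κ)) ((gaussFamily E κ).prod (stdGaussian E)) := by
  have h := Measure.pi_map_piOptionEquivProd (fun _ : Option κ => stdGaussian E)
  have h2 : MeasurePreserving (MeasurableEquiv.piOptionEquivProd (fun _ : Option κ => E)).symm
      ((gaussFamily E κ).prod (stdGaussian E)) (gaussFamily E (Option κ)) :=
    ⟨MeasurableEquiv.measurable _, h⟩
  exact h2.symm

lemma ae_linInd (hle : Fintype.card ι + Fintype.card κ ≤ finrank ℝ E) :
    ∀ᵐ p ∂((gaussFamily E ι).prod (gaussFamily E (Option κ))),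
      LinearIndependent ℝ p.1 ∧ LinearIndependent ℝ fun k => resid p.1 (p.2 (some k)) := by
  have hm1 : MeasurableSet {p : (ι → E) × (Option κ → E) | LinearIndependent ℝ p.1} :=
    measurable_fst measurableSet_linearIndependent
  have hm2 : MeasurableSet {p : (ι → E) × (Option κ → E) |
      LinearIndependent ℝ fun k => resid p.1 (p.2 (some k))} := by
    have : Measurable fun p : (ι → E) × (Option κ → E) => fun k => resid p.1 (p.2 (some k)) :=
      measurable_pi_iff.2 fun k => measurable_resid (by fun_prop) (by fun_prop)
    exact this measurableSet_linearIndependent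
  refine (Measure.ae_prod_iff_ae_ae (hm1.inter hm2)).2 ?_
  filter_upwards [ae_linearIndependent_id (ι := ι) (E := E) (by omega)] with z hz
  have h := ae_linearIndependent (ι := κ) (Submodule.span ℝ (Set.range z))ᗮ
    (by rw [finrank_orthogonal_span hz]; omega)
  have h2 : ∀ᵐ q ∂((gaussFamily E κ).prod (stdGaussian E)), LinearIndependent ℝ fun k =>
      (Submodule.span ℝ (Set.range z))ᗮ.starProjection (q.1 k) :=
    Measure.quasiMeasurePreserving_fst.ae h
  filter_upwards [measurePreserving_option.quasiMeasurePreserving.ae h2] with G hG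
  refine ⟨hz, ?_⟩
  change LinearIndependent ℝ fun k => resid z (G (some k))
  simpa only [resid_eq_starProjection hz] using hG

omit [DecidableEq ι] [DecidableEq κ] in
lemma prod_option_le {A : Set ((ι → E) × ((κ → E) × E))} (hA : MeasurableSet A) {c : ℝ≥0∞}
    (h : ∀ᵐ z ∂(gaussFamily E ι), ((gaussFamily E κ).prod (stdGaussian E)) {q | (z, q) ∈ A} ≤ c) :
    ((gaussFamily E ι).prod (gaussFamily E (Option κ)))
      {p | (p.1, ((fun k => p.2 (some k)), p.2 none)) ∈ A} ≤ c := by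
  have hpre := (MeasurePreserving.id (gaussFamily E ι)).prod
    (measurePreserving_option (E := E) (κ := κ))
  have h2 := prod_apply_le_of_ae hA h
  rwa [← hpre.measure_preimage hA.nullMeasurableSet] at h2

section Tails

variable {u : ℝ} (hu : 0 < u) (s : EuclideanSpace ℝ ι) (t : EuclideanSpace ℝ κ)

include hu

lemma rss_tail (hle : Fintype.card ι + Fintype.card κ ≤ finrank ℝ E) :
    ((gaussFamily E ι).prod (gaussFamily E (Option κ)))
    {p | ¬ |‖resid (Sum.elim p.1 fun k => p.2 (some k)) (p.2 none)‖ ^ 2 -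
      (finrank ℝ E - (Fintype.card ι + Fintype.card κ) : ℕ)| ≤
        dev u (finrank ℝ E - (Fintype.card ι + Fintype.card κ))} ≤ 2 * tailProb u := by
  set d := finrank ℝ E - (Fintype.card ι + Fintype.card κ) with hd
  have hm0 : Measurable fun p : (ι → E) × ((κ → E) × E) =>
      resid (Sum.elim p.1 p.2.1) p.2.2 := by
    refine measurable_resid (measurable_pi_iff.2 fun i => ?_) (by fun_prop)
    rcases i with i | k <;> simp only [Sum.elim_inl, Sum.elim_inr] <;> fun_prop
  have hm : MeasurableSet {p : (ι → E) × ((κ → E) × E) |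
      ¬ |‖resid (Sum.elim p.1 p.2.1) p.2.2‖ ^ 2 - d| ≤ dev u d} :=
    measurableSet_not_le (by fun_prop) measurable_const
  refine prod_option_le hm ?_
  filter_upwards [ae_linearIndependent_id (ι := ι) (E := E) (by omega)] with z hz
  refine prod_apply_le_of_ae (measurable_prodMk_left hm) ?_
  filter_upwards [ae_linearIndependent (ι := κ) (Submodule.span ℝ (Set.range z))ᗮ
    (by rw [finrank_orthogonal_span hz]; omega)] with y hy
  simp only [← resid_eq_starProjection hz] at hy
  have hzy := linearIndependent_sumElim hz hy
  have h := norm_sq_starProjection_tail hu (Submodule.span ℝ (Set.range (Sum.elim z y)))ᗮ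
  have hfr : finrank ℝ (Submodule.span ℝ (Set.range (Sum.elim z y)))ᗮ = d := by
    rw [finrank_orthogonal_span hzy, hd, Fintype.card_sum]
  rw [hfr] at h
  refine (measure_mono fun w hw => ?_).trans h
  have hw' : ¬ |‖resid (Sum.elim z y) w‖ ^ 2 - d| ≤ dev u d := hw
  rw [resid_eq_starProjection hzy] at hw'
  exact fun h' => hw' (le_of_lt h')

-- The weights `dir t` have squared length 1 + ‖t‖², so the combination is distributed as √(1 +
-- ‖t‖²) times one standard Gaussian vector, which is then projected off the span of z.
omit [DecidableEq κ] in
lemma rss₁_tail (hle : Fintype.card ι ≤ finrank ℝ E) :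
    ((gaussFamily E ι).prod (gaussFamily E (Option κ)))
    {p | ¬ |‖resid p.1 (∑ k, dir t k • p.2 k)‖ ^ 2 -
      (1 + ‖t‖ ^ 2) * (finrank ℝ E - Fintype.card ι : ℕ)| ≤
    (1 + ‖t‖ ^ 2) * dev u (finrank ℝ E - Fintype.card ι)} ≤ 2 * tailProb u := by
  set d := finrank ℝ E - Fintype.card ι with hd
  have hm0 : Measurable fun p : (ι → E) × (Option κ → E) =>
      resid p.1 (∑ k, dir t k • p.2 k) := measurable_resid (by fun_prop) (by fun_prop)
  refine prod_apply_le_of_ae (measurableSet_not_le (by fun_prop) measurable_const) ?_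
  filter_upwards [ae_linearIndependent_id (ι := ι) (E := E) hle] with z hz
  have h := norm_sq_starProjection_tail hu (Submodule.span ℝ (Set.range z))ᗮ
  rw [finrank_orthogonal_span hz, ← hd] at h
  set r := √(1 + ‖t‖ ^ 2) with hr
  have hr2 : r ^ 2 = 1 + ‖t‖ ^ 2 := Real.sq_sqrt (by positivity)
  have hmap := map_sum_smul_gaussFamily (E := E) (dir t) (s := r) (by rw [sum_dir_sq, hr2])
  have hm : MeasurableSet {w : E | ¬ |‖resid z w‖ ^ 2 - (1 + ‖t‖ ^ 2) * (d : ℝ)| ≤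
      (1 + ‖t‖ ^ 2) * dev u d} := by
    have : Measurable fun w : E => resid z w := measurable_resid (by fun_prop) (by fun_prop)
    exact measurableSet_not_le (by fun_prop) measurable_const
  change gaussFamily E (Option κ) ((fun G => ∑ k, dir t k • G k) ⁻¹' {w : E |
    ¬ |‖resid z w‖ ^ 2 - (1 + ‖t‖ ^ 2) * (d : ℝ)| ≤ (1 + ‖t‖ ^ 2) * dev u d}) ≤ _
  rw [← Measure.map_apply (by fun_prop) hm, hmap, Measure.map_apply (by fun_prop) hm]
  refine le_trans (measure_mono ?_) h
  intro w hw hlt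
  refine hw ?_
  rw [resid_eq_starProjection hz, map_smul, norm_smul, mul_pow, Real.norm_eq_abs, sq_abs, hr2,
    ← mul_sub, abs_mul, abs_of_pos (by positivity)]
  exact mul_le_mul_of_nonneg_left (le_of_lt hlt) (by positivity)

omit [DecidableEq ι] [DecidableEq κ] in
lemma total_tail :
    ((gaussFamily E ι).prod (gaussFamily E (Option κ)))
    {p | ¬ |‖∑ i, s i • p.1 i + ∑ k, dir t k • p.2 k‖ ^ 2 -
      (1 + ‖t‖ ^ 2 + ‖s‖ ^ 2) * finrank ℝ E| ≤
    (1 + ‖t‖ ^ 2 + ‖s‖ ^ 2) * dev u (finrank ℝ E)} ≤ 2 * tailProb u := by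
  have hpre := measurePreserving_sumPiEquivProdPi (fun _ : ι ⊕ Option κ => stdGaussian E)
  change MeasurePreserving _ (gaussFamily E (ι ⊕ Option κ))
    ((gaussFamily E ι).prod (gaussFamily E (Option κ))) at hpre
  have h := norm_sq_tail (E := E) hu
  set r := √(1 + ‖t‖ ^ 2 + ‖s‖ ^ 2) with hr
  have hr2 : r ^ 2 = 1 + ‖t‖ ^ 2 + ‖s‖ ^ 2 := Real.sq_sqrt (by positivity)
  have hmap := map_sum_smul_gaussFamily (E := E) (Sum.elim (fun i => s i) (dir t)) (s := r) (by
    rw [Fintype.sum_sum_type, hr2]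
    simp only [Sum.elim_inl, Sum.elim_inr, sum_dir_sq]
    rw [← EuclideanSpace.real_norm_sq_eq]; ring)
  have hm : MeasurableSet {w : E | ¬ |‖w‖ ^ 2 - (1 + ‖t‖ ^ 2 + ‖s‖ ^ 2) * finrank ℝ E| ≤
      (1 + ‖t‖ ^ 2 + ‖s‖ ^ 2) * dev u (finrank ℝ E)} :=
    measurableSet_not_le (by fun_prop) measurable_const
  have hm2 : Measurable fun p : (ι → E) × (Option κ → E) =>
    ∑ i, s i • p.1 i + ∑ k, dir t k • p.2 k := by fun_prop
  change ((gaussFamily E ι).prod (gaussFamily E (Option κ)))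
    ((fun p : (ι → E) × (Option κ → E) => ∑ i, s i • p.1 i + ∑ k, dir t k • p.2 k) ⁻¹'
      {w : E | ¬ |‖w‖ ^ 2 - (1 + ‖t‖ ^ 2 + ‖s‖ ^ 2) * finrank ℝ E| ≤
        (1 + ‖t‖ ^ 2 + ‖s‖ ^ 2) * dev u (finrank ℝ E)}) ≤ _
  rw [← hpre.measure_preimage (hm2 hm).nullMeasurableSet]
  have e : (fun g : ι ⊕ Option κ → E => ∑ k, Sum.elim (fun i => s i) (dir t) k • g k) =
      (fun p : (ι → E) × (Option κ → E) => ∑ i, s i • p.1 i + ∑ k, dir t k • p.2 k) ∘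
        (MeasurableEquiv.sumPiEquivProdPi fun _ : ι ⊕ Option κ => E) := by
    ext g
    simp [Fintype.sum_sum_type, MeasurableEquiv.coe_sumPiEquivProdPi, Equiv.sumPiEquivProdPi]
  rw [← Set.preimage_comp, ← e, ← Measure.map_apply (by fun_prop) hm, hmap,
    Measure.map_apply (by fun_prop) hm]
  refine le_trans (measure_mono ?_) h
  intro w hw hlt
  refine hw ?_
  rw [norm_smul, mul_pow, Real.norm_eq_abs, sq_abs, hr2, ← mul_sub, abs_mul,
    abs_of_pos (by positivity)]
  exact mul_le_mul_of_nonneg_left (le_of_lt hlt) (by positivity)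

-- Given z, the second block enters through its projections onto the orthogonal complement of the
-- span of z. A bound that is uniform over subspaces of that dimension therefore holds
-- unconditionally.
omit hu in
lemma blockErr_tail (hle : Fintype.card ι + Fintype.card κ ≤ finrank ℝ E)
    {S : Set (EuclideanSpace ℝ κ)} (hS : MeasurableSet S)
    (hF : ∀ F : Submodule ℝ E, finrank ℝ F = finrank ℝ E - Fintype.card ι →
      ((gaussFamily E κ).prod (stdGaussian E))
        {p | coef (fun i => F.starProjection (p.1 i)) p.2 ∈ S} ≤ 4 * tailProb u) :
    ((gaussFamily E ι).prod (gaussFamily E (Option κ))) {p | blockErr p.1 p.2 ∈ S} ≤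
      4 * tailProb u := by
  have hm0 : Measurable fun p : (ι → E) × ((κ → E) × E) =>
      coef (fun k => resid p.1 (p.2.1 k)) p.2.2 :=
    measurable_coef (measurable_pi_iff.2 fun k => measurable_resid (by fun_prop) (by fun_prop))
      (by fun_prop)
  refine prod_option_le (A := {p | coef (fun k => resid p.1 (p.2.1 k)) p.2.2 ∈ S}) (hm0 hS) ?_
  filter_upwards [ae_linearIndependent_id (ι := ι) (E := E) (by omega)] with z hz
  have h := hF (Submodule.span ℝ (Set.range z))ᗮ (finrank_orthogonal_span hz)
  simpa only [Set.mem_ofPred_eq, resid_eq_starProjection hz] using h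

variable [Nonempty ι]

/-- All the bounds in `IsTypical` hold with high probability. -/
lemma measure_not_isTypical_le [Nonempty κ]
    (hlt : Fintype.card ι + Fintype.card κ < finrank ℝ E)
    {K₁ K : ℕ} (hK₁ : finrank ℝ E - Fintype.card ι + 1 = K₁)
    (hK : finrank ℝ E - (Fintype.card ι + Fintype.card κ) + 1 = K)
    (hd₁ : dev u K₁ < K₁) (hd : dev u K < K) :
    ((gaussFamily E ι).prod (gaussFamily E (Option κ))) {p | ¬ IsTypical u s t p.1 p.2} ≤
      38 * tailProb u := by
  set μ := (gaussFamily E ι).prod (gaussFamily E (Option κ)) with hμ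
  have hle := hlt.le
  have hle₁ : Fintype.card ι ≤ finrank ℝ E := by omega
  have hKF : ∀ F : Submodule ℝ E, finrank ℝ F = finrank ℝ E - Fintype.card ι →
      finrank ℝ F - Fintype.card κ + 1 = K := fun F hF => by omega
  have h0 : μ {p | ¬ (LinearIndependent ℝ p.1 ∧
      LinearIndependent ℝ fun k => resid p.1 (p.2 (some k)))} = 0 := ae_iff.1 (ae_linInd hle)
  have h1 := rss_tail (ι := ι) (κ := κ) (E := E) hu hle
  have h2 := rss₁_tail (ι := ι) (E := E) hu t hle₁
  have h3 := total_tail (E := E) hu s t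
  have h4 := blockErr_tail (ι := ι) (κ := κ) (E := E) (u := u) hle
    (measurableSet_not_le (by fun_prop) measurable_const)
    (fun F hF => norm_sq_coef_tail (ι := κ) F (by omega) (hKF F hF) hu hd)
  have h5 := blockErr_tail (ι := ι) (κ := κ) (E := E) (u := u) hle
    (measurableSet_not_le (by fun_prop) measurable_const)
    (fun F hF => inner_coef_tail (ι := κ) F (by omega) (hKF F hF) hu hd t)
  -- the two directions and their normalizations
  set c : (ι → E) × (Option κ → E) → Option κ → ℝ := fun p => dir (-blockErr p.1 p.2) with hc
  have hcm : Measurable c := measurable_dir measurable_blockErr.neg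
  have hcr : ∀ z G, LinearIndependent ℝ z → c (z, fun k => resid z (G k)) = c (z, G) :=
    fun z G hz => by simp only [hc, blockErr_resid hz]
  have hdm : Measurable fun _ : (ι → E) × (Option κ → E) => dir t := measurable_const
  have hdr : ∀ (z : ι → E) (G : Option κ → E), LinearIndependent ℝ z →
    (fun _ : (ι → E) × (Option κ → E) => dir t) (z, fun k => resid z (G k)) =
      (fun _ : (ι → E) × (Option κ → E) => dir t) (z, G) := fun z G hz => rfl
  have hcsq : ∀ p, ∑ k, c p k ^ 2 = 1 + ‖blockErr p.1 p.2‖ ^ 2 := fun p => by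
    simp only [hc, sum_dir_sq, norm_neg]
  have h6 := norm_sq_coef_combination_tail hle₁ hcm hcr hK₁ hu hd₁
  have h7 := norm_sq_coef_combination_tail hle₁ hdm hdr hK₁ hu hd₁
  have h8 := inner_coef_combination_tail hle₁ hcm hcr hK₁ hu hd₁ s
  have h9 := inner_coef_combination_tail hle₁ hdm hdr hK₁ hu hd₁ s
  set nc : (ι → E) × (Option κ → E) → ℝ := fun p => (√(1 + ‖blockErr p.1 p.2‖ ^ 2))⁻¹ with hnc
  set nt : ℝ := (√(1 + ‖t‖ ^ 2))⁻¹ with hnt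
  have hncm : Measurable nc :=
    ((measurable_blockErr.norm.pow_const 2).const_add 1).sqrt.inv
  have hvm : ∀ σ : ℝ, Measurable fun p => nc p • c p + (σ * nt) • dir t := fun σ =>
    measurable_pi_iff.2 fun k =>
      (hncm.mul ((measurable_pi_apply k).comp hcm)).add measurable_const
  have hvr : ∀ σ : ℝ, ∀ (z : ι → E) (G : Option κ → E), LinearIndependent ℝ z →
      (fun p => nc p • c p + (σ * nt) • dir t) (z, fun k => resid z (G k)) =
        (fun p => nc p • c p + (σ * nt) • dir t) (z, G) := fun σ z G hz => by
    simp only [hcr z G hz, hnc, blockErr_resid hz]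
  -- The inner product of the two coefficient vectors is reached by polarization, from the sum and
  -- the difference of the two directions scaled to unit length.
  have h10 := norm_sq_coef_combination_tail hle₁ (hvm 1) (hvr 1) hK₁ hu hd₁
  have h11 := norm_sq_coef_combination_tail hle₁ (hvm (-1)) (hvr (-1)) hK₁ hu hd₁
  -- Linear independence fails with probability 0, `h1` to `h3` cost 2 exp(-u) each and `h4` to
  -- `h11` cost 4 exp(-u) each: 3 · 2 + 8 · 4 = 38.
  have hall := measure_union_le_add (measure_union_le_add (measure_union_le_add
    (measure_union_le_add (measure_union_le_add (measure_union_le_add (measure_union_le_add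
    (measure_union_le_add (measure_union_le_add (measure_union_le_add (measure_union_le_add
      h0.le h1) h2) h3) h4) h5) h6) h7) h8) h9) h10) h11
  refine (measure_mono fun p hp => ?_).trans (hall.trans_eq (by ring))
  by_contra hcon
  simp only [Set.mem_union, not_or, Set.mem_ofPred_eq, not_not] at hcon
  obtain ⟨⟨⟨⟨⟨⟨⟨⟨⟨⟨⟨g0, g1⟩, g2⟩, g3⟩, g4⟩, g5⟩, g6⟩, g7⟩, g8⟩, g9⟩, g10⟩, g11⟩ := hcon
  refine hp ?_
  subst hK hK₁
  rw [hcsq] at g6 g8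
  rw [sum_dir_sq] at g7 g9
  refine ⟨g0.1, g0.2, g1, g2, g3, g4, g5, g6, g7, ?_, g8, g9⟩
  set e := blockErr p.1 p.2 with he
  set Hc := coef p.1 (∑ k, c p k • p.2 k) with hHc
  set Hd := coef p.1 (∑ k, dir t k • p.2 k) with hHd
  have hnc0 : 0 < √(1 + ‖e‖ ^ 2) := Real.sqrt_pos.2 (by positivity)
  have hnt0 : 0 < √(1 + ‖t‖ ^ 2) := Real.sqrt_pos.2 (by positivity)
  have hncp : nc p = (√(1 + ‖e‖ ^ 2))⁻¹ := rfl
  have hcd : ∑ k, c p k * dir t k = 1 - ⟪t, e⟫ := by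
    simp only [hc, sum_dir_mul, inner_neg_left, ← he]
    rw [real_inner_comm]; ring
  have hsum : ∀ σ : ℝ, σ ^ 2 = 1 → ∑ k, (nc p • c p + (σ * nt) • dir t) k ^ 2 =
      2 + 2 * (σ * (nc p * nt * (1 - ⟪t, e⟫))) := fun σ hσ => by
    have e1 : ∀ k, (nc p • c p + (σ * nt) • dir t) k ^ 2 = nc p ^ 2 * c p k ^ 2 +
        2 * σ * nc p * nt * (c p k * dir t k) + σ ^ 2 * nt ^ 2 * dir t k ^ 2 := fun k => by
      simp only [Pi.add_apply, Pi.smul_apply, smul_eq_mul]; ring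
    simp only [e1, Finset.sum_add_distrib, ← Finset.mul_sum]
    rw [hcsq, hcd, sum_dir_sq, hσ, hncp, hnt, inv_pow, inv_pow, Real.sq_sqrt (by positivity),
      Real.sq_sqrt (by positivity), ← he, inv_mul_cancel₀ (by positivity), one_mul,
      inv_mul_cancel₀ (by positivity)]
    ring
  have hco : ∀ σ : ℝ, coef p.1 (∑ k, (nc p • c p + (σ * nt) • dir t) k • p.2 k) =
      nc p • Hc + σ • nt • Hd := fun σ => by
    simp only [Pi.add_apply, Pi.smul_apply, smul_eq_mul, add_smul, mul_smul,
      Finset.sum_add_distrib, ← Finset.smul_sum, coef_add, coef_smul, hHc, hHd]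
  rw [hco, hsum 1 (by norm_num), one_smul, one_mul] at g10
  rw [hco, hsum (-1) (by norm_num), neg_one_smul, ← sub_eq_add_neg,
    show ∀ x : ℝ, 2 + 2 * (-1 * x) = 2 - 2 * x from fun x => by ring] at g11
  have hpol := abs_inner_sub_le_of_polarization g10 g11
  rw [real_inner_smul_left, real_inner_smul_right, hncp, hnt] at hpol
  have hfac : ∀ a b x y q : ℝ, 0 < a → 0 < b →
      a⁻¹ * (b⁻¹ * x) - q * (a⁻¹ * b⁻¹ * y) = (x - q * y) / (a * b) := by
    intro a b x y q ha hb; field_simp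
  rwa [hfac _ _ _ _ _ hnc0 hnt0, abs_div, abs_of_pos (mul_pos hnc0 hnt0),
    div_le_iff₀ (mul_pos hnc0 hnt0)] at hpol

end Tails

end Canonical

/-! ### Size of the deviations -/

section Deviations

variable {n x κ : ℝ} (hn : 0 < n) (hx : 0 < x) (hx1 : x ≤ 1) (hκ : 0 < κ) (hκ1 : 119 * κ ≤ 1)

include hn hx hx1 hκ hκ1

/-- For dimensions that are only bounded above, such as block sizes in numerators. Here √(k u) ≤ n κ
x b, and u ≤ 0.01 n κ x b because κ ≤ 1/119, so the constant is 2 + 2 · 0.01. -/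
lemma dev_le_of_le {b : ℝ} {k : ℕ} (hb : x ≤ b) (hk : (k : ℝ) ≤ n * b) :
    dev (n * κ ^ 2 * x ^ 3) k ≤ 2.02 * κ * x * b * n := by
  have hb0 : 0 < b := hx.trans_le hb
  have h1 : √(k * (n * κ ^ 2 * x ^ 3)) ≤ n * κ * x * b := by
    apply Real.sqrt_le_iff.2
    refine ⟨by positivity, ?_⟩
    calc (k : ℝ) * (n * κ ^ 2 * x ^ 3) ≤ (n * b) * (n * κ ^ 2 * x ^ 3) := by gcongr
      _ = (n * κ * x) ^ 2 * b * x := by ring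
      _ ≤ (n * κ * x) ^ 2 * b * b := by gcongr
      _ = _ := by ring
  have h2 : n * κ ^ 2 * x ^ 3 ≤ 0.01 * (n * κ * x * b) := by
    calc n * κ ^ 2 * x ^ 3 = (n * κ * x) * (κ * (x * x)) := by ring
      _ ≤ (n * κ * x) * (0.01 * (b * 1)) := by gcongr; linarith
      _ = _ := by ring
  unfold dev
  linarith

/-- For degrees of freedom k ≥ n x the choice u = n κ² x³ makes √(k u) ≤ κ x k. The third power of x
leaves a relative error of order κ x, whose factor x later absorbs terms of size 1/x in the risk. -/
lemma dev_le_mul {k : ℕ} (hk : n * x ≤ k) :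
    dev (n * κ ^ 2 * x ^ 3) k ≤ 2.02 * κ * x * k := by
  have hk0 : (0 : ℝ) < k := (mul_pos hn hx).trans_le hk
  have h1 : √(k * (n * κ ^ 2 * x ^ 3)) ≤ κ * x * k := by
    apply Real.sqrt_le_iff.2
    refine ⟨by positivity, ?_⟩
    calc (k : ℝ) * (n * κ ^ 2 * x ^ 3) = k * κ ^ 2 * x ^ 2 * (n * x) := by ring
      _ ≤ k * κ ^ 2 * x ^ 2 * k := by gcongr
      _ = _ := by ring
  have h2 : n * κ ^ 2 * x ^ 3 ≤ 0.01 * (κ * x * k) := by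
    calc n * κ ^ 2 * x ^ 3 = (n * x) * (κ * x) * (κ * x) := by ring
      _ ≤ k * (κ * x) * (0.01 * 1) := by gcongr; linarith
      _ = _ := by ring
  unfold dev
  linarith

lemma dev_lt_self {k : ℕ} (hk : n * x ≤ k) : dev (n * κ ^ 2 * x ^ 3) k ≤ 0.02 * k := by
  refine (dev_le_mul hn hx hx1 hκ hκ1 hk).trans ?_
  have : κ * x ≤ 1 / 119 * 1 := by gcongr; linarith
  gcongr
  linarith

lemma scoreDev_le {K : ℕ} (hK : n * x ≤ K) :
    scoreDev (n * κ ^ 2 * x ^ 3) K ≤ 1.45 * κ * x := by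
  have hK0 : (0 : ℝ) < K := (mul_pos hn hx).trans_le hK
  have h1 := dev_lt_self hn hx hx1 hκ hκ1 hK
  have h2 : (0 : ℝ) < K - dev (n * κ ^ 2 * x ^ 3) K := by linarith
  rw [scoreDev, div_le_iff₀ (Real.sqrt_pos.2 h2)]
  have h3 : √(0.98 * (n * x)) ≤ √(K - dev (n * κ ^ 2 * x ^ 3) K) :=
    Real.sqrt_le_sqrt (by linarith)
  refine le_trans ?_ (mul_le_mul_of_nonneg_left h3 (by positivity))
  -- After squaring this is 2 ≤ 1.45² · 0.98.
  rw [Real.sqrt_le_left (by positivity), mul_pow, Real.sq_sqrt (by positivity)]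
  have : 0 ≤ n * κ ^ 2 * x ^ 3 := by positivity
  nlinarith

lemma ratioDev_le {b y : ℝ} {k K : ℕ} (hb : x ≤ b) (hk : (k : ℝ) ≤ n * b)
    (hxy : x ≤ y) (hK : n * y ≤ K) :
    ratioDev (n * κ ^ 2 * x ^ 3) k K ≤ 4.2 * κ * x * b / y := by
  have hy : 0 < y := hx.trans_le hxy
  have hb0 : 0 < b := hx.trans_le hb
  have hK' : n * x ≤ K := le_trans (by gcongr) hK
  have hK0 : (0 : ℝ) < K := (mul_pos hn hy).trans_le hK
  have h1 := dev_lt_self hn hx hx1 hκ hκ1 hK'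
  have h2 := dev_le_mul hn hx hx1 hκ hκ1 hK'
  have h3 := dev_le_of_le hn hx hx1 hκ hκ1 hb hk
  rw [ratioDev, div_le_div_iff₀ (by linarith) hy]
  have h4 : (k : ℝ) / K * dev (n * κ ^ 2 * x ^ 3) K ≤ 2.02 * κ * x * b * n := by
    calc (k : ℝ) / K * dev (n * κ ^ 2 * x ^ 3) K ≤ k / K * (2.02 * κ * x * K) := by gcongr
      _ = 2.02 * κ * x * k := by field_simp
      _ ≤ 2.02 * κ * x * (n * b) := by gcongr
      _ = _ := by ring
  calc (dev (n * κ ^ 2 * x ^ 3) k + k / K * dev (n * κ ^ 2 * x ^ 3) K) * y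
      ≤ (2.02 * κ * x * b * n + 2.02 * κ * x * b * n) * y := by gcongr
    _ = 4.04 * κ * x * b * (n * y) := by ring
    _ ≤ 4.04 * κ * x * b * K := by gcongr
    _ ≤ 4.2 * κ * x * b * (0.98 * K) := by
      have : 0 < κ * x * b * K := by positivity
      linarith
    _ ≤ _ := by gcongr; linarith

end Deviations

/-! ### Comparison of the prediction error and its estimate with a common reference value -/

/-- The reference value: `a, b` are the shrinkage factors, `S, T` the squared lengths of the
coefficient vectors of the two blocks, and `q₁`, `q` the limits of the estimation errors. -/
def refRisk (a b S T q₁ q : ℝ) : ℝ :=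
  1 + a ^ 2 * S + b ^ 2 * T + (1 - b) ^ 2 * (q - q₁) + (1 - a) ^ 2 * q₁ + (b - a) ^ 2 * q₁ * T

section Deterministic

variable {a b S T q₁ q₂ q κ x x₁ L : ℝ}

lemma refRisk_ge (hq₁ : 0 ≤ q₁) (hqq : q₁ ≤ q) :
    1 + a ^ 2 * S + b ^ 2 * T + (b - a) ^ 2 * q₁ * T ≤ refRisk a b S T q₁ q := by
  have h1 : 0 ≤ (1 - b) ^ 2 * (q - q₁) := mul_nonneg (sq_nonneg _) (by linarith)
  have h2 : 0 ≤ (1 - a) ^ 2 * q₁ := by positivity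
  unfold refRisk; linarith

/-- M plays the role of L times the reference risk. The letters e, hc, hd are squared lengths of the
second-block error and of the two coefficient vectors; hcd, l₂, lc, ld are inner products. Each
cross term is split by 2xy ≤ x² + y² into pieces controlled by a² S ≤ M, b² T ≤ M and (b - a)² (1 +
T) ≤ 2M. The nine constants add up to 45.58. -/
lemma abs_risk_errors_le (ha : 0 ≤ a) (hb : 0 ≤ b) (hb1 : b ≤ 1)
    (hS : 0 ≤ S) (hT : 0 ≤ T) (hx : 0 < x) (hxx : x ≤ x₁) (hx1 : x₁ ≤ 1)
    (hκ : 0 < κ) (hκ1 : 119 * κ ≤ 1) (hq₁ : 0 ≤ q₁) (hq₁x : q₁ * x₁ ≤ 1)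
    (hq₂x : (1 + q₂) * x ≤ x₁) {M : ℝ} (haM : 1 + a ^ 2 * S ≤ M) (hbM : 1 + b ^ 2 * T ≤ M)
    (hB0 : (b - a) ^ 2 * (1 + T) ≤ 2 * M)
    {e e₁ ℓ hc hd hcd l₂ lc ld : ℝ} (he0 : 0 ≤ e) (hℓ : ℓ ≤ 1.45 * κ * x)
    (he₁ : e₁ * x₁ ≤ 4.2 * κ * x) (he₁0 : 0 ≤ e₁)
    (he : |e - q₂| ≤ 4.2 * κ * x₁)
    (h_c : |hc - q₁ * (1 + e)| ≤ e₁ * (1 + e)) (h_d : |hd - q₁ * (1 + T)| ≤ e₁ * (1 + T))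
    (h_cd : |hcd - q₁ * (1 - l₂)| ≤ e₁ * (√(1 + e) * √(1 + T)))
    (h_l₂ : |l₂| ≤ √T * ℓ) (h_lc : |lc| ≤ √S * ℓ * √(1 + e))
    (h_ld : |ld| ≤ √S * ℓ * √(1 + T)) (hℓ0 : 0 ≤ ℓ) :
    |(1 - b) ^ 2 * (hc - q₁ * (1 + e)) + (1 - b) ^ 2 * (q₁ * (e - q₂)) + (1 - b) ^ 2 * (e - q₂)
      + (b - a) ^ 2 * (hd - q₁ * (1 + T)) + 2 * (1 - b) * (b - a) * (hcd - q₁ * (1 - l₂))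
      - 2 * (1 - b) * (b - a) * (q₁ * l₂) - 2 * a * (1 - b) * lc - 2 * a * (b - a) * ld
      - 2 * b * (1 - b) * l₂| ≤ 46 * (κ * M) := by
  have haS : 0 ≤ a ^ 2 * S := by positivity
  have hM1 : 1 ≤ M := by linarith
  have h1b : (1 - b) ^ 2 ≤ 1 := pow_le_one₀ (by linarith) (by linarith)
  have hx₁ : 0 < x₁ := hx.trans_le hxx
  have hB0' : (b - a) ^ 2 * T ≤ 2 * M := by linarith [sq_nonneg (b - a)]
  -- The squared error e may be as large as order x₁/x, but every error bound that multiplies 1 + e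
  -- carries a factor x. The constant uses 4.2/119 ≤ 0.036.
  have hex : (1 + e) * x ≤ 1.036 * x₁ := by
    have h1 : e ≤ q₂ + 4.2 * κ * x₁ := by linarith [(abs_le.1 he).2]
    have h2 : (4.2 * κ) * x₁ * x ≤ 0.036 * x₁ * 1 := by gcongr <;> linarith
    have h3 := mul_le_mul_of_nonneg_right h1 hx.le
    linarith
  have he₁e : e₁ * (1 + e) ≤ 4.36 * κ := by
    have h1 : (e₁ * x₁) * ((1 + e) * x) ≤ (4.2 * κ * x) * (1.036 * x₁) := by gcongr
    have h2 : (e₁ * (1 + e)) * (x * x₁) ≤ (4.36 * κ) * (x * x₁) := by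
      have : 0 < κ * x * x₁ := by positivity
      linarith
    exact le_of_mul_le_mul_right h2 (by positivity)
  have he₁κ : e₁ ≤ 4.2 * κ := by
    have : e₁ * x₁ ≤ (4.2 * κ) * x₁ := he₁.trans (by gcongr)
    exact le_of_mul_le_mul_right this hx₁
  have hℓκ : ℓ ≤ 1.45 * κ := by
    have : 1.45 * κ * x ≤ 1.45 * κ * 1 := by gcongr; linarith
    linarith
  have hse : √(1 + e) ^ 2 = 1 + e := Real.sq_sqrt (by positivity)
  have hsT1 : √(1 + T) ^ 2 = 1 + T := Real.sq_sqrt (by positivity)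
  have hsT : √T ^ 2 = T := Real.sq_sqrt hT
  have hsS : √S ^ 2 = S := Real.sq_sqrt hS
  have hκM : κ ≤ κ * M := le_mul_of_one_le_right hκ.le hM1
  have B1 : |(1 - b) ^ 2 * (hc - q₁ * (1 + e))| ≤ 4.36 * (κ * M) := by
    rw [abs_mul, abs_of_nonneg (sq_nonneg _)]
    calc (1 - b) ^ 2 * |hc - q₁ * (1 + e)| ≤ 1 * (4.36 * κ) := by
          gcongr; exact h_c.trans he₁e
      _ ≤ _ := by linarith
  have B2 : |(1 - b) ^ 2 * (q₁ * (e - q₂))| ≤ 4.2 * (κ * M) := by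
    rw [abs_mul, abs_of_nonneg (sq_nonneg _), abs_mul, abs_of_nonneg hq₁]
    calc (1 - b) ^ 2 * (q₁ * |e - q₂|) ≤ 1 * (q₁ * (4.2 * κ * x₁)) := by gcongr
      _ = (4.2 * κ) * (q₁ * x₁) := by ring
      _ ≤ (4.2 * κ) * 1 := by gcongr
      _ ≤ _ := by linarith
  have B3 : |(1 - b) ^ 2 * (e - q₂)| ≤ 4.2 * (κ * M) := by
    rw [abs_mul, abs_of_nonneg (sq_nonneg _)]
    calc (1 - b) ^ 2 * |e - q₂| ≤ 1 * (4.2 * κ * 1) := by gcongr; exact he.trans (by gcongr)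
      _ ≤ _ := by linarith
  have B4 : |(b - a) ^ 2 * (hd - q₁ * (1 + T))| ≤ 8.4 * (κ * M) := by
    rw [abs_mul, abs_of_nonneg (sq_nonneg _)]
    calc (b - a) ^ 2 * |hd - q₁ * (1 + T)| ≤ (b - a) ^ 2 * (e₁ * (1 + T)) := by gcongr
      _ = e₁ * ((b - a) ^ 2 * (1 + T)) := by ring
      _ ≤ (4.2 * κ) * (2 * M) := by gcongr
      _ = _ := by ring
  have B5 : |2 * (1 - b) * (b - a) * (hcd - q₁ * (1 - l₂))| ≤ 12.76 * (κ * M) := by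
    rw [abs_mul, abs_mul, abs_of_nonneg (by linarith : 0 ≤ 2 * (1 - b))]
    calc 2 * (1 - b) * |b - a| * |hcd - q₁ * (1 - l₂)|
        ≤ 2 * 1 * |b - a| * (e₁ * (√(1 + e) * √(1 + T))) := by gcongr; linarith
      _ = e₁ * (2 * √(1 + e) * (|b - a| * √(1 + T))) := by ring
      _ ≤ e₁ * (√(1 + e) ^ 2 + (|b - a| * √(1 + T)) ^ 2) := by
          gcongr; exact two_mul_le_add_sq _ _
      _ = e₁ * (1 + e) + e₁ * ((b - a) ^ 2 * (1 + T)) := by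
          rw [mul_pow, sq_abs, hse, hsT1]; ring
      _ ≤ 4.36 * κ + (4.2 * κ) * (2 * M) := by gcongr
      _ ≤ _ := by linarith
  have B6 : |2 * (1 - b) * (b - a) * (q₁ * l₂)| ≤ 4.35 * (κ * M) := by
    rw [abs_mul, abs_mul, abs_of_nonneg (by linarith : 0 ≤ 2 * (1 - b)), abs_mul,
      abs_of_nonneg hq₁]
    calc 2 * (1 - b) * |b - a| * (q₁ * |l₂|)
        ≤ 2 * 1 * |b - a| * (q₁ * (√T * (1.45 * κ * x₁))) := by
          gcongr
          · linarith
          · exact h_l₂.trans (by gcongr; exact hℓ.trans (by gcongr))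
      _ = (1.45 * κ) * (q₁ * x₁) * (2 * 1 * (|b - a| * √T)) := by ring
      _ ≤ (1.45 * κ) * 1 * (1 ^ 2 + (|b - a| * √T) ^ 2) := by
          gcongr; exact two_mul_le_add_sq _ _
      _ = (1.45 * κ) * (1 + (b - a) ^ 2 * T) := by rw [mul_pow, sq_abs, hsT]; ring
      _ ≤ (1.45 * κ) * (1 + 2 * M) := by gcongr
      _ ≤ _ := by linarith
  have B7 : |2 * a * (1 - b) * lc| ≤ 1.51 * (κ * M) := by
    rw [abs_mul, abs_of_nonneg (mul_nonneg (by linarith) (by linarith) : 0 ≤ 2 * a * (1 - b))]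
    calc 2 * a * (1 - b) * |lc| ≤ 2 * a * 1 * (√S * ℓ * √(1 + e)) := by gcongr; linarith
      _ = ℓ * (2 * (a * √S) * √(1 + e)) := by ring
      _ ≤ ℓ * ((a * √S) ^ 2 + √(1 + e) ^ 2) := by gcongr; exact two_mul_le_add_sq _ _
      _ = ℓ * (a ^ 2 * S) + ℓ * (1 + e) := by rw [mul_pow, hsS, hse]; ring
      _ ≤ 1.45 * κ * (M - 1) + (1.45 * κ * x) * (1 + e) := by
          gcongr; linarith
      _ = 1.45 * κ * (M - 1) + 1.45 * κ * ((1 + e) * x) := by ring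
      _ ≤ 1.45 * κ * (M - 1) + 1.45 * κ * (1.036 * 1) := by
          have := hex.trans (mul_le_mul_of_nonneg_left hx1 (by norm_num))
          gcongr
      _ ≤ _ := by linarith
  have B8 : |2 * a * (b - a) * ld| ≤ 4.35 * (κ * M) := by
    rw [abs_mul, abs_mul, abs_of_nonneg (by linarith : 0 ≤ 2 * a)]
    calc 2 * a * |b - a| * |ld| ≤ 2 * a * |b - a| * (√S * ℓ * √(1 + T)) := by gcongr
      _ = ℓ * (2 * (a * √S) * (|b - a| * √(1 + T))) := by ring
      _ ≤ ℓ * ((a * √S) ^ 2 + (|b - a| * √(1 + T)) ^ 2) := by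
          gcongr; exact two_mul_le_add_sq _ _
      _ = ℓ * (a ^ 2 * S + (b - a) ^ 2 * (1 + T)) := by
          rw [mul_pow, mul_pow, sq_abs, hsS, hsT1]
      _ ≤ (1.45 * κ) * (M + 2 * M) := by gcongr; linarith
      _ = _ := by ring
  have B9 : |2 * b * (1 - b) * l₂| ≤ 1.45 * (κ * M) := by
    rw [abs_mul, abs_of_nonneg (mul_nonneg (by linarith) (by linarith) : 0 ≤ 2 * b * (1 - b))]
    calc 2 * b * (1 - b) * |l₂| ≤ 2 * b * 1 * (√T * ℓ) := by gcongr; linarith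
      _ = ℓ * (2 * 1 * (b * √T)) := by ring
      _ ≤ ℓ * (1 ^ 2 + (b * √T) ^ 2) := by gcongr; exact two_mul_le_add_sq _ _
      _ = ℓ * (1 + b ^ 2 * T) := by rw [mul_pow, hsT]; ring
      _ ≤ (1.45 * κ) * M := by gcongr
      _ = _ := by ring
  rw [abs_le] at B1 B2 B3 B4 B5 B6 B7 B8 B9 ⊢
  constructor <;> linarith

lemma abs_risk_sub_refRisk_le (ha : 0 ≤ a) (hb : 0 ≤ b) (hb1 : b ≤ 1)
    (hS : 0 ≤ S) (hT : 0 ≤ T) (hx : 0 < x) (hxx : x ≤ x₁) (hx1 : x₁ ≤ 1)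
    (hκ : 0 < κ) (hκ1 : 119 * κ ≤ 1) (hq₁ : 0 ≤ q₁) (hq₁x : q₁ * x₁ ≤ 1) (hq₂ : 0 ≤ q₂)
    (hq₂x : (1 + q₂) * x ≤ x₁) (hq : q = q₁ * (1 + q₂) + q₂) (hL : 1 ≤ L)
    (haL : a ^ 2 * (1 + T) ≤ L * refRisk a b S T q₁ q)
    {e e₁ ℓ hc hd hcd l₂ lc ld : ℝ} (he0 : 0 ≤ e) (hℓ : ℓ ≤ 1.45 * κ * x)
    (he₁ : e₁ * x₁ ≤ 4.2 * κ * x) (he₁0 : 0 ≤ e₁)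
    (he : |e - q₂| ≤ 4.2 * κ * x₁)
    (h_c : |hc - q₁ * (1 + e)| ≤ e₁ * (1 + e)) (h_d : |hd - q₁ * (1 + T)| ≤ e₁ * (1 + T))
    (h_cd : |hcd - q₁ * (1 - l₂)| ≤ e₁ * (√(1 + e) * √(1 + T)))
    (h_l₂ : |l₂| ≤ √T * ℓ) (h_lc : |lc| ≤ √S * ℓ * √(1 + e))
    (h_ld : |ld| ≤ √S * ℓ * √(1 + T)) (hℓ0 : 0 ≤ ℓ) :
    |1 + ((1 - b) ^ 2 * hc + (b - a) ^ 2 * hd + a ^ 2 * S + 2 * (1 - b) * (b - a) * hcd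
        - 2 * a * (1 - b) * lc - 2 * a * (b - a) * ld)
      + ((1 - b) ^ 2 * e + b ^ 2 * T - 2 * b * (1 - b) * l₂) - refRisk a b S T q₁ q| ≤
      46 * κ * L * refRisk a b S T q₁ q := by
  have hqq : q₁ ≤ q := by rw [hq]; linarith [mul_nonneg hq₁ hq₂]
  have hRge := refRisk_ge (a := a) (b := b) (S := S) (T := T) hq₁ hqq
  have haS : 0 ≤ a ^ 2 * S := by positivity
  have hbT : 0 ≤ b ^ 2 * T := by positivity
  have habT : 0 ≤ (b - a) ^ 2 * q₁ * T := by positivity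
  have hLR : refRisk a b S T q₁ q ≤ L * refRisk a b S T q₁ q :=
    le_mul_of_one_le_left (by linarith) hL
  -- Since a, b ≥ 0, (b - a)² ≤ a² + b². The b-part is below the reference risk R because b² ≤ 1;
  -- the a-part is where the comparison with L R is indispensable.
  have hB0 : (b - a) ^ 2 * (1 + T) ≤ 2 * (L * refRisk a b S T q₁ q) := by
    have h1 : (b - a) ^ 2 ≤ a ^ 2 + b ^ 2 := by linarith [mul_nonneg ha hb, sub_sq b a]
    have h2 : (b - a) ^ 2 * (1 + T) ≤ (a ^ 2 + b ^ 2) * (1 + T) := by gcongr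
    have hb2 : b ^ 2 ≤ 1 := pow_le_one₀ hb hb1
    linarith
  have h := abs_risk_errors_le ha hb hb1 hS hT hx hxx hx1 hκ hκ1 hq₁ hq₁x hq₂x
    (by linarith) (by linarith) hB0 he0 hℓ he₁ he₁0 he h_c h_d h_cd h_l₂ h_lc h_ld hℓ0
  calc _ = _ := by
        congr 1
        rw [refRisk, hq]; ring
    _ ≤ _ := h
    _ = _ := by ring

/-- With σ, m, y replaced by their limits 1, 1 + T, 1 + T + S the estimate equals the reference
risk, and r cancels. The weights are of size up to 1 + q, which the factor x in the relative errors
compensates through (1 + q) x ≤ 1. The three errors have constants 2.05 + 2.05 + 4.1 = 8.2. -/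
lemma abs_estimate_sub_refRisk_le (ha : 0 ≤ a) (ha1 : a ≤ 1) (hb : 0 ≤ b) (hb1 : b ≤ 1)
    (hS : 0 ≤ S) (hT : 0 ≤ T) (hx : 0 < x) (hx1 : x ≤ 1) (hκ : 0 < κ)
    (hq₁ : 0 ≤ q₁) (hqq : q₁ ≤ q) (hqx : (1 + q) * x ≤ 1) (hL : 1 ≤ L)
    (haL : a ^ 2 * (1 + T) ≤ L * refRisk a b S T q₁ q)
    {σ m y r : ℝ} (hσ : |σ - 1| ≤ 2.05 * κ * x) (hm : |m - (1 + T)| ≤ 2.05 * κ * x * (1 + T))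
    (hy : |y - (1 + T + S)| ≤ 2.05 * κ * x * (1 + T + S)) :
    |((1 - b) ^ 2 * q + 1 - b ^ 2 - (a - b) ^ 2 * q₁ + (b - a) * (2 - a - b) * q₁) * σ
      + a ^ 2 * (y - (1 - r) * m) + (b ^ 2 - a ^ 2 * r + (b - a) ^ 2 * q₁) * m
      - refRisk a b S T q₁ q| ≤ 8.2 * κ * L * refRisk a b S T q₁ q := by
  have hRge := refRisk_ge (a := a) (b := b) (S := S) (T := T) hq₁ hqq
  obtain ⟨R, hR⟩ : ∃ R, R = refRisk a b S T q₁ q := ⟨_, rfl⟩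
  rw [← hR] at hRge haL ⊢
  have hq0 : 0 ≤ q := hq₁.trans hqq
  have haS : 0 ≤ a ^ 2 * S := by positivity
  have hbT : 0 ≤ b ^ 2 * T := by positivity
  have habT : 0 ≤ (b - a) ^ 2 * q₁ * T := by positivity
  have hR1 : 1 ≤ R := by linarith
  have hLR : R ≤ L * R := le_mul_of_one_le_left (by linarith) hL
  have hb2 : b ^ 2 ≤ 1 := pow_le_one₀ hb hb1
  have h1b : (1 - b) ^ 2 ≤ 1 := pow_le_one₀ (by linarith) (by linarith)
  have h1a : (1 - a) ^ 2 ≤ 1 := pow_le_one₀ (by linarith) (by linarith)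
  have hba : (b - a) ^ 2 ≤ 1 := by
    rw [sq_le_one_iff_abs_le_one, abs_le]; constructor <;> linarith
  have hκR : κ ≤ κ * (L * R) := le_mul_of_one_le_right hκ.le (by linarith)
  have hw : |(1 - b) ^ 2 * q + 1 - b ^ 2 - (a - b) ^ 2 * q₁ + (b - a) * (2 - a - b) * q₁| ≤
      1 + q := by
    have e1 : (1 - b) ^ 2 * q + 1 - b ^ 2 - (a - b) ^ 2 * q₁ + (b - a) * (2 - a - b) * q₁ =
        1 - b ^ 2 + (1 - b) ^ 2 * (q - q₁) + (1 - a) ^ 2 * q₁ - (b - a) ^ 2 * q₁ := by ring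
    have h2 : (1 - b) ^ 2 * (q - q₁) ≤ 1 * (q - q₁) :=
      mul_le_mul_of_nonneg_right h1b (by linarith)
    have h2' : 0 ≤ (1 - b) ^ 2 * (q - q₁) := mul_nonneg (sq_nonneg _) (by linarith)
    have h3 : (1 - a) ^ 2 * q₁ ≤ 1 * q₁ := mul_le_mul_of_nonneg_right h1a hq₁
    have h4 : (b - a) ^ 2 * q₁ ≤ 1 * q₁ := mul_le_mul_of_nonneg_right hba hq₁
    have h5 : 0 ≤ (b - a) ^ 2 * q₁ := by positivity
    have h6 : 0 ≤ (1 - a) ^ 2 * q₁ := by positivity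
    rw [e1, abs_le]
    constructor <;> linarith [sq_nonneg b]
  have B1 : |((1 - b) ^ 2 * q + 1 - b ^ 2 - (a - b) ^ 2 * q₁ + (b - a) * (2 - a - b) * q₁) *
      (σ - 1)| ≤ 2.05 * (κ * (L * R)) := by
    rw [abs_mul]
    calc _ ≤ (1 + q) * (2.05 * κ * x) := by gcongr
      _ = 2.05 * κ * ((1 + q) * x) := by ring
      _ ≤ 2.05 * κ * 1 := by gcongr
      _ ≤ _ := by linarith
  have B2 : |(b ^ 2 + (b - a) ^ 2 * q₁ - a ^ 2) * (m - (1 + T))| ≤ 2.05 * (κ * (L * R)) := by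
    rw [abs_mul]
    have h1 : |b ^ 2 + (b - a) ^ 2 * q₁ - a ^ 2| * (1 + T) * x ≤ L * R := by
      have e1 : |b ^ 2 + (b - a) ^ 2 * q₁ - a ^ 2| * (1 + T) * x =
          |(b ^ 2 * (1 + T) + (b - a) ^ 2 * q₁ * (1 + T) - a ^ 2 * (1 + T)) * x| := by
        rw [show (b ^ 2 * (1 + T) + (b - a) ^ 2 * q₁ * (1 + T) - a ^ 2 * (1 + T)) * x =
          (b ^ 2 + (b - a) ^ 2 * q₁ - a ^ 2) * (1 + T) * x by ring, abs_mul, abs_mul,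
          abs_of_pos hx, abs_of_pos (by positivity : 0 < 1 + T)]
      have h2 : (b - a) ^ 2 * q₁ ≤ 1 * q₁ := by gcongr
      have h3 : b ^ 2 * (1 + T) + (b - a) ^ 2 * q₁ * (1 + T) ≤ R + q₁ := by linarith
      have h4 : (R + q₁) * x ≤ R := by
        have h5 : (R + q₁) * x ≤ (R * (1 + q)) * x := by gcongr; linarith [mul_le_mul hR1 hqq hq₁ (by linarith)]
        have h6 : R * ((1 + q) * x) ≤ R * 1 := by gcongr
        linarith
      have h7 : 0 ≤ a ^ 2 * (1 + T) := by positivity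
      have h8 : 0 ≤ b ^ 2 * (1 + T) + (b - a) ^ 2 * q₁ * (1 + T) := by positivity
      rw [e1, abs_le]
      constructor
      · have : a ^ 2 * (1 + T) * x ≤ a ^ 2 * (1 + T) * 1 := by gcongr
        linarith [mul_nonneg h8 hx.le]
      · have := mul_le_mul_of_nonneg_right h3 hx.le
        linarith [mul_nonneg h7 hx.le]
    calc |b ^ 2 + (b - a) ^ 2 * q₁ - a ^ 2| * |m - (1 + T)|
        ≤ |b ^ 2 + (b - a) ^ 2 * q₁ - a ^ 2| * (2.05 * κ * x * (1 + T)) := by gcongr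
      _ = 2.05 * κ * (|b ^ 2 + (b - a) ^ 2 * q₁ - a ^ 2| * (1 + T) * x) := by ring
      _ ≤ 2.05 * κ * (L * R) := by gcongr
      _ = _ := by ring
  have B3 : |a ^ 2 * (y - (1 + T + S))| ≤ 4.1 * (κ * (L * R)) := by
    rw [abs_mul, abs_of_nonneg (sq_nonneg _)]
    calc a ^ 2 * |y - (1 + T + S)| ≤ a ^ 2 * (2.05 * κ * 1 * (1 + T + S)) := by
          gcongr; exact hy.trans (by gcongr)
      _ = 2.05 * κ * (a ^ 2 * (1 + T) + a ^ 2 * S) := by ring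
      _ ≤ 2.05 * κ * (L * R + L * R) :=
          mul_le_mul_of_nonneg_left (add_le_add haL (by linarith)) (by positivity)
      _ = _ := by ring
  have key : ((1 - b) ^ 2 * q + 1 - b ^ 2 - (a - b) ^ 2 * q₁ + (b - a) * (2 - a - b) * q₁) * σ
      + a ^ 2 * (y - (1 - r) * m) + (b ^ 2 - a ^ 2 * r + (b - a) ^ 2 * q₁) * m - R =
      ((1 - b) ^ 2 * q + 1 - b ^ 2 - (a - b) ^ 2 * q₁ + (b - a) * (2 - a - b) * q₁) * (σ - 1)
      + (b ^ 2 + (b - a) ^ 2 * q₁ - a ^ 2) * (m - (1 + T)) + a ^ 2 * (y - (1 + T + S)) := by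
    rw [hR, refRisk]; ring
  rw [key]
  rw [abs_le] at B1 B2 B3 ⊢
  constructor <;> linarith

/-- As 46/119 < 0.4, ρ ≥ 0.6 R. The distance of ρ' from ρ is at most 54.2 κ L R, and 54.2/119 < 0.6.
-/
lemma abs_sub_lt_mul_of_close {ρ ρ' R δ : ℝ} (hR : 1 ≤ R) (hδ : 0 < δ) (hδ1 : δ ≤ 1)
    (hκL : 119 * (κ * L) ≤ δ) (h₁ : |ρ - R| ≤ 46 * κ * L * R)
    (h₂ : |ρ' - R| ≤ 8.2 * κ * L * R) : |ρ' - ρ| < δ * ρ := by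
  have h3 : 119 * (κ * L * R) ≤ δ * R := by nlinarith
  have h4 : δ * R ≤ R := by nlinarith
  rw [abs_le] at h₁ h₂
  have h5 : 0.6 * R ≤ ρ := by nlinarith
  have h6 : δ * (0.6 * R) ≤ δ * ρ := by gcongr
  have h7 : 0 < δ * R := by positivity
  rw [abs_lt]
  constructor <;> nlinarith

end Deterministic

/-! ### The canonical risk and its estimate on the typical event -/

section Typical

variable {E : Type*} [NormedAddCommGroup E] [InnerProductSpace ℝ E]
variable {ι κ : Type*} [Fintype ι] [DecidableEq ι] [Fintype κ] [DecidableEq κ]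

/-- The prediction error in the canonical model, as a function of the shrinkage factors. -/
def canonRisk (a b : ℝ) (s : EuclideanSpace ℝ ι) (t : EuclideanSpace ℝ κ) (z : ι → E)
    (G : Option κ → E) : ℝ :=
  1 + ‖(1 - b) • coef z (∑ k, dir (-blockErr z G) k • G k) + (b - a) • coef z (∑ k, dir t k • G k)
      - a • s‖ ^ 2 + ‖(1 - b) • blockErr z G - b • t‖ ^ 2

/-- The estimated prediction error in the canonical model. -/
def canonEstimate (a b : ℝ) (s : EuclideanSpace ℝ ι) (t : EuclideanSpace ℝ κ) (z : ι → E)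
    (G : Option κ → E) : ℝ :=
  w₁ a b (finrank ℝ E) (Fintype.card ι) (Fintype.card ι + Fintype.card κ) *
      (‖resid (Sum.elim z fun k => G (some k)) (G none)‖ ^ 2 /
        (finrank ℝ E - (Fintype.card ι + Fintype.card κ)))
    + w₂ a * ((‖∑ i, s i • z i + ∑ k, dir t k • G k‖ ^ 2 -
        ‖resid z (∑ k, dir t k • G k)‖ ^ 2) / finrank ℝ E)
    + w₃ a b (finrank ℝ E) (Fintype.card ι) *
      (‖resid z (∑ k, dir t k • G k)‖ ^ 2 / (finrank ℝ E - Fintype.card ι))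

lemma canonRisk_pos (a b : ℝ) (s : EuclideanSpace ℝ ι) (t : EuclideanSpace ℝ κ) (z : ι → E)
    (G : Option κ → E) : 0 < canonRisk a b s t z G := by
  unfold canonRisk; positivity

lemma norm_sq_comb {V : Type*} [NormedAddCommGroup V] [InnerProductSpace ℝ V] (a b : ℝ)
    (c d s : V) : ‖(1 - b) • c + (b - a) • d - a • s‖ ^ 2 =
      (1 - b) ^ 2 * ‖c‖ ^ 2 + (b - a) ^ 2 * ‖d‖ ^ 2 + a ^ 2 * ‖s‖ ^ 2
        + 2 * (1 - b) * (b - a) * ⟪c, d⟫ - 2 * a * (1 - b) * ⟪s, c⟫ - 2 * a * (b - a) * ⟪s, d⟫ := by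
  rw [norm_sub_sq_real, norm_add_sq_real, inner_add_left]
  simp only [norm_smul, mul_pow, Real.norm_eq_abs, sq_abs, real_inner_smul_left,
    real_inner_smul_right, real_inner_comm s]
  ring

lemma abs_div_sub_le_of_dev {A c : ℝ} {k : ℕ} {d e : ℝ} (hk : (0 : ℝ) < k) (hc : 0 ≤ c)
    (h : |A - c * k| ≤ c * d) (hd : d ≤ e * k) : |A / k - c| ≤ e * c := by
  have : A / k - c = (A - c * k) / k := by field_simp
  rw [this, abs_div, abs_of_pos hk, div_le_iff₀ hk]
  calc _ ≤ c * d := h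
    _ ≤ c * (e * k) := by gcongr
    _ = _ := by ring

/-- The accuracy of the estimate on the typical event. The factor `L` compares the total signal
with the reference risk. -/
theorem IsTypical.abs_canonEstimate_sub_lt {η x L δ a b : ℝ} {s : EuclideanSpace ℝ ι}
    {t : EuclideanSpace ℝ κ} {z : ι → E} {G : Option κ → E}
    (hη : 0 < η) (hη1 : 119 * η ≤ 1)
    (hlt : Fintype.card ι + Fintype.card κ < finrank ℝ E)
    (hx : x = 1 - (Fintype.card ι + Fintype.card κ : ℝ) / finrank ℝ E)
    (h : IsTypical (finrank ℝ E * η ^ 2 * x ^ 3) s t z G)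
    (ha : 0 ≤ a) (ha1 : a ≤ 1) (hb : 0 ≤ b) (hb1 : b ≤ 1) (hL : 1 ≤ L) (hδ : 0 < δ) (hδ1 : δ ≤ 1)
    (hηL : 119 * (η * L) ≤ δ)
    (haL : a ^ 2 * (1 + ‖t‖ ^ 2) ≤ L * refRisk a b (‖s‖ ^ 2) (‖t‖ ^ 2)
      (Fintype.card ι / (finrank ℝ E - Fintype.card ι + 1))
      ((Fintype.card ι + Fintype.card κ) /
        (finrank ℝ E - (Fintype.card ι + Fintype.card κ) + 1))) :
    |canonEstimate a b s t z G - canonRisk a b s t z G| < δ * canonRisk a b s t z G := by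
  obtain ⟨n, hn⟩ : ∃ n, n = finrank ℝ E := ⟨_, rfl⟩
  obtain ⟨p, hp⟩ : ∃ p, p = Fintype.card ι := ⟨_, rfl⟩
  obtain ⟨p', hp'⟩ : ∃ p, p = Fintype.card κ := ⟨_, rfl⟩
  obtain ⟨-, -, h_rss, h_rss₁, h_total, h_e, h_te, h_c, h_d, h_cd, h_sc, h_sd⟩ := h
  unfold canonEstimate canonRisk
  rw [norm_sq_comb]
  simp only [← hn, ← hp, ← hp'] at *
  have hn0 : (0 : ℝ) < n := by have : 0 < n := by omega
                               exact_mod_cast this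
  have hk : ((n - (p + p') : ℕ) : ℝ) = n - (p + p') := by
    rw [Nat.cast_sub hlt.le]; push_cast; ring
  have hk₁ : ((n - p : ℕ) : ℝ) = n - p := Nat.cast_sub (by omega)
  have hK : ((n - (p + p') + 1 : ℕ) : ℝ) = n - (p + p') + 1 := by push_cast [hk]; ring
  have hK₁ : ((n - p + 1 : ℕ) : ℝ) = n - p + 1 := by push_cast [hk₁]; ring
  have hlt' : (p : ℝ) + p' < n := by exact_mod_cast hlt
  have hp0 : (0 : ℝ) ≤ p := p.cast_nonneg
  have hp0' : (0 : ℝ) ≤ p' := p'.cast_nonneg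
  obtain ⟨x₁, hx₁⟩ : ∃ x₁, x₁ = 1 - (p : ℝ) / n := ⟨_, rfl⟩
  have hnx : n * x = n - (p + p') := by rw [hx]; field_simp
  have hnx₁ : n * x₁ = n - p := by rw [hx₁]; field_simp
  have hx0 : 0 < x := by
    have : 0 < n * x := by rw [hnx]; linarith
    exact pos_of_mul_pos_right this hn0.le
  have hxx : x ≤ x₁ := le_of_mul_le_mul_left (by rw [hnx, hnx₁]; linarith) hn0
  have hx₁1 : x₁ ≤ 1 := le_of_mul_le_mul_left (by rw [hnx₁]; linarith) hn0
  have hx1 : x ≤ 1 := hxx.trans hx₁1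
  have hx₁0 : 0 < x₁ := hx0.trans_le hxx
  have hD : (0 : ℝ) < n - (p + p') + 1 := by linarith
  have hD₁ : (0 : ℝ) < n - p + 1 := by linarith
  have hq₁x : (p : ℝ) / (n - p + 1) * x₁ ≤ 1 := by
    rw [div_mul_eq_mul_div, div_le_one hD₁, ← mul_le_mul_iff_right₀ hn0]
    calc (n : ℝ) * (p * x₁) = p * (n * x₁) := by ring
      _ ≤ n * (n - p + 1) := by rw [hnx₁]; gcongr <;> linarith
  have hq₂x : (1 + (p' : ℝ) / (n - (p + p') + 1)) * x ≤ x₁ := by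
    rw [← mul_le_mul_iff_right₀ hn0, hnx₁]
    have : (n : ℝ) * ((1 + (p' : ℝ) / (n - (p + p') + 1)) * x) =
      (n - p + 1) * (n * x) / (n - (p + p') + 1) := by field_simp; ring
    rw [this, hnx, div_le_iff₀ hD]
    linarith
  have hqx : (1 + ((p : ℝ) + p') / (n - (p + p') + 1)) * x ≤ 1 := by
    rw [← mul_le_mul_iff_right₀ hn0]
    have : (n : ℝ) * ((1 + ((p : ℝ) + p') / (n - (p + p') + 1)) * x) =
      (n + 1) * (n * x) / (n - (p + p') + 1) := by field_simp; ring
    rw [this, hnx, div_le_iff₀ hD]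
    linarith
  -- Equivalently 1 + q = (1 + q₁)(1 + q₂), since 1 + k/(N - k + 1) = (N + 1)/(N - k + 1), for N = n
  -- and for N = n - p. Thus the estimation errors of the two blocks compound to that of the whole
  -- model.
  have hq : ((p : ℝ) + p') / (n - (p + p') + 1) = p / (n - p + 1) *
      (1 + p' / (n - (p + p') + 1)) + p' / (n - (p + p') + 1) := by
    field_simp; ring
  rw [hK] at h_e
  rw [hK₁] at h_c h_d h_cd
  have hq₁0 : 0 ≤ (p : ℝ) / (n - p + 1) := by positivity
  have hq₂0 : 0 ≤ (p' : ℝ) / (n - (p + p') + 1) := by positivity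
  have hqq : (p : ℝ) / (n - p + 1) ≤ ((p : ℝ) + p') / (n - (p + p') + 1) := by
    rw [hq]; linarith [mul_nonneg hq₁0 hq₂0]
  obtain ⟨u, hu⟩ : ∃ u, u = n * η ^ 2 * x ^ 3 := ⟨_, rfl⟩
  have hu0 : 0 < u := by rw [hu]; positivity
  have hdev : ∀ k : ℕ, n * x ≤ k → dev u k ≤ 2.05 * η * x * k := fun k hk => by
    rw [hu]
    refine (dev_le_mul hn0 hx0 hx1 hη hη1 hk).trans ?_
    have : 0 ≤ η * x * k := by positivity
    linarith
  have hscore : ∀ k : ℕ, n * x ≤ k → scoreDev u k ≤ 1.45 * η * x := fun k hk => by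
    rw [hu]; exact scoreDev_le hn0 hx0 hx1 hη hη1 hk
  have hnx₁' : n * x ≤ n * x₁ := by gcongr
  have hKx : n * x ≤ ((n - (p + p') + 1 : ℕ) : ℝ) := by rw [hK]; linarith
  have hKx₁ : n * x₁ ≤ ((n - p + 1 : ℕ) : ℝ) := by rw [hK₁]; linarith
  have hr₁ : ratioDev u p (n - p + 1) ≤ 4.2 * η * x * 1 / x₁ := by
    rw [hu]; exact ratioDev_le hn0 hx0 hx1 hη hη1 hx1 (by linarith) hxx hKx₁
  have hr₂ : ratioDev u p' (n - (p + p') + 1) ≤ 4.2 * η * x * x₁ / x := by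
    rw [hu]; exact ratioDev_le hn0 hx0 hx1 hη hη1 hxx (by linarith) le_rfl hKx
  rw [← hu] at h_rss h_rss₁ h_total h_e h_te h_c h_d h_cd h_sc h_sd
  have hr₁0 : 0 ≤ ratioDev u p (n - p + 1) := by
    have h1 : 0 ≤ ratioDev u p (n - p + 1) * (1 + ‖t‖ ^ 2) := (abs_nonneg _).trans h_d
    exact nonneg_of_mul_nonneg_left h1 (by positivity)
  have h₁ := abs_risk_sub_refRisk_le (S := ‖s‖ ^ 2) (T := ‖t‖ ^ 2) (ℓ := 1.45 * η * x)
    ha hb hb1 (by positivity) (by positivity)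
    hx0 hxx hx₁1 hη hη1 hq₁0 hq₁x hq₂0 hq₂x hq hL haL (sq_nonneg ‖blockErr z G‖) le_rfl
    (by rw [mul_one, le_div_iff₀ hx₁0] at hr₁; exact hr₁) hr₁0
    (h_e.trans (hr₂.trans (by rw [div_le_iff₀ hx0]; exact le_of_eq (by ring)))) h_c h_d h_cd
    (by rw [Real.sqrt_sq (norm_nonneg _)]; exact h_te.trans (by gcongr; exact hscore _ hKx))
    (by rw [Real.sqrt_sq (norm_nonneg _)]
        exact h_sc.trans (by gcongr; exact hscore _ (hnx₁'.trans hKx₁)))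
    (by rw [Real.sqrt_sq (norm_nonneg _)]
        exact h_sd.trans (by gcongr; exact hscore _ (hnx₁'.trans hKx₁)))
    (by positivity)
  have hσ : |‖resid (Sum.elim z fun k => G (some k)) (G none)‖ ^ 2 / (n - (p + p') : ℕ) - 1| ≤
      2.05 * η * x * 1 :=
    abs_div_sub_le_of_dev (by rw [hk]; linarith) zero_le_one
      (by simpa using h_rss) (hdev _ (by rw [hk, hnx]))
  rw [mul_one] at hσ
  have h₂ := abs_estimate_sub_refRisk_le (S := ‖s‖ ^ 2) (T := ‖t‖ ^ 2) (κ := η) (x := x)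
    (r := (p : ℝ) / n) ha ha1 hb hb1 (by positivity) (by positivity) hx0 hx1 hη hq₁0 hqq hqx hL haL
    hσ
    (abs_div_sub_le_of_dev (k := n - p) (by rw [hk₁]; linarith) (by positivity)
      h_rss₁ (hdev _ (by rw [hk₁]; linarith)))
    (abs_div_sub_le_of_dev (k := n) hn0 (by positivity) h_total (hdev _ (by linarith)))
  have hR1 : 1 ≤ refRisk a b (‖s‖ ^ 2) (‖t‖ ^ 2) ((p : ℝ) / (n - p + 1))
      ((p + p') / (n - (p + p') + 1)) := by
    have h0 := refRisk_ge (a := a) (b := b) (S := ‖s‖ ^ 2) (T := ‖t‖ ^ 2) hq₁0 hqq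
    have h3 : 0 ≤ a ^ 2 * ‖s‖ ^ 2 + b ^ 2 * ‖t‖ ^ 2 + (b - a) ^ 2 * ((p : ℝ) / (n - p + 1)) *
      ‖t‖ ^ 2 := by positivity
    linarith
  have hfin := abs_sub_lt_mul_of_close hR1 hδ hδ1 hηL h₁ h₂
  have e₁ : ‖(1 - b) • blockErr z G - b • t‖ ^ 2 =
      (1 - b) ^ 2 * ‖blockErr z G‖ ^ 2 + b ^ 2 * ‖t‖ ^ 2 - 2 * b * (1 - b) * ⟪t, blockErr z G⟫ := by
    rw [norm_sub_sq_real]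
    simp only [norm_smul, mul_pow, Real.norm_eq_abs, sq_abs,
      real_inner_smul_right, real_inner_comm t]
    ring
  rw [e₁]
  convert hfin using 3
  rw [w₁, w₂, w₃, hk, hk₁]
  have hpn : (n : ℝ) - p ≠ 0 := by linarith
  field_simp

end Typical

/-! ### Comparison of the total signal with the reference risk -/

lemma sq_mul_le_mul_refRisk_of_signal {a b S T q₁ q : ℝ} (ha : 0 ≤ a) (ha1 : a ≤ 1) (hS : 0 ≤ S)
    (hT : 0 ≤ T) (hq₁ : 0 ≤ q₁) (hqq : q₁ ≤ q) :
    a ^ 2 * (1 + T) ≤ (1 + (S + T)) * refRisk a b S T q₁ q := by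
  have h := refRisk_ge (a := a) (b := b) (S := S) (T := T) hq₁ hqq
  have h1 : 0 ≤ a ^ 2 * S + b ^ 2 * T + (b - a) ^ 2 * q₁ * T := by positivity
  have ha2 : a ^ 2 ≤ 1 := pow_le_one₀ ha ha1
  calc a ^ 2 * (1 + T) ≤ 1 * (1 + T) := by gcongr
    _ ≤ (1 + (S + T)) * 1 := by linarith
    _ ≤ _ := by gcongr; linarith

lemma sq_mul_le_mul_refRisk_of_ratio {a b S T q₁ q r : ℝ} (ha : 0 ≤ a) (ha1 : a ≤ 1) (hS : 0 ≤ S)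
    (hT : 0 ≤ T) (hr : 0 < r) (hrq : r ≤ q₁) (hqq : q₁ ≤ q) :
    a ^ 2 * (1 + T) ≤ (1 + 1 / r) * refRisk a b S T q₁ q := by
  have hq₁ : 0 < q₁ := hr.trans_le hrq
  have h := refRisk_ge (a := a) (b := b) (S := S) (T := T) hq₁.le hqq
  have haS : 0 ≤ a ^ 2 * S := by positivity
  have ha2 : a ^ 2 ≤ 1 := pow_le_one₀ ha ha1
  have hc : a ^ 2 ≤ (1 + 1 / r) * (b ^ 2 + (b - a) ^ 2 * q₁) := by
    -- The minimum over b of b² + (b - a)² r is a² r/(1 + r), attained at b = a r/(1 + r); the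
    -- difference is a perfect square divided by r.
    have h1 : (1 + 1 / r) * (b ^ 2 + (b - a) ^ 2 * r) - a ^ 2 = (b + (b - a) * r) ^ 2 / r := by
      field_simp; ring
    have h2 : 0 ≤ (b + (b - a) * r) ^ 2 / r := by positivity
    have h3 : (1 + 1 / r) * (b ^ 2 + (b - a) ^ 2 * r) ≤
        (1 + 1 / r) * (b ^ 2 + (b - a) ^ 2 * q₁) := by gcongr
    linarith
  have hL : 1 ≤ 1 + 1 / r := by have : 0 < 1 / r := by positivity
                                linarith
  calc a ^ 2 * (1 + T) = a ^ 2 + a ^ 2 * T := by ring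
    _ ≤ (1 + 1 / r) + (1 + 1 / r) * (b ^ 2 + (b - a) ^ 2 * q₁) * T := by
        gcongr; linarith
    _ = (1 + 1 / r) * (1 + b ^ 2 * T + (b - a) ^ 2 * q₁ * T) := by ring
    _ ≤ _ := by gcongr; linarith

/-! ### Least squares in terms of coefficients and residuals -/

section Change

variable {E : Type*} [NormedAddCommGroup E] [InnerProductSpace ℝ E] [FiniteDimensional ℝ E]
variable {ι κ : Type*} [Fintype ι] [DecidableEq ι] [Fintype κ] [DecidableEq κ]

lemma sum_coef_smul {z : ι → E} (hz : LinearIndependent ℝ z) (w : E) :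
    ∑ j, coef z w j • z j = (Submodule.span ℝ (Set.range z)).starProjection w := by
  have h := resid_eq_starProjection hz w
  rw [Submodule.starProjection_orthogonal_val, resid] at h
  exact sub_right_injective h

omit [FiniteDimensional ℝ E] [DecidableEq ι] in
lemma linearIndependent_of_span_eq {κ' : Type*} [Fintype κ'] {z : ι → E} {x : κ' → E}
    (hz : LinearIndependent ℝ z)
    (h : Submodule.span ℝ (Set.range x) = Submodule.span ℝ (Set.range z))
    (hcard : Fintype.card κ' = Fintype.card ι) : LinearIndependent ℝ x := by
  rw [linearIndependent_iff_card_eq_finrank_span, Set.finrank, h, hcard, finrank_span_eq_card hz]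

lemma resid_eq_of_span_eq {z : ι → E} {x : κ → E} (hz : LinearIndependent ℝ z)
    (hx : LinearIndependent ℝ x)
    (h : Submodule.span ℝ (Set.range x) = Submodule.span ℝ (Set.range z)) (w : E) :
    resid x w = resid z w := by
  rw [resid_eq_starProjection hz, resid_eq_starProjection hx, h]

omit [FiniteDimensional ℝ E] in
lemma span_range_sum_smul (z : ι → E) {A : Matrix ι ι ℝ} (hA : IsUnit A.det) :
    Submodule.span ℝ (Set.range fun i => ∑ j, A i j • z j) = Submodule.span ℝ (Set.range z) := by
  refine le_antisymm (Submodule.span_le.2 ?_) (Submodule.span_le.2 ?_)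
  · rintro _ ⟨i, rfl⟩
    exact Submodule.sum_mem _ fun j _ => Submodule.smul_mem _ _ (Submodule.subset_span ⟨j, rfl⟩)
  · rintro _ ⟨i, rfl⟩
    have h : z i = ∑ k, A⁻¹ i k • ∑ j, A k j • z j := by
      simp only [Finset.smul_sum, smul_smul]
      rw [Finset.sum_comm]
      simp only [← Finset.sum_smul]
      have : ∀ j, ∑ k, A⁻¹ i k * A k j = (1 : Matrix ι ι ℝ) i j := fun j => by
        rw [← nonsing_inv_mul A hA, mul_apply]
      simp [this, Matrix.one_apply]
    rw [h]
    exact Submodule.sum_mem _ fun j _ => Submodule.smul_mem _ _ (Submodule.subset_span ⟨j, rfl⟩)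

omit [FiniteDimensional ℝ E] in
lemma linearIndependent_sum_smul {z : ι → E} (hz : LinearIndependent ℝ z) {A : Matrix ι ι ℝ}
    (hA : IsUnit A.det) : LinearIndependent ℝ fun i => ∑ j, A i j • z j :=
  linearIndependent_of_span_eq hz (span_range_sum_smul z hA) rfl

lemma resid_sum_smul {z : ι → E} (hz : LinearIndependent ℝ z) {A : Matrix ι ι ℝ}
    (hA : IsUnit A.det) (w : E) : resid (fun i => ∑ j, A i j • z j) w = resid z w :=
  resid_eq_of_span_eq hz (linearIndependent_sum_smul hz hA) (span_range_sum_smul z hA) w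

/-- Both families span the same space and so give the same fitted vector. Expanding it in the basis
z shows that coefficients transform by Aᵀ. -/
lemma transpose_mulVec_coef {z : ι → E} (hz : LinearIndependent ℝ z) {A : Matrix ι ι ℝ}
    (hA : IsUnit A.det) (w : E) :
    Aᵀ *ᵥ (coef (fun i => ∑ j, A i j • z j) w).ofLp = (coef z w).ofLp := by
  have h : ∑ i, coef (fun i => ∑ j, A i j • z j) w i • ∑ j, A i j • z j =
      ∑ j, (Aᵀ *ᵥ (coef (fun i => ∑ j, A i j • z j) w).ofLp) j • z j := by
    simp only [Finset.smul_sum, smul_smul]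
    rw [Finset.sum_comm]
    simp only [← Finset.sum_smul, mulVec, dotProduct, transpose_apply, mul_comm]
  have h2 := sum_coef_smul (linearIndependent_sum_smul hz hA) w
  rw [span_range_sum_smul z hA, ← sum_coef_smul hz w, h] at h2
  have h3 := congrArg (coef z) h2
  rw [coef_sum_smul hz, coef_sum_smul hz (fun j => coef z w j)] at h3
  exact congrArg WithLp.ofLp h3

omit [FiniteDimensional ℝ E] in
lemma resid_add {z : ι → E} (v w : E) : resid z (v + w) = resid z v + resid z w := by
  simp only [resid, coef_add, PiLp.add_apply, add_smul, Finset.sum_add_distrib]; abel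

omit [FiniteDimensional ℝ E] in
lemma resid_smul {z : ι → E} (c : ℝ) (w : E) : resid z (c • w) = c • resid z w := by
  simp only [resid, coef_smul, PiLp.smul_apply, smul_sub, Finset.smul_sum, smul_smul, smul_eq_mul]

omit [FiniteDimensional ℝ E] in
lemma resid_sum {κ' : Type*} (s : Finset κ') {z : ι → E} (f : κ' → E) :
    resid z (∑ k ∈ s, f k) = ∑ k ∈ s, resid z (f k) := by
  classical
  induction s using Finset.induction_on with
  | empty => simpa using resid_smul (z := z) 0 0
  | insert a s ha ih => rw [Finset.sum_insert ha, Finset.sum_insert ha, resid_add, ih]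

omit [FiniteDimensional ℝ E] in
lemma resid_sum_smul_self {z : ι → E} (hz : LinearIndependent ℝ z) (c : ι → ℝ) :
    resid z (∑ j, c j • z j) = 0 := by
  rw [resid, coef_sum_smul hz]; simp

lemma inner_resid {z : ι → E} (hz : LinearIndependent ℝ z) (v w : E) :
    ⟪resid z v, resid z w⟫ = ⟪v, resid z w⟫ := by
  simp only [resid_eq_starProjection hz]
  rw [Submodule.inner_starProjection_left_eq_right]
  congr 1
  exact Submodule.starProjection_eq_self_iff.2 (Submodule.starProjection_apply_mem _ _)

lemma inner_resid_comm {z : ι → E} (hz : LinearIndependent ℝ z) (v w : E) :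
    ⟪resid z v, w⟫ = ⟪v, resid z w⟫ := by
  simp only [resid_eq_starProjection hz]
  rw [Submodule.inner_starProjection_left_eq_right]

lemma coef_resid_resid {z : ι → E} (hz : LinearIndependent ℝ z) (y : κ → E) (w : E) :
    coef (fun k => resid z (y k)) (resid z w) = coef (fun k => resid z (y k)) w :=
  coef_eq_of_inner_eq fun k => by rw [inner_resid hz, inner_resid_comm hz]

end Change

/-! ### The statistics of the sample -/

section Sample

variable {n : ℕ}

/-- The columns of the design matrix. -/
def colVec (X : Fin n → ℕ → ℝ) (s : Finset ℕ) (i : s) : EuclideanSpace ℝ (Fin n) :=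
  WithLp.toLp 2 fun j => X j i

/-- For an invertible matrix the first Penrose equation alone determines the inverse. -/
lemma pinv_eq_inv {ι : Type*} [Fintype ι] [DecidableEq ι] {A : Matrix ι ι ℝ} (hA : IsUnit A.det) :
    pinv A = A⁻¹ := by
  have h : ∃ B, IsMoorePenrose A B := by
    refine ⟨A⁻¹, ?_, ?_, ?_, ?_⟩ <;> simp [mul_nonsing_inv A hA, nonsing_inv_mul A hA]
  rw [pinv, dif_pos h]
  have h1 := h.choose_spec.mul_mul_left
  generalize h.choose = B at h1
  calc B = A⁻¹ * (A * B * A) * A⁻¹ := by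
        rw [Matrix.mul_assoc A B A, ← Matrix.mul_assoc A⁻¹, nonsing_inv_mul A hA, Matrix.one_mul,
          Matrix.mul_assoc, mul_nonsing_inv A hA, Matrix.mul_one]
    _ = A⁻¹ := by rw [h1, nonsing_inv_mul A hA, Matrix.one_mul]

lemma transpose_design_mul_design (X : Fin n → ℕ → ℝ) (s : Finset ℕ) :
    (design X s)ᵀ * design X s = gram ℝ (colVec X s) := by
  ext i j
  simp [mul_apply, design, gram_apply, colVec, PiLp.inner_apply, mul_comm]

lemma design_mulVec (X : Fin n → ℕ → ℝ) (s : Finset ℕ) (v : s → ℝ) :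
    design X s *ᵥ v = (∑ i, v i • colVec X s i).ofLp := by
  ext j
  simp [mulVec, dotProduct, design, colVec, mul_comm]

lemma transpose_design_mulVec (X : Fin n → ℕ → ℝ) (s : Finset ℕ) (w : EuclideanSpace ℝ (Fin n)) :
    (design X s)ᵀ *ᵥ w.ofLp = fun i => ⟪colVec X s i, w⟫ := by
  ext i
  simp [mulVec, dotProduct, design, colVec, PiLp.inner_apply, mul_comm]

variable {X : Fin n → ℕ → ℝ} {s : Finset ℕ} (hs : LinearIndependent ℝ (colVec X s))

include hs

lemma pinv_mulVec_transpose_design (w : EuclideanSpace ℝ (Fin n)) :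
    pinv ((design X s)ᵀ * design X s) *ᵥ ((design X s)ᵀ *ᵥ w.ofLp) =
      (coef (colVec X s) w).ofLp := by
  rw [transpose_design_mul_design, pinv_eq_inv (isUnit_det_gram hs), transpose_design_mulVec]
  rfl

lemma lsEst_eq_coef (Y : Fin n → ℝ) : lsEst Y X s = (coef (colVec X s) (WithLp.toLp 2 Y)).ofLp :=
  pinv_mulVec_transpose_design hs (WithLp.toLp 2 Y)

lemma residProj_mulVec (w : EuclideanSpace ℝ (Fin n)) :
    residProj X s *ᵥ w.ofLp = (resid (colVec X s) w).ofLp := by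
  rw [residProj, sub_mulVec, one_mulVec, ← mulVec_mulVec, ← mulVec_mulVec,
    pinv_mulVec_transpose_design hs, design_mulVec]
  rfl

lemma sigmaHatSq_eq (Y : Fin n → ℝ) :
    sigmaHatSq Y X s = ‖resid (colVec X s) (WithLp.toLp 2 Y)‖ ^ 2 / (n - s.card) := by
  rw [sigmaHatSq, lsEst_eq_coef hs, design_mulVec, EuclideanSpace.real_norm_sq_eq]
  rfl

lemma dotProduct_residProj_mulVec (Y : Fin n → ℝ) :
    Y ⬝ᵥ (residProj X s *ᵥ Y) = ‖resid (colVec X s) (WithLp.toLp 2 Y)‖ ^ 2 := by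
  rw [← real_inner_self_eq_norm_sq, inner_resid hs,
    show residProj X s *ᵥ Y = residProj X s *ᵥ (WithLp.toLp 2 Y : EuclideanSpace ℝ (Fin n)).ofLp
      from rfl, residProj_mulVec hs]
  simp [PiLp.inner_apply, dotProduct, mul_comm]

lemma dotProduct_one_sub_residProj_mulVec (Y : Fin n → ℝ) :
    Y ⬝ᵥ ((1 - residProj X s) *ᵥ Y) = ‖(WithLp.toLp 2 Y : EuclideanSpace ℝ (Fin n))‖ ^ 2 -
      ‖resid (colVec X s) (WithLp.toLp 2 Y)‖ ^ 2 := by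
  rw [sub_mulVec, one_mulVec, dotProduct_sub, dotProduct_residProj_mulVec hs,
    EuclideanSpace.real_norm_sq_eq (WithLp.toLp 2 Y)]
  simp [dotProduct, pow_two]

/-- The residual maker is symmetric and idempotent, so X₂'M₁X₂ is the Gram matrix of the
residualized columns and X₂'M₁Y collects their inner products with Y. -/
lemma thetaHat₂_eq_coef (Y : Fin n → ℝ) {s' : Finset ℕ}
    (hs' : LinearIndependent ℝ fun k => resid (colVec X s) (colVec X s' k)) :
    thetaHat₂ Y X s s' =
      (coef (fun k => resid (colVec X s) (colVec X s' k)) (WithLp.toLp 2 Y)).ofLp := by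
  have h1 : (design X s')ᵀ * residProj X s * design X s' =
      gram ℝ fun k => resid (colVec X s) (colVec X s' k) := by
    ext i j
    rw [gram_apply, inner_resid hs, Matrix.mul_assoc]
    have h2 : ((design X s')ᵀ * (residProj X s * design X s')) i j =
        ((design X s')ᵀ *ᵥ (residProj X s *ᵥ (colVec X s' j).ofLp)) i := by
      simp only [mul_apply, mulVec, dotProduct, transpose_apply]
      rfl
    rw [h2, residProj_mulVec hs, transpose_design_mulVec]
  rw [thetaHat₂, h1, pinv_eq_inv (isUnit_det_gram hs'),
    show residProj X s *ᵥ Y = residProj X s *ᵥ (WithLp.toLp 2 Y : EuclideanSpace ℝ (Fin n)).ofLp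
      from rfl, residProj_mulVec hs, transpose_design_mulVec]
  simp only [← inner_resid_comm hs]
  rfl

end Sample

/-! ### Shrinkage factors -/

section Factors

variable {n : ℕ} {Y : Fin n → ℝ} {X : Fin n → ℕ → ℝ} {m₁ m₂ : Finset ℕ} {c₁ c₂ : ℝ}

lemma sigmaHatSq_nonneg {m : Finset ℕ} (h : m.card < n) : 0 ≤ sigmaHatSq Y X m := by
  have : (m.card : ℝ) < n := by exact_mod_cast h
  unfold sigmaHatSq
  exact div_nonneg (Finset.sum_nonneg fun _ _ => sq_nonneg _) (by linarith)

lemma dotProduct_transpose_mul_mulVec_nonneg {ι κ : Type*} [Fintype ι] [Fintype κ]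
    (M : Matrix ι κ ℝ) (v : κ → ℝ) : 0 ≤ v ⬝ᵥ ((Mᵀ * M) *ᵥ v) := by
  rw [← mulVec_mulVec, dotProduct_mulVec, vecMul_transpose]
  exact Finset.sum_nonneg fun _ _ => mul_self_nonneg _

lemma shrink₁_nonneg (hc : 0 ≤ c₁) (h : (m₁ ∪ m₂).card < n) : 0 ≤ shrink₁ c₁ Y X m₁ m₂ :=
  mul_nonneg (mul_nonneg hc (sigmaHatSq_nonneg h))
    (div_nonneg (Nat.cast_nonneg _) (dotProduct_transpose_mul_mulVec_nonneg _ _))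

lemma shrink₂_nonneg (hc : 0 ≤ c₂) (h : (m₁ ∪ m₂).card < n) : 0 ≤ shrink₂ c₂ Y X m₁ m₂ :=
  mul_nonneg (mul_nonneg hc (sigmaHatSq_nonneg h))
    (div_nonneg (Nat.cast_nonneg _) (dotProduct_transpose_mul_mulVec_nonneg _ _))

lemma max_one_sub_eq (x : ℝ) : max (1 - x) 0 = 1 - min 1 x := by
  rcases le_total x 1 with h | h
  · rw [max_eq_left (by linarith), min_eq_right h]
  · rw [max_eq_right (by linarith), min_eq_left h, sub_self]

end Factors

/-! ### A sample in canonical coordinates -/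

section Whitened

variable {n : ℕ}

/-- The sample `(Y, X)` is expressed by the vectors `z`, `G` through a block triangular
transformation of the regressors. -/
structure IsWhitened (Y : Fin n → ℝ) (X : Fin n → ℕ → ℝ) (m₁ m₂ : Finset ℕ)
    (A : Matrix m₁ m₁ ℝ) (C : Matrix m₂ m₁ ℝ) (B : Matrix m₂ m₂ ℝ) (σ : ℝ)
    (s : EuclideanSpace ℝ m₁) (t : EuclideanSpace ℝ m₂) (z : m₁ → EuclideanSpace ℝ (Fin n))
    (G : Option m₂ → EuclideanSpace ℝ (Fin n)) : Prop where
  col₁ : ∀ i, colVec X m₁ i = ∑ j, A i j • z j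
  col₂ : ∀ k, colVec X m₂ k = ∑ j, C k j • z j + ∑ l, B k l • G (some l)
  response : WithLp.toLp 2 Y = σ • (∑ i, s i • z i + ∑ k, dir t k • G k)

namespace IsWhitened

variable {Y : Fin n → ℝ} {X : Fin n → ℕ → ℝ} {m₁ m₂ : Finset ℕ}
  {A : Matrix m₁ m₁ ℝ} {C : Matrix m₂ m₁ ℝ} {B : Matrix m₂ m₂ ℝ} {σ : ℝ}
  {s : EuclideanSpace ℝ m₁} {t : EuclideanSpace ℝ m₂} {z : m₁ → EuclideanSpace ℝ (Fin n)}
  {G : Option m₂ → EuclideanSpace ℝ (Fin n)}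
  (h : IsWhitened Y X m₁ m₂ A C B σ s t z G) (hA : IsUnit A.det) (hB : IsUnit B.det)
  (hz : LinearIndependent ℝ z) (hG : LinearIndependent ℝ fun k => resid z (G (some k)))

include h hA hz

lemma linearIndependent_col₁ : LinearIndependent ℝ (colVec X m₁) := by
  rw [funext h.col₁]
  exact linearIndependent_sum_smul hz hA

lemma resid_col₁ (w : EuclideanSpace ℝ (Fin n)) : resid (colVec X m₁) w = resid z w := by
  rw [funext h.col₁]
  exact resid_sum_smul hz hA w

lemma resid_response : resid (colVec X m₁) (WithLp.toLp 2 Y) =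
    σ • resid z (∑ k, dir t k • G k) := by
  rw [h.resid_col₁ hA hz, h.response, resid_smul, resid_add, resid_sum_smul_self hz, zero_add]

omit hA in
lemma coef_response : coef z (WithLp.toLp 2 Y) = σ • (s + coef z (∑ k, dir t k • G k)) := by
  rw [h.response, coef_smul, coef_add, coef_sum_smul hz (fun i => s i)]

lemma resid_col₂ (k : m₂) : resid (colVec X m₁) (colVec X m₂ k) =
    ∑ l, B k l • resid z (G (some l)) := by
  rw [h.resid_col₁ hA hz, h.col₂, resid_add, resid_sum_smul_self hz, zero_add, resid_sum]
  simp only [resid_smul]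

include hB hG

lemma linearIndependent_col₂ :
    LinearIndependent ℝ fun k => resid (colVec X m₁) (colVec X m₂ k) := by
  rw [funext (h.resid_col₂ hA hz)]
  exact linearIndependent_sum_smul hG hB

/-- In the basis of the residuals of G, the residual of Y/σ has coefficients t plus those of the
error, and the latter are `blockErr`. -/
lemma transpose_mulVec_thetaHat₂ :
    Bᵀ *ᵥ thetaHat₂ Y X m₁ m₂ = σ • (t + blockErr z G).ofLp := by
  rw [thetaHat₂_eq_coef (h.linearIndependent_col₁ hA hz) Y (h.linearIndependent_col₂ hA hB hz hG),
    funext (h.resid_col₂ hA hz), transpose_mulVec_coef hG hB, ← coef_resid_resid hz,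
    ← h.resid_col₁ hA hz, h.resid_response hA hz, coef_smul, sum_dir_smul, resid_add, resid_sum]
  simp only [resid_smul]
  rw [coef_add, coef_sum_smul hG (fun k => t k), coef_resid_resid hz, add_comm t]
  rfl

/-- The estimate of the coefficients of the second block, in canonical coordinates. -/
lemma transpose_mulVec_thetaJS₂ (c₂ : ℝ) :
    Bᵀ *ᵥ thetaJS₂ c₂ Y X m₁ m₂ = σ • (t + ((1 - a₂ c₂ Y X m₁ m₂) • blockErr z G -
      a₂ c₂ Y X m₁ m₂ • t)).ofLp := by
  rw [thetaJS₂, max_one_sub_eq, mulVec_smul, h.transpose_mulVec_thetaHat₂ hA hB hz hG]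
  ext k
  simp only [a₂, WithLp.ofLp_add, WithLp.ofLp_sub, WithLp.ofLp_smul, Pi.smul_apply, Pi.add_apply,
    Pi.sub_apply, smul_eq_mul]
  ring

/-- The estimate of the coefficients of the first block, in canonical coordinates. -/
lemma transpose_mulVec_thetaJS₁ (c₁ c₂ : ℝ) :
    Aᵀ *ᵥ thetaJS₁ c₁ c₂ Y X m₁ m₂ + Cᵀ *ᵥ thetaJS₂ c₂ Y X m₁ m₂ =
      σ • (s + ((1 - a₂ c₂ Y X m₁ m₂) • coef z (∑ k, dir (-blockErr z G) k • G k) +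
        (a₂ c₂ Y X m₁ m₂ - a₁ c₁ Y X m₁ m₂) • coef z (∑ k, dir t k • G k) -
          a₁ c₁ Y X m₁ m₂ • s)).ofLp := by
  have hcol := h.linearIndependent_col₁ hA hz
  have h1 : Aᵀ *ᵥ thetaHat₁Star Y X m₁ = (coef z (WithLp.toLp 2 Y)).ofLp := by
    rw [thetaHat₁Star, lsEst_eq_coef hcol, funext h.col₁, transpose_mulVec_coef hz hA]
  have h2 : ∀ v : m₂ → ℝ, Aᵀ *ᵥ (pinv ((design X m₁)ᵀ * design X m₁) *ᵥ
      ((design X m₁)ᵀ *ᵥ (design X m₂ *ᵥ v))) =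
      Cᵀ *ᵥ v + (coef z (∑ l, (Bᵀ *ᵥ v) l • G (some l))).ofLp := fun v => by
    have h3 : ∑ k, v k • colVec X m₂ k =
        ∑ j, (Cᵀ *ᵥ v) j • z j + ∑ l, (Bᵀ *ᵥ v) l • G (some l) := by
      simp only [h.col₂, smul_add, Finset.smul_sum, smul_smul, Finset.sum_add_distrib]
      congr 1 <;> rw [Finset.sum_comm] <;>
        simp only [← Finset.sum_smul, mulVec, dotProduct, transpose_apply, mul_comm]
    rw [design_mulVec, pinv_mulVec_transpose_design hcol, funext h.col₁,
      transpose_mulVec_coef hz hA, h3, coef_add, coef_sum_smul hz]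
    rfl
  -- The second-block weights are (1 - a₂) σ (t + e). A combination with weights t + e is the
  -- difference of those in the directions (1, t) and (1, -e): the error vector cancels. This is how
  -- the two directions enter the risk.
  have h4 : coef z (∑ l, (Bᵀ *ᵥ thetaJS₂ c₂ Y X m₁ m₂) l • G (some l)) =
      ((1 - a₂ c₂ Y X m₁ m₂) * σ) • (coef z (∑ k, dir t k • G k) -
        coef z (∑ k, dir (-blockErr z G) k • G k)) := by
    rw [← coef_sub, ← coef_smul, sum_dir_smul, sum_dir_smul, thetaJS₂, max_one_sub_eq, mulVec_smul,
      h.transpose_mulVec_thetaHat₂ hA hB hz hG, add_sub_add_left_eq_sub, ← Finset.sum_sub_distrib,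
      Finset.smul_sum]
    congr 1
    refine Finset.sum_congr rfl fun l _ => ?_
    rw [← sub_smul, smul_smul ((1 - a₂ c₂ Y X m₁ m₂) * σ)]
    congr 1
    simp only [a₂, WithLp.ofLp_add, WithLp.ofLp_neg, Pi.smul_apply, Pi.add_apply, Pi.neg_apply,
      smul_eq_mul]
    ring
  rw [thetaJS₁, mulVec_sub, h2, h4, thetaJS₁Star, max_one_sub_eq, mulVec_smul, h1,
    h.coef_response hz]
  ext i
  simp only [a₁, WithLp.ofLp_add, WithLp.ofLp_sub, WithLp.ofLp_smul, Pi.smul_apply, Pi.add_apply,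
    Pi.sub_apply, smul_eq_mul]
  ring

omit hz hG in
lemma span_col_union : Submodule.span ℝ (Set.range (colVec X (m₁ ∪ m₂))) =
    Submodule.span ℝ (Set.range (Sum.elim z fun k => G (some k))) := by
  have hU₁ : Submodule.span ℝ (Set.range (colVec X m₁)) = Submodule.span ℝ (Set.range z) := by
    rw [funext h.col₁]; exact span_range_sum_smul z hA
  have hr : Set.range (colVec X (m₁ ∪ m₂)) =
      Set.range (colVec X m₁) ∪ Set.range (colVec X m₂) := by
    ext v
    simp only [Set.mem_range, Set.mem_union, Subtype.exists, Finset.mem_union]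
    constructor
    · rintro ⟨i, hi | hi, rfl⟩
      · exact Or.inl ⟨i, hi, rfl⟩
      · exact Or.inr ⟨i, hi, rfl⟩
    · rintro (⟨i, hi, rfl⟩ | ⟨i, hi, rfl⟩)
      · exact ⟨i, Or.inl hi, rfl⟩
      · exact ⟨i, Or.inr hi, rfl⟩
  rw [hr, Set.Sum.elim_range, Submodule.span_union, Submodule.span_union, hU₁]
  refine le_antisymm (sup_le le_sup_left (Submodule.span_le.2 ?_))
    (sup_le le_sup_left ?_)
  · rintro _ ⟨k, rfl⟩
    rw [h.col₂]
    refine Submodule.add_mem_sup ?_ ?_ <;>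
    exact Submodule.sum_mem _ fun j _ => Submodule.smul_mem _ _ (Submodule.subset_span ⟨j, rfl⟩)
  · rw [← span_range_sum_smul _ hB, Submodule.span_le]
    rintro _ ⟨k, rfl⟩
    have : ∑ l, B k l • G (some l) = -(∑ j, C k j • z j) + colVec X m₂ k := by
      rw [h.col₂]; abel
    change ∑ l, B k l • G (some l) ∈ _
    rw [this]
    refine Submodule.add_mem_sup (Submodule.neg_mem _ ?_) (Submodule.subset_span ⟨k, rfl⟩)
    exact Submodule.sum_mem _ fun j _ => Submodule.smul_mem _ _ (Submodule.subset_span ⟨j, rfl⟩)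

lemma sigmaHatSq_eq_canon (hdisj : Disjoint m₁ m₂) : sigmaHatSq Y X (m₁ ∪ m₂) =
    σ ^ 2 * (‖resid (Sum.elim z fun k => G (some k)) (G none)‖ ^ 2 /
      (n - (m₁.card + m₂.card))) := by
  have hspan := h.span_col_union hA hB
  have hli := linearIndependent_sumElim hz hG
  have hli' : LinearIndependent ℝ (colVec X (m₁ ∪ m₂)) := by
    refine linearIndependent_of_span_eq hli hspan ?_
    simp [Finset.card_union_of_disjoint hdisj]
  have hr : resid (Sum.elim z fun k => G (some k)) (∑ i, s i • z i + ∑ k, dir t k • G k) =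
      resid (Sum.elim z fun k => G (some k)) (G none) := by
    have : ∑ i, s i • z i + ∑ k, dir t k • G k =
        ∑ o, (Sum.elim (fun i => s i) fun k => t k) o • Sum.elim z (fun k => G (some k)) o +
          G none := by
      rw [sum_dir_smul, Fintype.sum_sum_type]; simp only [Sum.elim_inl, Sum.elim_inr]; abel
    rw [this, resid_add, resid_sum_smul_self hli, zero_add]
  rw [sigmaHatSq_eq hli', resid_eq_of_span_eq hli hli' hspan, h.response, resid_smul, hr,
    norm_smul, mul_pow, Real.norm_eq_abs, sq_abs, Finset.card_union_of_disjoint hdisj]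
  push_cast
  ring

/-- The estimated prediction error, in canonical coordinates. -/
lemma rhoHatSq_eq (hdisj : Disjoint m₁ m₂) (c₁ c₂ : ℝ) : rhoHatSq c₁ c₂ Y X m₁ m₂ =
    σ ^ 2 * canonEstimate (a₁ c₁ Y X m₁ m₂) (a₂ c₂ Y X m₁ m₂) s t z G := by
  have hcol := h.linearIndependent_col₁ hA hz
  rw [rhoHatSq, h.sigmaHatSq_eq_canon hA hB hz hG hdisj, dotProduct_residProj_mulVec hcol,
    dotProduct_one_sub_residProj_mulVec hcol, h.resid_response hA hz, h.response, norm_smul,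
    norm_smul, mul_pow, mul_pow, Real.norm_eq_abs, sq_abs, canonEstimate, finrank_euclideanSpace,
    Fintype.card_fin, Fintype.card_coe, Fintype.card_coe, Finset.card_union_of_disjoint hdisj]
  push_cast
  ring

end IsWhitened

end Whitened

/-! ### Block Cholesky factorization -/

section Cholesky

variable {α β : Type*} [Fintype α] [DecidableEq α] [Fintype β] [DecidableEq β]

open scoped MatrixOrder Matrix.Norms.L2Operator in
lemma exists_eq_mul_transpose {Γ : Matrix α α ℝ} (h : Γ.PosDef) :
    ∃ A : Matrix α α ℝ, IsUnit A.det ∧ Γ = A * Aᵀ := by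
  obtain ⟨B, hB⟩ := CStarAlgebra.nonneg_iff_eq_star_mul_self.1 h.posSemidef.nonneg
  have hB' : Γ = Bᵀ * Bᵀᵀ := by
    rw [hB, star_eq_conjTranspose, conjTranspose_eq_transpose_of_trivial, transpose_transpose]
  refine ⟨Bᵀ, ?_, hB'⟩
  have hdet := h.det_pos.ne'
  rw [hB', det_mul] at hdet
  exact isUnit_iff_ne_zero.2 (left_ne_zero_of_mul hdet)

/-- Block elimination: S is the Schur complement of the first block. It is left unfactored so that a
factor of any desired shape can be inserted. -/
lemma exists_block_factor {Γ : Matrix (α ⊕ β) (α ⊕ β) ℝ} (h : Γ.PosDef) :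
    ∃ (A : Matrix α α ℝ) (C : Matrix β α ℝ) (S : Matrix β β ℝ), IsUnit A.det ∧ S.PosDef ∧
      ∀ B : Matrix β β ℝ, S = B * Bᵀ → Γ = fromBlocks A 0 C B * (fromBlocks A 0 C B)ᵀ := by
  obtain ⟨A, hA, hA'⟩ := exists_eq_mul_transpose (h.submatrix (e := Sum.inl) Sum.inl_injective)
  set C : Matrix β α ℝ := Γ.toBlocks₂₁ * A⁻¹ᵀ with hC
  set S : Matrix β β ℝ := Γ.toBlocks₂₂ - C * Cᵀ with hS
  have hAt : IsUnit Aᵀ.det := by rwa [det_transpose]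
  have h11 : A * Aᵀ = Γ.toBlocks₁₁ := hA'.symm
  have h21 : C * Aᵀ = Γ.toBlocks₂₁ := by
    rw [hC, Matrix.mul_assoc, ← transpose_mul, mul_nonsing_inv A hA, transpose_one, Matrix.mul_one]
  have hsymm : Γᵀ = Γ := by simpa [conjTranspose_eq_transpose_of_trivial] using h.isHermitian.eq
  have h12 : A * Cᵀ = Γ.toBlocks₁₂ := by
    have := congrArg transpose h21
    rw [transpose_mul, transpose_transpose] at this
    rw [this]
    ext i j
    exact congrFun (congrFun hsymm (Sum.inl i)) (Sum.inr j)
  have hΓ : Γ = fromBlocks A 0 C 1 * fromBlocks 1 0 0 S * (fromBlocks A 0 C 1)ᵀ := by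
    rw [fromBlocks_transpose, fromBlocks_multiply, fromBlocks_multiply]
    conv_lhs => rw [← fromBlocks_toBlocks Γ]
    simp [h11, h21, h12, hS]
  have hF : IsUnit (fromBlocks A 0 C (1 : Matrix β β ℝ)).det := by
    rw [det_fromBlocks_zero₁₂, det_one, mul_one]; exact hA
  refine ⟨A, C, S, hA, ?_, fun B hB => ?_⟩
  · have h1 : (fromBlocks (1 : Matrix α α ℝ) 0 0 S).PosDef := by
      have hu : IsUnit (fromBlocks A 0 C (1 : Matrix β β ℝ)) := (isUnit_iff_isUnit_det _).2 hF
      rw [hΓ] at h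
      have := Matrix.IsUnit.posDef_star_right_conjugate_iff hu (x := fromBlocks (1 : Matrix α α ℝ) 0 0 S)
      refine this.1 ?_
      simpa [star_eq_conjTranspose, conjTranspose_eq_transpose_of_trivial] using h
    exact h1.submatrix (e := Sum.inr) Sum.inr_injective
  · rw [fromBlocks_transpose, fromBlocks_multiply]
    conv_lhs => rw [← fromBlocks_toBlocks Γ]
    simp [h11, h21, h12, ← hB, hS]

/-- The block lower triangular matrix with a first block of rows indexed by `ι`, a second one
indexed by `κ`, and a last row. -/
def lowerMatrix {ι κ : Type*} (A : Matrix ι ι ℝ) (C : Matrix κ ι ℝ) (B : Matrix κ κ ℝ) (ξ : ι → ℝ)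
    (ζ : κ → ℝ) (σ : ℝ) : Matrix (ι ⊕ Option κ) (ι ⊕ Option κ) ℝ :=
  fromBlocks A 0 (Matrix.of fun o j => o.elim (ξ j) fun k => C k j)
    (Matrix.of fun o o' => o.elim (o'.elim σ ζ) fun k => o'.elim 0 (B k))

/-- Eliminate twice: first the block ι, then the block κ inside the Schur complement. With the
response in the last row, its remaining coordinate is the part of y unexplained by the regressors.
-/
lemma exists_eq_lowerMatrix_mul_transpose {ι κ : Type*} [Fintype ι] [DecidableEq ι] [Fintype κ]
    [DecidableEq κ] {Γ : Matrix (ι ⊕ Option κ) (ι ⊕ Option κ) ℝ} (h : Γ.PosDef) :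
    ∃ A C B ξ ζ σ, IsUnit A.det ∧ IsUnit B.det ∧ σ ≠ 0 ∧
      Γ = lowerMatrix A C B ξ ζ σ * (lowerMatrix A C B ξ ζ σ)ᵀ := by
  obtain ⟨A, C, S, hA, hS, hΓ⟩ := exists_block_factor h
  obtain ⟨B, ζ, S', hB, hS', hS₁⟩ := exists_block_factor (Γ := S.submatrix
    (Equiv.optionEquivSumPUnit κ).symm (Equiv.optionEquivSumPUnit κ).symm)
    (hS.submatrix (Equiv.injective _))
  obtain ⟨D, hD, hS''⟩ := exists_eq_mul_transpose hS'
  have hD' : D () () ≠ 0 := by simpa [isUnit_iff_ne_zero] using hD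
  refine ⟨A, Matrix.of fun k j => C (some k) j, B, fun j => C none j, fun l => ζ () l, D () (),
    hA, hB, hD', ?_⟩
  have h1 : S = (Matrix.of fun o o' : Option κ => o.elim (o'.elim (D () ()) fun l => ζ () l)
      fun k => o'.elim 0 (B k)) * (Matrix.of fun o o' : Option κ =>
        o.elim (o'.elim (D () ()) fun l => ζ () l) fun k => o'.elim 0 (B k))ᵀ := by
    have h2 := hS₁ D hS''
    ext o o'
    have h3 := congrFun (congrFun h2 (Equiv.optionEquivSumPUnit κ o))
      (Equiv.optionEquivSumPUnit κ o')
    rw [submatrix_apply, Equiv.symm_apply_apply, Equiv.symm_apply_apply] at h3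
    rw [h3]
    cases o <;> cases o' <;> simp [mul_apply, Fintype.sum_option, add_comm]
  rw [hΓ _ h1, lowerMatrix]
  congr 2 <;> · congr 1; ext o j; cases o <;> rfl

end Cholesky

/-! ### The law of a sample with independent standard Gaussian entries -/

section SampleLaw

lemma pi_pi_map_swap {α β X : Type*} [Fintype α] [Fintype β] [MeasurableSpace X] (μ : Measure X)
    [IsProbabilityMeasure μ] :
    (Measure.pi fun _ : α => Measure.pi fun _ : β => μ).map (fun f b a => f a b) =
      Measure.pi fun _ : β => Measure.pi fun _ : α => μ := by
  have h₁ : (Measure.pi fun _ : α => Measure.pi fun _ : β => μ) =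
      (Measure.pi fun _ : α × β => μ).map (MeasurableEquiv.curry α β X) := by
    have := Measure.infinitePi_map_curry (fun (_ : α) (_ : β) => μ)
    simpa only [Measure.infinitePi_eq_pi] using this.symm
  have h₂ : (Measure.pi fun _ : β => Measure.pi fun _ : α => μ) =
      (Measure.pi fun _ : β × α => μ).map (MeasurableEquiv.curry β α X) := by
    have := Measure.infinitePi_map_curry (fun (_ : β) (_ : α) => μ)
    simpa only [Measure.infinitePi_eq_pi] using this.symm
  have h₃ : (Measure.pi fun _ : β × α => μ) =
      (Measure.pi fun _ : α × β => μ).map (fun f p => f p.swap) := by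
    have := Measure.pi_map_piCongrLeft (Equiv.prodComm α β) (fun _ : β × α => μ)
    rw [← this]
    congr 1
  rw [h₁, h₂, h₃, Measure.map_map (by fun_prop) (by fun_prop),
    Measure.map_map (by fun_prop) (by fun_prop)]
  rfl

/-- Observations are independent rows, whereas regression geometry concerns columns. An array of
independent standard normals may be transposed. -/
lemma map_columns_eq_gaussFamily {Ω : Type*} [MeasurableSpace Ω] {P : Measure Ω}
    [IsProbabilityMeasure P] {n : ℕ} {ι κ : Type*} [Fintype ι] [Fintype κ]
    {W : Fin n → Ω → (ι ⊕ κ → ℝ)} (hW : ∀ j, AEMeasurable (W j) P) (hind : iIndepFun W P)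
    (hlaw : ∀ j, P.map (W j) = Measure.pi fun _ => gaussianReal 0 1) :
    P.map (fun ω => ((fun i => WithLp.toLp 2 fun j => W j ω (Sum.inl i)),
      (fun k => WithLp.toLp 2 fun j => W j ω (Sum.inr k)))) =
    (gaussFamily (EuclideanSpace ℝ (Fin n)) ι).prod (gaussFamily (EuclideanSpace ℝ (Fin n)) κ) := by
  have h₁ : P.map (fun ω j => W j ω) =
      Measure.pi fun _ : Fin n => Measure.pi fun _ : ι ⊕ κ => gaussianReal 0 1 := by
    rw [(iIndepFun_iff_map_fun_eq_pi_map hW).1 hind]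
    simp only [hlaw]
  have h₂ : (Measure.pi fun _ : ι ⊕ κ => Measure.pi fun _ : Fin n => gaussianReal 0 1).map
      (fun f i => (WithLp.toLp 2 (f i) : EuclideanSpace ℝ (Fin n))) =
      gaussFamily (EuclideanSpace ℝ (Fin n)) (ι ⊕ κ) := by
    have hs : ∀ _ : ι ⊕ κ, SigmaFinite ((Measure.pi fun _ : Fin n => gaussianReal 0 1).map
        (WithLp.toLp 2 : (Fin n → ℝ) → EuclideanSpace ℝ (Fin n))) := fun _ => by
      rw [map_pi_eq_stdGaussian]; infer_instance
    rw [Measure.pi_map_pi (f := fun _ => (WithLp.toLp 2 : _ → EuclideanSpace ℝ (Fin n)))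
      (fun _ => (by fun_prop))]
    simp only [map_pi_eq_stdGaussian]
    rfl
  have h₃ := (measurePreserving_sumPiEquivProdPi fun _ : ι ⊕ κ =>
    stdGaussian (EuclideanSpace ℝ (Fin n))).map_eq
  rw [gaussFamily, gaussFamily, ← h₃, ← gaussFamily, ← h₂, ← pi_pi_map_swap, ← h₁,
    Measure.map_map, Measure.map_map,
    AEMeasurable.map_map_of_aemeasurable (Measurable.aemeasurable ?_) (aemeasurable_pi_iff.2 hW)]
  · rfl
  all_goals fun_prop

end SampleLaw

/-! ### Second moments in the linear model -/

section Moments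

variable {Ω : Type*} [MeasurableSpace Ω] {P : Measure Ω} [IsProbabilityMeasure P]

omit [IsProbabilityMeasure P] in
lemma tendsto_integral_mul_of_eLpNorm {f : Ω → ℝ} {g : ℕ → Ω → ℝ} (hf : MemLp f 2 P)
    (hg : ∀ N, AEStronglyMeasurable (g N) P)
    (h : Tendsto (fun N => eLpNorm (g N) 2 P) atTop (𝓝 0)) :
    Tendsto (fun N => ∫ ω, f ω * g N ω ∂P) atTop (𝓝 0) := by
  have h1 : Tendsto (fun N => eLpNorm f 2 P * eLpNorm (g N) 2 P) atTop (𝓝 0) := by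
    simpa using ENNReal.Tendsto.const_mul h (Or.inr hf.2.ne)
  rw [tendsto_zero_iff_enorm_tendsto_zero]
  refine tendsto_of_tendsto_of_tendsto_of_le_of_le tendsto_const_nhds h1 (fun _ => zero_le)
    fun N => ?_
  calc ‖∫ ω, f ω * g N ω ∂P‖ₑ ≤ ∫⁻ ω, ‖f ω * g N ω‖ₑ ∂P := enorm_integral_le_lintegral_enorm _
    _ = eLpNorm (fun ω => f ω * g N ω) 1 P := by rw [eLpNorm_one_eq_lintegral_enorm]
    _ ≤ eLpNorm f 2 P * eLpNorm (g N) 2 P := by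
      simpa only [smul_eq_mul, Pi.smul_apply', Pi.mul_def] using
        eLpNorm_smul_le_mul_eLpNorm (p := 2) (q := 2) (r := 1) (hg N) hf.1

variable {y : Ω → ℝ} {x : ℕ → Ω → ℝ} {u : Ω → ℝ} {β : ℕ → ℝ} {σsq : ℝ}

namespace IsLinearModel

variable (h : IsLinearModel P y x u β σsq)

include h

omit [IsProbabilityMeasure P] in
lemma memLp_y : MemLp y 2 P := (h.gaussian.hasGaussianLaw_eval none).memLp_two

omit [IsProbabilityMeasure P] in
lemma integral_u_mul_x (i : ℕ) : ∫ ω, u ω * x i ω ∂P = 0 := by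
  have hi : IndepFun u (x i) P :=
    h.indep.comp measurable_id (measurable_pi_apply i)
  have := hi.integral_fun_mul_eq_mul_integral h.measurable_u.aestronglyMeasurable
    (h.measurable_x i).aestronglyMeasurable
  rw [this, h.mean_u, zero_mul]

lemma integral_u_mul_u : ∫ ω, u ω * u ω ∂P = σsq := by
  have := variance_eq_sub h.memLp_u
  rw [h.var_u, h.mean_u] at this
  simp only [Pi.pow_apply] at this
  rw [this]
  simp [pow_two]

-- A square integrable f orthogonal to every regressor is orthogonal to the L²-limit y - u of the
-- series. Applied to u and to constants, this gives E[u y] = σ² and E[y] = 0.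
omit [IsProbabilityMeasure P] in
lemma integral_mul_y_eq {f : Ω → ℝ} (hf : MemLp f 2 P) (hx : ∀ i, ∫ ω, f ω * x i ω ∂P = 0) :
    ∫ ω, f ω * y ω ∂P = ∫ ω, f ω * u ω ∂P := by
  have hlim := tendsto_integral_mul_of_eLpNorm hf (fun N =>
    ((h.measurable_y.sub h.measurable_u).sub (Finset.measurable_sum (Finset.range N) fun i _ =>
      (h.measurable_x i).mul_const (β i))).aestronglyMeasurable) h.tendsto_series
  have hfy : Integrable (fun ω => f ω * y ω) P := hf.integrable_mul h.memLp_y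
  have hfu : Integrable (fun ω => f ω * u ω) P := hf.integrable_mul h.memLp_u
  have hfyu : Integrable (fun ω => f ω * y ω - f ω * u ω) P := hfy.sub hfu
  have hN : ∀ N : ℕ, ∫ ω, f ω * (y ω - u ω - ∑ i ∈ Finset.range N, x i ω * β i) ∂P =
      ∫ ω, f ω * y ω ∂P - ∫ ω, f ω * u ω ∂P := fun N => by
    have hfx : ∀ i, Integrable (fun ω => f ω * x i ω) P := fun i =>
      hf.integrable_mul (h.memLp_x i)
    have hsum : ∀ ω, f ω * (y ω - u ω - ∑ i ∈ Finset.range N, x i ω * β i) =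
        f ω * y ω - f ω * u ω - ∑ i ∈ Finset.range N, f ω * x i ω * β i := fun ω => by
      rw [mul_sub, mul_sub, Finset.mul_sum]; simp only [mul_assoc]
    simp only [hsum]
    rw [integral_sub hfyu
      (integrable_finsetSum _ fun i _ => (hfx i).mul_const _),
      integral_sub hfy hfu,
      integral_finsetSum _ fun i _ => (hfx i).mul_const _]
    simp [integral_mul_const, hx]
  replace hlim := hlim.congr hN
  exact sub_eq_zero.1 (tendsto_nhds_unique tendsto_const_nhds hlim)

lemma integral_u_mul_y : ∫ ω, u ω * y ω ∂P = σsq := by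
  rw [h.integral_mul_y_eq h.memLp_u h.integral_u_mul_x, h.integral_u_mul_u]

lemma mean_y : ∫ ω, y ω ∂P = 0 := by
  have := h.integral_mul_y_eq (memLp_const (1 : ℝ)) (fun i => by simpa using h.mean_x i)
  simpa [h.mean_u] using this

end IsLinearModel

end Moments

/-! ### The vector of the variables in the model -/

section ObsVec

variable {m₁ m₂ : Finset ℕ}

/-- The sequence with prescribed values on the two blocks, and zero elsewhere. -/
def glue (f : m₁ → ℝ) (g : m₂ → ℝ) (i : ℕ) : ℝ :=
  if h₁ : i ∈ m₁ then f ⟨i, h₁⟩ else if h₂ : i ∈ m₂ then g ⟨i, h₂⟩ else 0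

@[simp]
lemma glue_left (f : m₁ → ℝ) (g : m₂ → ℝ) (i : m₁) : glue f g i = f i := by
  simp [glue]

lemma glue_right (hdisj : Disjoint m₁ m₂) (f : m₁ → ℝ) (g : m₂ → ℝ) (k : m₂) :
    glue f g k = g k := by
  have : (k : ℕ) ∉ m₁ := Finset.disjoint_right.1 hdisj k.2
  simp [glue, this]

lemma sum_glue (hdisj : Disjoint m₁ m₂) (f : m₁ → ℝ) (g : m₂ → ℝ) (X : ℕ → ℝ) :
    ∑ i : ↥(m₁ ∪ m₂), glue f g i * X i = ∑ i, f i * X i + ∑ k, g k * X k := by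
  rw [Finset.sum_coe_sort (m₁ ∪ m₂) (fun i => glue f g i * X i), Finset.sum_union hdisj,
    ← Finset.sum_coe_sort m₁, ← Finset.sum_coe_sort m₂]
  simp [glue_right hdisj]

/-- The regressors of the two blocks and the response of an observation. -/
def obsVec (m₁ m₂ : Finset ℕ) (q : ℝ × (ℕ → ℝ)) : m₁ ⊕ Option m₂ → ℝ :=
  Sum.elim (fun i => q.2 i) fun o => o.elim q.1 fun k => q.2 k

lemma measurable_obsVec : Measurable (obsVec m₁ m₂) := by
  refine measurable_pi_iff.2 fun a => ?_
  rcases a with i | _ | k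
  · exact measurable_pi_iff.1 measurable_snd _
  · exact measurable_fst
  · exact measurable_pi_iff.1 measurable_snd _

variable {Ω : Type*} [MeasurableSpace Ω] {P : Measure Ω} [IsProbabilityMeasure P]
  {y : Ω → ℝ} {x : ℕ → Ω → ℝ} {u : Ω → ℝ} {β : ℕ → ℝ} {σsq : ℝ}

/-- The matrix of second moments of the variables in the model. -/
def momentMatrix (P : Measure Ω) (y : Ω → ℝ) (x : ℕ → Ω → ℝ) (m₁ m₂ : Finset ℕ) :
    Matrix (m₁ ⊕ Option m₂) (m₁ ⊕ Option m₂) ℝ :=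
  Matrix.of fun a b => ∫ ω, obsVec m₁ m₂ (y ω, fun i => x i ω) a *
    obsVec m₁ m₂ (y ω, fun i => x i ω) b ∂P

omit [IsProbabilityMeasure P] in
lemma integral_sum_mul_sum {γ : Type*} [Fintype γ] {V : γ → Ω → ℝ} (hV : ∀ a, MemLp (V a) 2 P)
    (c d : γ → ℝ) : ∫ ω, (∑ a, c a * V a ω) * (∑ b, d b * V b ω) ∂P =
      c ⬝ᵥ ((Matrix.of fun a b => ∫ ω, V a ω * V b ω ∂P) *ᵥ d) := by
  have : ∀ ω, (∑ a, c a * V a ω) * (∑ b, d b * V b ω) =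
      ∑ a, ∑ b, c a * d b * (V a ω * V b ω) := fun ω => by
    rw [Finset.sum_mul_sum]
    exact Finset.sum_congr rfl fun a _ => Finset.sum_congr rfl fun b _ => by ring
  have hint : ∀ a b, Integrable (fun ω => V a ω * V b ω) P := fun a b =>
    (hV a).integrable_mul (hV b)
  simp only [this]
  rw [integral_finsetSum _ fun a _ => integrable_finsetSum _ fun b _ => (hint a b).const_mul _]
  simp only [dotProduct, mulVec, Finset.mul_sum, Matrix.of_apply]
  refine Finset.sum_congr rfl fun a _ => ?_
  rw [integral_finsetSum _ fun b _ => (hint a b).const_mul _]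
  refine Finset.sum_congr rfl fun b _ => ?_
  rw [integral_const_mul]; ring

omit [IsProbabilityMeasure P] in
lemma integral_sq_sum {γ : Type*} [Fintype γ] {V : γ → Ω → ℝ} (hV : ∀ a, MemLp (V a) 2 P)
    (c : γ → ℝ) : ∫ ω, (∑ a, c a * V a ω) ^ 2 ∂P =
      c ⬝ᵥ ((Matrix.of fun a b => ∫ ω, V a ω * V b ω ∂P) *ᵥ c) := by
  simp only [pow_two, integral_sum_mul_sum hV]

namespace IsLinearModel

variable (h : IsLinearModel P y x u β σsq)

include h

omit [IsProbabilityMeasure P] in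
lemma memLp_obsVec (a : m₁ ⊕ Option m₂) :
    MemLp (fun ω => obsVec m₁ m₂ (y ω, fun i => x i ω) a) 2 P := by
  rcases a with i | _ | k
  · exact h.memLp_x i
  · exact h.memLp_y
  · exact h.memLp_x k

lemma mean_obsVec (a : m₁ ⊕ Option m₂) :
    ∫ ω, obsVec m₁ m₂ (y ω, fun i => x i ω) a ∂P = 0 := by
  rcases a with i | _ | k
  · exact h.mean_x i
  · exact h.mean_y
  · exact h.mean_x k

omit [IsProbabilityMeasure P] in
lemma hasGaussianLaw_obsVec :
    HasGaussianLaw (fun ω => obsVec m₁ m₂ (y ω, fun i => x i ω)) P := by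
  have hp := h.gaussian.comp_right (S := m₁ ⊕ Option m₂)
    (Sum.elim (fun i => some (i : ℕ)) fun o => o.map fun k => (k : ℕ))
  let L : (↥(Finset.univ : Finset (m₁ ⊕ Option m₂)) → ℝ) →L[ℝ] (m₁ ⊕ Option m₂ → ℝ) :=
    ContinuousLinearMap.pi fun a => ContinuousLinearMap.proj ⟨a, Finset.mem_univ a⟩
  convert! (hp.hasGaussianLaw Finset.univ).map_fun L using 1
  ext ω a
  rcases a with i | _ | k <;> rfl

/-- Suppose a combination of the variables vanishes almost surely. Pairing it with u isolates the
coefficient of y times σ² > 0, so this coefficient is 0; the rest vanishes because the covariance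
matrix of the regressors is positive definite. -/
lemma posDef_momentMatrix (hdisj : Disjoint m₁ m₂) : (momentMatrix P y x m₁ m₂).PosDef := by
  have hV := fun a => h.memLp_obsVec (m₁ := m₁) (m₂ := m₂) a
  refine Matrix.PosDef.of_dotProduct_mulVec_pos ?_ fun c hc => ?_
  · ext a b
    simp [momentMatrix, mul_comm]
  rw [star_trivial, momentMatrix, ← integral_sq_sum hV]
  refine lt_of_le_of_ne (integral_nonneg fun ω => sq_nonneg _) fun h0 => ?_
  have hf : MemLp (fun ω => ∑ a, c a * obsVec m₁ m₂ (y ω, fun i => x i ω) a) 2 P :=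
    memLp_finsetSum _ fun a _ => (hV a).const_mul _
  rw [eq_comm, integral_eq_zero_iff_of_nonneg (fun ω => sq_nonneg _) hf.integrable_sq] at h0
  have hf0 : ∀ᵐ ω ∂P, ∑ a, c a * obsVec m₁ m₂ (y ω, fun i => x i ω) a = 0 := by
    filter_upwards [h0] with ω hω using pow_eq_zero_iff two_ne_zero |>.1 hω
  by_cases hcy : c (Sum.inr none) = 0
  · have hc'0 : (fun i : ↥(m₁ ∪ m₂) => glue (fun i => c (Sum.inl i))
        (fun k => c (Sum.inr (some k))) i) ≠ 0 := fun h0 => by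
      refine hc (funext fun a => ?_)
      rcases a with i | _ | k
      · have := congrFun h0 ⟨i, Finset.mem_union_left _ i.2⟩
        simpa using this
      · exact hcy
      · have := congrFun h0 ⟨k, Finset.mem_union_right _ k.2⟩
        simpa [glue_right hdisj] using this
    have hsum : ∀ ω, ∑ i : ↥(m₁ ∪ m₂), glue (fun i => c (Sum.inl i))
        (fun k => c (Sum.inr (some k))) i * x i ω =
          ∑ a, c a * obsVec m₁ m₂ (y ω, fun i => x i ω) a := fun ω => by
      rw [sum_glue hdisj _ _ (fun i => x i ω)]
      simp [Fintype.sum_option, obsVec, hcy]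
    have hpos := (h.posDef_cov (m₁ ∪ m₂)).dotProduct_mulVec_pos hc'0
    rw [star_trivial, covMatrix, ← integral_sq_sum (fun i : ↥(m₁ ∪ m₂) => h.memLp_x i)] at hpos
    refine hpos.ne' ?_
    simp only [hsum]
    rw [integral_congr_ae (g := fun _ => (0 : ℝ)) (by filter_upwards [hf0] with ω hω; simp [hω])]
    simp
  · have h1 : ∫ ω, u ω * ∑ a, c a * obsVec m₁ m₂ (y ω, fun i => x i ω) a ∂P =
        c (Sum.inr none) * σsq := by
      have : ∀ ω, u ω * ∑ a, c a * obsVec m₁ m₂ (y ω, fun i => x i ω) a =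
          ∑ a, c a * (u ω * obsVec m₁ m₂ (y ω, fun i => x i ω) a) := fun ω => by
        rw [Finset.mul_sum]; exact Finset.sum_congr rfl fun a _ => by ring
      simp only [this]
      have hint : ∀ a, Integrable (fun ω => u ω * obsVec m₁ m₂ (y ω, fun i => x i ω) a) P :=
        fun a => h.memLp_u.integrable_mul (hV a)
      rw [integral_finsetSum _ fun a _ => (hint a).const_mul _]
      simp [Fintype.sum_option, obsVec, integral_const_mul, h.integral_u_mul_x, h.integral_u_mul_y]
    rw [integral_congr_ae (g := fun _ => (0 : ℝ)) (by filter_upwards [hf0] with ω hω; simp [hω])]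
      at h1
    simp [hcy, h.σsq_pos.ne'] at h1

end IsLinearModel
end ObsVec

/-! ### Whitening -/

section Whitening

variable {m₁ m₂ : Finset ℕ}

/-- The coordinates of an observation in which the variables are standardized. -/
def whiten (L : Matrix (m₁ ⊕ Option m₂) (m₁ ⊕ Option m₂) ℝ) (q : ℝ × (ℕ → ℝ)) :
    m₁ ⊕ Option m₂ → ℝ :=
  L⁻¹ *ᵥ obsVec m₁ m₂ q

lemma measurable_whiten (L : Matrix (m₁ ⊕ Option m₂) (m₁ ⊕ Option m₂) ℝ) :
    Measurable (whiten L) := by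
  refine measurable_pi_iff.2 fun a => ?_
  simp only [whiten, mulVec, dotProduct]
  exact Finset.measurable_sum _ fun b _ =>
    (measurable_pi_iff.1 measurable_obsVec b).const_mul _

lemma mulVec_whiten {L : Matrix (m₁ ⊕ Option m₂) (m₁ ⊕ Option m₂) ℝ} (hL : IsUnit L.det)
    (q : ℝ × (ℕ → ℝ)) : L *ᵥ whiten L q = obsVec m₁ m₂ q := by
  rw [whiten, mulVec_mulVec, mul_nonsing_inv L hL, one_mulVec]

variable {Ω : Type*} [MeasurableSpace Ω] {P : Measure Ω} [IsProbabilityMeasure P]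
  {y : Ω → ℝ} {x : ℕ → Ω → ℝ} {u : Ω → ℝ} {β : ℕ → ℝ} {σsq : ℝ}
  {L : Matrix (m₁ ⊕ Option m₂) (m₁ ⊕ Option m₂) ℝ}

omit [IsProbabilityMeasure P] in
lemma isUnit_det_of_posDef (hdef : (momentMatrix P y x m₁ m₂).PosDef)
    (hL : momentMatrix P y x m₁ m₂ = L * Lᵀ) : IsUnit L.det := by
  have := hdef.det_pos.ne'
  rw [hL, det_mul] at this
  exact isUnit_iff_ne_zero.2 (left_ne_zero_of_mul this)

namespace IsLinearModel

variable (h : IsLinearModel P y x u β σsq)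

include h

omit [IsProbabilityMeasure P] in
lemma integral_whiten_mul_whiten (hu : IsUnit L.det)
    (hL : momentMatrix P y x m₁ m₂ = L * Lᵀ) (a b : m₁ ⊕ Option m₂) :
    ∫ ω, whiten L (y ω, fun i => x i ω) a * whiten L (y ω, fun i => x i ω) b ∂P =
      (1 : Matrix _ _ ℝ) a b := by
  have h1 := integral_sum_mul_sum (fun a => h.memLp_obsVec (m₁ := m₁) (m₂ := m₂) a) (L⁻¹ a) (L⁻¹ b)
  refine h1.trans ?_
  change L⁻¹ a ⬝ᵥ (momentMatrix P y x m₁ m₂ *ᵥ L⁻¹ b) = _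
  have h2 : L⁻¹ * momentMatrix P y x m₁ m₂ * L⁻¹ᵀ = 1 := by
    rw [hL, ← Matrix.mul_assoc, nonsing_inv_mul L hu, Matrix.one_mul, ← transpose_mul,
      nonsing_inv_mul L hu, transpose_one]
  rw [← h2, Matrix.mul_assoc]
  rfl

omit [IsProbabilityMeasure P] in
lemma memLp_whiten (a : m₁ ⊕ Option m₂) :
    MemLp (fun ω => whiten L (y ω, fun i => x i ω) a) 2 P :=
  memLp_finsetSum _ fun b _ => (h.memLp_obsVec b).const_mul _

lemma mean_whiten (a : m₁ ⊕ Option m₂) : ∫ ω, whiten L (y ω, fun i => x i ω) a ∂P = 0 := by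
  simp only [whiten, mulVec, dotProduct]
  rw [integral_finsetSum _ fun b _ => ((h.memLp_obsVec b).integrable one_le_two).const_mul _]
  simp [integral_const_mul, h.mean_obsVec]

omit [IsProbabilityMeasure P] in
lemma hasGaussianLaw_whiten : HasGaussianLaw (fun ω => whiten L (y ω, fun i => x i ω)) P :=
  h.hasGaussianLaw_obsVec.map_fun (L⁻¹).mulVecLin.toContinuousLinearMap

lemma covariance_whiten (hu : IsUnit L.det)
    (hL : momentMatrix P y x m₁ m₂ = L * Lᵀ) (a b : m₁ ⊕ Option m₂) :
    cov[fun ω => whiten L (y ω, fun i => x i ω) a, fun ω => whiten L (y ω, fun i => x i ω) b; P] =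
      (1 : Matrix _ _ ℝ) a b := by
  rw [covariance_eq_sub (h.memLp_whiten a) (h.memLp_whiten b), h.mean_whiten, h.mean_whiten,
    mul_zero, sub_zero, ← h.integral_whiten_mul_whiten hu hL a b]
  rfl

/-- The whitened coordinates are jointly Gaussian, centered, uncorrelated and of unit variance,
hence independent standard normals. -/
lemma map_whiten (hu : IsUnit L.det) (hL : momentMatrix P y x m₁ m₂ = L * Lᵀ) :
    P.map (fun ω => whiten L (y ω, fun i => x i ω)) = Measure.pi fun _ => gaussianReal 0 1 := by
  have hg := h.hasGaussianLaw_whiten (L := L)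
  have hind : iIndepFun (fun a ω => whiten L (y ω, fun i => x i ω) a) P := by
    refine hg.iIndepFun_of_covariance_eq_zero fun a b hab => ?_
    rw [h.covariance_whiten hu hL, Matrix.one_apply_ne hab]
  have hmeas : ∀ a, AEMeasurable (fun ω => whiten L (y ω, fun i => x i ω) a) P := fun a =>
    (h.memLp_whiten a).1.aemeasurable
  rw [(iIndepFun_iff_map_fun_eq_pi_map hmeas).1 hind]
  congr 1
  ext1 a
  rw [(hg.eval a).map_eq_gaussianReal, h.mean_whiten, ← covariance_self (hmeas a),
    h.covariance_whiten hu hL, Matrix.one_apply_eq, Real.toNNReal_one]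

end IsLinearModel

end Whitening

/-! ### The sample and the prediction error in whitened coordinates -/

section Risk

variable {n : ℕ} {Y : Fin n → ℝ} {X : Fin n → ℕ → ℝ} {m₁ m₂ : Finset ℕ}
  {A : Matrix m₁ m₁ ℝ} {C : Matrix m₂ m₁ ℝ} {B : Matrix m₂ m₂ ℝ} {ξ : m₁ → ℝ} {ζ : m₂ → ℝ} {σ : ℝ}

/-- Read L · whitened = observed row by row. The last row is (ξ, ζ, σ); factoring out σ gives the
signal vectors s = ξ/σ and t = ζ/σ. -/
lemma isWhitened_of_isUnit (hσ : σ ≠ 0) (hu : IsUnit (lowerMatrix A C B ξ ζ σ).det)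
    (Y : Fin n → ℝ) (X : Fin n → ℕ → ℝ) :
    IsWhitened Y X m₁ m₂ A C B σ (WithLp.toLp 2 (σ⁻¹ • ξ)) (WithLp.toLp 2 (σ⁻¹ • ζ))
      (fun i => WithLp.toLp 2 fun j => whiten (lowerMatrix A C B ξ ζ σ) (Y j, X j) (Sum.inl i))
      (fun k => WithLp.toLp 2 fun j =>
        whiten (lowerMatrix A C B ξ ζ σ) (Y j, X j) (Sum.inr k)) := by
  have hW := fun j a => congrFun (mulVec_whiten hu (Y j, X j)) a
  refine ⟨fun i => ?_, fun k => ?_, ?_⟩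
  · ext j
    have := (hW j (Sum.inl i)).symm
    simpa [obsVec, mulVec, dotProduct, lowerMatrix, Fintype.sum_option, colVec] using this
  · ext j
    have := (hW j (Sum.inr (some k))).symm
    simpa [obsVec, mulVec, dotProduct, lowerMatrix, Fintype.sum_option, colVec] using this
  · ext j
    have := (hW j (Sum.inr none)).symm
    rw [sum_dir_smul]
    simp [obsVec, mulVec, dotProduct, lowerMatrix, Fintype.sum_option] at this
    refine this.trans ?_
    simp [Finset.mul_sum, ← mul_assoc, hσ]
    rfl

variable {Ω : Type*} [MeasurableSpace Ω] {P : Measure Ω} [IsProbabilityMeasure P]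
  {y : Ω → ℝ} {x : ℕ → Ω → ℝ} {u : Ω → ℝ} {β : ℕ → ℝ} {σsq : ℝ}

omit [IsProbabilityMeasure P] in
/-- The prediction error, in canonical coordinates. -/
lemma IsWhitened.rhoSq_eq {z : m₁ → EuclideanSpace ℝ (Fin n)}
    {G : Option m₂ → EuclideanSpace ℝ (Fin n)} (h : IsLinearModel P y x u β σsq)
    (hL : momentMatrix P y x m₁ m₂ = lowerMatrix A C B ξ ζ σ * (lowerMatrix A C B ξ ζ σ)ᵀ)
    (hσ : σ ≠ 0) (hA : IsUnit A.det) (hB : IsUnit B.det) (hdisj : Disjoint m₁ m₂)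
    (hw : IsWhitened Y X m₁ m₂ A C B σ (WithLp.toLp 2 (σ⁻¹ • ξ)) (WithLp.toLp 2 (σ⁻¹ • ζ)) z G)
    (hz : LinearIndependent ℝ z) (hG : LinearIndependent ℝ fun k => resid z (G (some k)))
    (c₁ c₂ : ℝ) : rhoSq P y x c₁ c₂ Y X m₁ m₂ = σ ^ 2 * canonRisk (a₁ c₁ Y X m₁ m₂)
      (a₂ c₂ Y X m₁ m₂) (WithLp.toLp 2 (σ⁻¹ • ξ)) (WithLp.toLp 2 (σ⁻¹ • ζ)) z G := by
  obtain ⟨t₁, ht₁⟩ : ∃ t, t = thetaJS₁ c₁ c₂ Y X m₁ m₂ := ⟨_, rfl⟩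
  obtain ⟨t₂, ht₂⟩ : ∃ t, t = thetaJS₂ c₂ Y X m₁ m₂ := ⟨_, rfl⟩
  have h₁ := hw.transpose_mulVec_thetaJS₁ hA hB hz hG c₁ c₂
  have h₂ := hw.transpose_mulVec_thetaJS₂ hA hB hz hG c₂
  set c : m₁ ⊕ Option m₂ → ℝ := Sum.elim t₁ fun o => o.elim (-1) t₂ with hc
  have herr : ∀ ω, (∑' i, x i ω * betaHat c₁ c₂ Y X m₁ m₂ i) - y ω =
      ∑ a, c a * obsVec m₁ m₂ (y ω, fun i => x i ω) a := fun ω => by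
    have hb : ∀ i, betaHat c₁ c₂ Y X m₁ m₂ i = glue t₁ t₂ i := fun i => by rw [ht₁, ht₂]; rfl
    rw [tsum_eq_sum (s := m₁ ∪ m₂), ← Finset.sum_coe_sort]
    · simp only [hb, mul_comm (x _ ω)]
      rw [sum_glue hdisj _ _ (fun i => x i ω)]
      simp [Fintype.sum_option, obsVec, hc]
      ring
    · intro i hi
      rw [Finset.mem_union, not_or] at hi
      simp [hb, glue, hi.1, hi.2]
  -- The prediction error is the linear form c = (θ̂₁, θ̂₂, -1) in the new observation, so its
  -- second moment is c'Γc = |Lᵀc|². The last component of Lᵀc is -σ, which produces the summand 1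
  -- of `canonRisk`.
  have hsq : rhoSq P y x c₁ c₂ Y X m₁ m₂ = ∑ a, ((lowerMatrix A C B ξ ζ σ)ᵀ *ᵥ c) a ^ 2 := by
    simp only [rhoSq, herr]
    refine (integral_sq_sum (fun a => h.memLp_obsVec a) c).trans ?_
    change c ⬝ᵥ (momentMatrix P y x m₁ m₂ *ᵥ c) = _
    rw [hL, ← mulVec_mulVec, dotProduct_mulVec, ← mulVec_transpose]
    simp [dotProduct, pow_two]
  have e₁ : ∀ j, ((lowerMatrix A C B ξ ζ σ)ᵀ *ᵥ c) (Sum.inl j) =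
      (Aᵀ *ᵥ t₁ + Cᵀ *ᵥ t₂) j - ξ j := fun j => by
    simp [mulVec, dotProduct, lowerMatrix, Fintype.sum_option, hc]; ring
  have e₂ : ∀ k, ((lowerMatrix A C B ξ ζ σ)ᵀ *ᵥ c) (Sum.inr (some k)) =
      (Bᵀ *ᵥ t₂) k - ζ k := fun k => by
    simp [mulVec, dotProduct, lowerMatrix, Fintype.sum_option, hc]; ring
  have e₃ : ((lowerMatrix A C B ξ ζ σ)ᵀ *ᵥ c) (Sum.inr none) = -σ := by
    simp [mulVec, dotProduct, lowerMatrix, Fintype.sum_option, hc]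
  rw [hsq, canonRisk, Fintype.sum_sum_type, Fintype.sum_option, e₃]
  simp only [e₁, e₂]
  rw [ht₁, ht₂, h₁, h₂, EuclideanSpace.real_norm_sq_eq, EuclideanSpace.real_norm_sq_eq, mul_add,
    mul_add, Finset.mul_sum, Finset.mul_sum]
  have e₄ : ∀ (v w : ℝ), (σ • (σ⁻¹ * v + w)) - v = σ * w := fun v w => by
    simp only [smul_eq_mul]; field_simp; ring
  have e₅ : ∀ (ι : Type) (v : ι → ℝ) (w : EuclideanSpace ℝ ι) (i : ι),
      ((σ • (WithLp.toLp 2 (σ⁻¹ • v) + w).ofLp) i - v i) ^ 2 = σ ^ 2 * w i ^ 2 := fun ι v w i => by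
    rw [← mul_pow, ← e₄ (v i) (w i)]; rfl
  simp only [e₅]
  ring

end Risk

/-! ### The parameters of the submodel -/

section Submodel

variable {m₁ m₂ : Finset ℕ} {A : Matrix m₁ m₁ ℝ} {C : Matrix m₂ m₁ ℝ} {B : Matrix m₂ m₂ ℝ}
  {ξ : m₁ → ℝ} {ζ : m₂ → ℝ} {σ : ℝ}

/-- The coefficients of the regressors in the conditional mean of the response. -/
def submodelCoef (L : Matrix (m₁ ⊕ Option m₂) (m₁ ⊕ Option m₂) ℝ) (σ : ℝ) : ↥(m₁ ∪ m₂) → ℝ :=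
  fun i => glue (fun i => -σ * L⁻¹ (Sum.inr none) (Sum.inl i))
    (fun k => -σ * L⁻¹ (Sum.inr none) (Sum.inr (some k))) i

/-- Solve the last row of L⁻¹ for the response. The diagonal entry there is σ⁻¹, because the error
column of L vanishes outside the last row. -/
lemma sum_submodelCoef_add (hdisj : Disjoint m₁ m₂)
    (hu : IsUnit (lowerMatrix A C B ξ ζ σ).det) (q : ℝ × (ℕ → ℝ)) :
    ∑ i : ↥(m₁ ∪ m₂), q.2 i * submodelCoef (lowerMatrix A C B ξ ζ σ) σ i +
      σ * whiten (lowerMatrix A C B ξ ζ σ) q (Sum.inr none) = q.1 := by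
  set L := lowerMatrix A C B ξ ζ σ with hL
  have h1 : L⁻¹ (Sum.inr none) (Sum.inr none) * σ = 1 := by
    have := congrFun (congrFun (nonsing_inv_mul L hu) (Sum.inr none)) (Sum.inr none)
    rw [Matrix.one_apply_eq, mul_apply] at this
    simpa [hL, lowerMatrix, Fintype.sum_option] using this
  have h2 : ∑ i : ↥(m₁ ∪ m₂), q.2 i * submodelCoef L σ i =
      -σ * (∑ i, L⁻¹ (Sum.inr none) (Sum.inl i) * q.2 i +
        ∑ k, L⁻¹ (Sum.inr none) (Sum.inr (some k)) * q.2 k) := by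
    simp only [submodelCoef, mul_comm (q.2 _)]
    rw [sum_glue hdisj _ _ q.2, mul_add, Finset.mul_sum, Finset.mul_sum]
    simp only [mul_assoc]
  have h3 : whiten L q (Sum.inr none) = ∑ i, L⁻¹ (Sum.inr none) (Sum.inl i) * q.2 i +
      (L⁻¹ (Sum.inr none) (Sum.inr none) * q.1 +
        ∑ k, L⁻¹ (Sum.inr none) (Sum.inr (some k)) * q.2 k) := by
    simp only [whiten, mulVec, dotProduct, Fintype.sum_sum_type, Fintype.sum_option]
    rfl
  rw [h2, h3]
  linear_combination q.1 * h1

lemma sum_submodelCoef (hdisj : Disjoint m₁ m₂)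
    (hu : IsUnit (lowerMatrix A C B ξ ζ σ).det) (q : ℝ × (ℕ → ℝ)) :
    ∑ i : ↥(m₁ ∪ m₂), q.2 i * submodelCoef (lowerMatrix A C B ξ ζ σ) σ i =
      ∑ a, (Sum.elim ξ fun o : Option m₂ => o.elim 0 ζ) a *
        whiten (lowerMatrix A C B ξ ζ σ) q a := by
  have h1 := sum_submodelCoef_add hdisj hu q
  have h2 := congrFun (mulVec_whiten hu q) (Sum.inr none)
  have h3 : obsVec m₁ m₂ q (Sum.inr none) = q.1 := rfl
  rw [h3] at h2
  simp only [mulVec, dotProduct, Fintype.sum_sum_type, Fintype.sum_option] at h2 ⊢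
  have h4 : ∀ i, lowerMatrix A C B ξ ζ σ (Sum.inr none) (Sum.inl i) = ξ i := fun _ => rfl
  have h5 : ∀ k, lowerMatrix A C B ξ ζ σ (Sum.inr none) (Sum.inr (some k)) = ζ k := fun _ => rfl
  have h6 : lowerMatrix A C B ξ ζ σ (Sum.inr none) (Sum.inr none) = σ := rfl
  simp only [h4, h5, h6] at h2
  simp only [Sum.elim_inl, Sum.elim_inr, Option.elim_none, Option.elim_some]
  linarith

/-- The σ-algebra generated by the regressors in the model. -/
abbrev modelSigma {Ω : Type*} (x : ℕ → Ω → ℝ) (m : Finset ℕ) : MeasurableSpace Ω :=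
  MeasurableSpace.comap (fun ω (i : m) => x i ω) inferInstance

variable {Ω : Type*} [MeasurableSpace Ω] {P : Measure Ω} [IsProbabilityMeasure P]
  {y : Ω → ℝ} {x : ℕ → Ω → ℝ} {u : Ω → ℝ} {β : ℕ → ℝ} {σsq : ℝ}

namespace IsLinearModel

variable (h : IsLinearModel P y x u β σsq)

include h

/-- The rows of L belonging to regressors have entry 0 in the error column, so the regressors are
uncorrelated with the error coordinate; joint Gaussianity yields independence. -/
lemma indepFun_whiten_none
    (hu : IsUnit (lowerMatrix A C B ξ ζ σ).det)
    (hL : momentMatrix P y x m₁ m₂ = lowerMatrix A C B ξ ζ σ * (lowerMatrix A C B ξ ζ σ)ᵀ) :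
    IndepFun (fun ω => whiten (lowerMatrix A C B ξ ζ σ) (y ω, fun i => x i ω) (Sum.inr none))
      (fun ω (i : ↥(m₁ ∪ m₂)) => x i ω) P := by
  set L := lowerMatrix A C B ξ ζ σ with hLdef
  set W : m₁ ⊕ Option m₂ → Ω → ℝ := fun a ω => whiten L (y ω, fun i => x i ω) a with hW
  have hcov : ∀ b : m₁ ⊕ Option m₂, L b (Sum.inr none) = 0 →
      cov[W (Sum.inr none), fun ω => obsVec m₁ m₂ (y ω, fun i => x i ω) b; P] = 0 := by
    intro b hb
    have h1 : (fun ω => obsVec m₁ m₂ (y ω, fun i => x i ω) b) = fun ω => ∑ a, L b a * W a ω := by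
      ext ω
      exact (congrFun (mulVec_whiten hu _) b).symm
    rw [h1, covariance_fun_sum_right (fun a => (h.memLp_whiten a).const_mul _) (h.memLp_whiten _)]
    refine Finset.sum_eq_zero fun a _ => ?_
    rw [covariance_const_mul_right, h.covariance_whiten hu hL]
    by_cases ha : a = Sum.inr none
    · rw [ha, hb, zero_mul]
    · rw [Matrix.one_apply_ne (Ne.symm ha), mul_zero]
  choose loc hloc hloc0 using show ∀ i : ↥(m₁ ∪ m₂), ∃ b : m₁ ⊕ Option m₂,
      (∀ ω, x i ω = obsVec m₁ m₂ (y ω, fun i => x i ω) b) ∧ L b (Sum.inr none) = 0 by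
    rintro ⟨i, hi⟩
    rcases Finset.mem_union.1 hi with hi | hi
    · exact ⟨Sum.inl ⟨i, hi⟩, fun _ => rfl, rfl⟩
    · exact ⟨Sum.inr (some ⟨i, hi⟩), fun _ => rfl, rfl⟩
  have hg : HasGaussianLaw (fun ω => ((fun _ : Unit => W (Sum.inr none) ω),
      fun i : ↥(m₁ ∪ m₂) => x i ω)) P := by
    let T : (m₁ ⊕ Option m₂ → ℝ) →L[ℝ] (Unit → ℝ) × (↥(m₁ ∪ m₂) → ℝ) :=
      (ContinuousLinearMap.pi fun _ => (ContinuousLinearMap.proj (Sum.inr none)).comp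
        (L⁻¹).mulVecLin.toContinuousLinearMap).prod
      (ContinuousLinearMap.pi fun i => ContinuousLinearMap.proj (loc i))
    have h1 := (h.hasGaussianLaw_obsVec (m₁ := m₁) (m₂ := m₂)).map_fun T
    have h2 : (fun ω => ((fun _ : Unit => W (Sum.inr none) ω), fun i : ↥(m₁ ∪ m₂) => x i ω)) =
        fun ω => T (obsVec m₁ m₂ (y ω, fun i => x i ω)) :=
      funext fun ω => Prod.ext rfl (funext fun i => hloc i ω)
    rwa [h2]
  have hi := hg.indepFun_of_covariance_eval (X := fun _ : Unit => W (Sum.inr none))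
    (Y := fun i : ↥(m₁ ∪ m₂) => x i) fun _ i => by
      rw [funext (hloc i)]
      exact hcov _ (hloc0 i)
  exact hi.comp (measurable_pi_apply ()) measurable_id

lemma isSubmodelParam (hdisj : Disjoint m₁ m₂)
    (hu : IsUnit (lowerMatrix A C B ξ ζ σ).det)
    (hL : momentMatrix P y x m₁ m₂ = lowerMatrix A C B ξ ζ σ * (lowerMatrix A C B ξ ζ σ)ᵀ) :
    IsSubmodelParam P y x (m₁ ∪ m₂) (submodelCoef (lowerMatrix A C B ξ ζ σ) σ) (σ ^ 2) := by
  set L := lowerMatrix A C B ξ ζ σ with hLdef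
  set W : Ω → ℝ := fun ω => whiten L (y ω, fun i => x i ω) (Sum.inr none) with hW
  have hXm : Measurable (fun ω (i : ↥(m₁ ∪ m₂)) => x i ω) :=
    measurable_pi_iff.2 fun i => h.measurable_x i
  have hWm : Measurable W := (measurable_pi_iff.1 (measurable_whiten L) _).comp
    (h.measurable_y.prodMk (measurable_pi_iff.2 h.measurable_x))
  have hWL : MemLp W 2 P := h.memLp_whiten _
  have hind : Indep (MeasurableSpace.comap W inferInstance)
      (modelSigma x (m₁ ∪ m₂)) P :=
    (IndepFun_iff_Indep _ _ _).1 (h.indepFun_whiten_none hu hL)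
  have hFle : modelSigma x (m₁ ∪ m₂) ≤ _ := hXm.comap_le
  have hWF : Measurable[MeasurableSpace.comap W inferInstance] W := comap_measurable W
  have hy : y = fun ω => ∑ i : ↥(m₁ ∪ m₂), x i ω * submodelCoef L σ i + σ * W ω := by
    ext ω
    exact (sum_submodelCoef_add hdisj hu (y ω, fun i => x i ω)).symm
  have hxm : StronglyMeasurable[modelSigma x (m₁ ∪ m₂)] fun ω => ∑ i : ↥(m₁ ∪ m₂), x i ω * submodelCoef L σ i := by
    have hc : Measurable[modelSigma x (m₁ ∪ m₂)] fun ω (i : ↥(m₁ ∪ m₂)) => x i ω :=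
      comap_measurable _
    exact (Measurable.comp (g := fun v : ↥(m₁ ∪ m₂) → ℝ => ∑ i, v i * submodelCoef L σ i)
      (by fun_prop) hc).stronglyMeasurable
  have hxi : Integrable (fun ω => ∑ i : ↥(m₁ ∪ m₂), x i ω * submodelCoef L σ i) P :=
    integrable_finsetSum _ fun i _ => ((h.memLp_x i).integrable one_le_two).mul_const _
  have hWi : Integrable (fun ω => σ * W ω) P := (hWL.integrable one_le_two).const_mul _
  have hmean : P[y | modelSigma x (m₁ ∪ m₂)] =ᵐ[P] fun ω => ∑ i : ↥(m₁ ∪ m₂), x i ω * submodelCoef L σ i := by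
    have h1 := condExp_add hxi hWi (modelSigma x (m₁ ∪ m₂))
    have h2 : P[fun ω => σ * W ω | modelSigma x (m₁ ∪ m₂)] =ᵐ[P] fun _ => 0 := by
      have := condExp_indep_eq (f := fun ω => σ * W ω) hWm.comap_le hFle
        (hWF.const_mul σ).stronglyMeasurable hind
      filter_upwards [this] with ω hω
      rw [hω, integral_const_mul, h.mean_whiten, mul_zero]
    rw [condExp_of_stronglyMeasurable hFle hxm hxi] at h1
    rw [hy]
    filter_upwards [h1, h2] with ω h1 h2
    refine h1.trans ?_
    rw [Pi.add_apply, h2, add_zero]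
  refine ⟨hmean, ?_⟩
  have hsq : (fun ω => (y ω - (P[y | modelSigma x (m₁ ∪ m₂)]) ω) ^ 2) =ᵐ[P] fun ω => (σ * W ω) ^ 2 := by
    filter_upwards [hmean] with ω hω
    rw [hω, congrFun hy ω]; ring
  have h1 : Var[y; P | modelSigma x (m₁ ∪ m₂)] =ᵐ[P] P[fun ω => (σ * W ω) ^ 2 | modelSigma x (m₁ ∪ m₂)] := condExp_congr_ae hsq
  have h2 := condExp_indep_eq (f := fun ω => (σ * W ω) ^ 2) hWm.comap_le hFle
    ((hWF.const_mul σ).pow_const 2).stronglyMeasurable hind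
  filter_upwards [h1, h2] with ω h1 h2
  rw [h1, h2]
  have := h.integral_whiten_mul_whiten hu hL (Sum.inr none) (Sum.inr none)
  simp only [mul_pow, integral_const_mul]
  rw [Matrix.one_apply_eq] at this
  simp only [pow_two, W]
  rw [this, mul_one]

/-- Any admissible parameters give almost surely the same conditional mean and variance, so the
variance is σ² and the linear predictor is ξ, ζ applied to the whitened regressors. Its second
moment is |ξ|² + |ζ|². -/
lemma snr_eq (hdisj : Disjoint m₁ m₂)
    (hu : IsUnit (lowerMatrix A C B ξ ζ σ).det)
    (hL : momentMatrix P y x m₁ m₂ = lowerMatrix A C B ξ ζ σ * (lowerMatrix A C B ξ ζ σ)ᵀ)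
    {θ : ↥(m₁ ∪ m₂) → ℝ} {τsq : ℝ} (hθ : IsSubmodelParam P y x (m₁ ∪ m₂) θ τsq) :
    snr P x (m₁ ∪ m₂) θ τsq =
      ‖(WithLp.toLp 2 (σ⁻¹ • ξ) : EuclideanSpace ℝ m₁)‖ ^ 2 +
        ‖(WithLp.toLp 2 (σ⁻¹ • ζ) : EuclideanSpace ℝ m₂)‖ ^ 2 := by
  have h0 := h.isSubmodelParam hdisj hu hL
  have hτ : τsq = σ ^ 2 := by
    obtain ⟨ω, hω⟩ := (hθ.condVariance.symm.trans h0.condVariance).exists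
    exact hω
  have h1 : θ ⬝ᵥ (covMatrix P x (m₁ ∪ m₂) *ᵥ θ) = ∑ i, ξ i ^ 2 + ∑ k, ζ k ^ 2 := by
    rw [covMatrix, ← integral_sq_sum (fun i : ↥(m₁ ∪ m₂) => h.memLp_x i)]
    have h2 : (fun ω => (∑ i : ↥(m₁ ∪ m₂), θ i * x i ω) ^ 2) =ᵐ[P] fun ω =>
        (∑ a, (Sum.elim ξ fun o : Option m₂ => o.elim 0 ζ) a *
          whiten (lowerMatrix A C B ξ ζ σ) (y ω, fun i => x i ω) a) ^ 2 := by
      filter_upwards [hθ.condMean.symm.trans h0.condMean] with ω hω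
      rw [← sum_submodelCoef hdisj hu (y ω, fun i => x i ω), ← hω]
      simp only [mul_comm]
    rw [integral_congr_ae h2, integral_sq_sum (fun a => h.memLp_whiten a)]
    have h3 : (Matrix.of fun a b => ∫ ω, whiten (lowerMatrix A C B ξ ζ σ) (y ω, fun i => x i ω) a *
        whiten (lowerMatrix A C B ξ ζ σ) (y ω, fun i => x i ω) b ∂P) = 1 := by
      ext a b
      exact h.integral_whiten_mul_whiten hu hL a b
    rw [h3, one_mulVec]
    simp [dotProduct, Fintype.sum_option, pow_two]
  rw [snr, h1, hτ, EuclideanSpace.real_norm_sq_eq, EuclideanSpace.real_norm_sq_eq, add_div,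
    Finset.sum_div, Finset.sum_div]
  simp [mul_pow, div_eq_inv_mul]

end IsLinearModel

end Submodel

/-! ### The deviation probability -/

/-- The tolerance is ε/(1+ε) because 1 - ε/(1+ε) = 1/(1+ε), whose logarithm is at least -ε. On the
upper side log r ≤ r - 1 < ε. -/
lemma absLog_lt {ρ ρ' ε : ℝ} (hε : 0 < ε) (hρ : 0 < ρ) (h : |ρ' - ρ| < ε / (1 + ε) * ρ) :
    absLog (ρ' / ρ) < ENNReal.ofReal ε := by
  have h1 : |ρ' / ρ - 1| < ε / (1 + ε) := by
    have : ρ' / ρ - 1 = (ρ' - ρ) / ρ := by field_simp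
    rw [this, abs_div, abs_of_pos hρ, div_lt_iff₀ hρ]
    exact h
  obtain ⟨h2, h3⟩ := abs_lt.1 h1
  have hr : 1 / (1 + ε) < ρ' / ρ := by
    have : 1 - ε / (1 + ε) = 1 / (1 + ε) := by field_simp; ring
    linarith
  have hr0 : 0 < ρ' / ρ := lt_trans (by positivity) hr
  have hδ : ε / (1 + ε) ≤ ε := div_le_self hε.le (by linarith)
  have hup : Real.log (ρ' / ρ) < ε := by
    have := Real.log_le_sub_one_of_pos hr0
    linarith
  have hlow : -ε < Real.log (ρ' / ρ) := by
    have h4 := Real.log_lt_log (by positivity) hr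
    rw [one_div, Real.log_inv] at h4
    have h5 := Real.log_le_sub_one_of_pos (show 0 < 1 + ε by linarith)
    linarith
  rw [absLog, ENNReal.log_ofReal_of_pos hr0, EReal.abs_def]
  exact (ENNReal.ofReal_lt_ofReal_iff hε).2 (abs_lt.2 ⟨hlow, hup⟩)

section Deviation

variable {Ω : Type*} [MeasurableSpace Ω] {P : Measure Ω} [IsProbabilityMeasure P]
  {n : ℕ} {y : Fin (n + 1) → Ω → ℝ} {x : Fin (n + 1) → ℕ → Ω → ℝ}
  {u : Ω → ℝ} {β : ℕ → ℝ} {σsq : ℝ} {m₁ m₂ : Finset ℕ}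
  {A : Matrix m₁ m₁ ℝ} {C : Matrix m₂ m₁ ℝ} {B : Matrix m₂ m₂ ℝ} {ξ : m₁ → ℝ} {ζ : m₂ → ℝ} {σ : ℝ}

lemma map_whiten_sample (hmodel : IsLinearModel P (y 0) (x 0) u β σsq)
    (hident : ∀ j, IdentDistrib (fun ω => (y j ω, fun i => x j i ω))
      (fun ω => (y 0 ω, fun i => x 0 i ω)) P P)
    (hindep : iIndepFun (fun j ω => (y j ω, fun i => x j i ω)) P)
    {L : Matrix (m₁ ⊕ Option m₂) (m₁ ⊕ Option m₂) ℝ} (hu : IsUnit L.det)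
    (hL : momentMatrix P (y 0) (x 0) m₁ m₂ = L * Lᵀ) :
    ∃ F : Ω → (m₁ → EuclideanSpace ℝ (Fin n)) × (Option m₂ → EuclideanSpace ℝ (Fin n)),
      AEMeasurable F P ∧
      P.map F = (gaussFamily (EuclideanSpace ℝ (Fin n)) m₁).prod
        (gaussFamily (EuclideanSpace ℝ (Fin n)) (Option m₂)) ∧
      ∀ ω, F ω = ((fun i => WithLp.toLp 2 fun j =>
          whiten L (y (Fin.succ j) ω, fun i => x (Fin.succ j) i ω) (Sum.inl i)),
        fun k => WithLp.toLp 2 fun j =>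
          whiten L (y (Fin.succ j) ω, fun i => x (Fin.succ j) i ω) (Sum.inr k)) := by
  set W : Fin n → Ω → (m₁ ⊕ Option m₂ → ℝ) := fun j ω =>
    whiten L (y (Fin.succ j) ω, fun i => x (Fin.succ j) i ω) with hWdef
  have hW : ∀ j, AEMeasurable (W j) P := fun j =>
    (measurable_whiten L).comp_aemeasurable (hident j.succ).aemeasurable_fst
  have hind : iIndepFun W P :=
    (hindep.precomp (Fin.succ_injective n)).comp (fun _ => whiten L) fun _ => measurable_whiten L
  have hlaw : ∀ j, P.map (W j) = Measure.pi fun _ => gaussianReal 0 1 := fun j => by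
    rw [← hmodel.map_whiten hu hL]
    exact ((hident j.succ).comp (measurable_whiten L)).map_eq
  refine ⟨_, ?_, map_columns_eq_gaussFamily hW hind hlaw, fun ω => rfl⟩
  have hWa : ∀ j a, AEMeasurable (fun ω => W j ω a) P := fun j => aemeasurable_pi_iff.1 (hW j)
  refine AEMeasurable.prodMk (aemeasurable_pi_iff.2 fun i => ?_)
    (aemeasurable_pi_iff.2 fun k => ?_) <;>
  exact (PiLp.continuous_toLp 2 _).measurable.comp_aemeasurable
    (aemeasurable_pi_iff.2 fun j => hWa j _)

theorem measureReal_deviationEvent_le (hmodel : IsLinearModel P (y 0) (x 0) u β σsq)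
    (hident : ∀ j, IdentDistrib (fun ω => (y j ω, fun i => x j i ω))
      (fun ω => (y 0 ω, fun i => x 0 i ω)) P P)
    (hindep : iIndepFun (fun j ω => (y j ω, fun i => x j i ω)) P)
    (hdisj : Disjoint m₁ m₂) (hm₁ : 3 ≤ m₁.card) (hm₂ : 3 ≤ m₂.card) (hmn : (m₁ ∪ m₂).card < n)
    {c₁ c₂ : ℝ} (hc₁ : 0 ≤ c₁) (hc₂ : 0 ≤ c₂) (hA : IsUnit A.det) (hB : IsUnit B.det) (hσ : σ ≠ 0)
    (hL : momentMatrix P (y 0) (x 0) m₁ m₂ =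
      lowerMatrix A C B ξ ζ σ * (lowerMatrix A C B ξ ζ σ)ᵀ)
    {η Λ ε : ℝ} (hε : 0 < ε) (hη : 0 < η) (hΛ : 1 ≤ Λ) (hηΛ : 119 * (η * Λ) ≤ ε / (1 + ε))
    (hsignal : ∀ a b : ℝ, 0 ≤ a → a ≤ 1 →
      a ^ 2 * (1 + ‖(WithLp.toLp 2 (σ⁻¹ • ζ) : EuclideanSpace ℝ m₂)‖ ^ 2) ≤
        Λ * refRisk a b (‖(WithLp.toLp 2 (σ⁻¹ • ξ) : EuclideanSpace ℝ m₁)‖ ^ 2)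
          (‖(WithLp.toLp 2 (σ⁻¹ • ζ) : EuclideanSpace ℝ m₂)‖ ^ 2)
          (m₁.card / (n - m₁.card + 1))
          ((m₁.card + m₂.card) / (n - (m₁.card + m₂.card) + 1))) :
    P.real (deviationEvent P y x c₁ c₂ m₁ m₂ ε) ≤
      38 * Real.exp (-(n * η ^ 2 * (1 - ((m₁ ∪ m₂).card : ℝ) / n) ^ 3)) := by
  have hcard := Finset.card_union_of_disjoint hdisj
  have hu : IsUnit (lowerMatrix A C B ξ ζ σ).det :=
    isUnit_det_of_posDef (hmodel.posDef_momentMatrix hdisj) hL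
  obtain ⟨F, hF, hlaw, hFω⟩ := map_whiten_sample hmodel hident hindep hu hL
  set s : EuclideanSpace ℝ m₁ := WithLp.toLp 2 (σ⁻¹ • ξ) with hs
  set t : EuclideanSpace ℝ m₂ := WithLp.toLp 2 (σ⁻¹ • ζ) with ht
  set v : ℝ := 1 - ((m₁ ∪ m₂).card : ℝ) / n with hv
  have hn0 : (0 : ℝ) < n := by exact_mod_cast (Nat.zero_le _).trans_lt hmn
  have hmn' : ((m₁ ∪ m₂).card : ℝ) < n := by exact_mod_cast hmn
  have hv0 : 0 < v := by rw [hv, sub_pos, div_lt_one hn0]; exact hmn'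
  have hv1 : v ≤ 1 := by
    have : 0 ≤ ((m₁ ∪ m₂).card : ℝ) / n := by positivity
    linarith
  have hδ1 : ε / (1 + ε) ≤ 1 := by rw [div_le_one (by linarith)]; linarith
  have hη1 : 119 * η ≤ 1 := by
    have : η ≤ η * Λ := le_mul_of_one_le_right hη.le hΛ
    linarith
  have hnv : n * v = n - (m₁ ∪ m₂).card := by rw [hv]; field_simp
  have hne₁ : Nonempty m₁ := Finset.Nonempty.coe_sort (Finset.card_pos.1 (by omega))
  have hne₂ : Nonempty m₂ := Finset.Nonempty.coe_sort (Finset.card_pos.1 (by omega))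
  have hu0 : 0 < n * η ^ 2 * v ^ 3 := by positivity
  have hdev : ∀ K : ℕ, n * v ≤ K → dev (n * η ^ 2 * v ^ 3) K < K := fun K hK => by
    have h1 := dev_lt_self hn0 hv0 hv1 hη hη1 hK
    have h2 : (0 : ℝ) < K := (mul_pos hn0 hv0).trans_le hK
    linarith
  have hbound := measure_not_isTypical_le (E := EuclideanSpace ℝ (Fin n)) hu0 s t
    (by simpa [← hcard] using hmn) rfl rfl
    (hdev _ (by
      simp only [finrank_euclideanSpace, Fintype.card_fin, Fintype.card_coe]
      rw [hnv, hcard]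
      have : m₁.card ≤ n := by omega
      push_cast [Nat.cast_sub this]
      linarith [(Nat.cast_nonneg m₂.card : (0 : ℝ) ≤ m₂.card)]))
    (hdev _ (by
      simp only [finrank_euclideanSpace, Fintype.card_fin, Fintype.card_coe]
      rw [hnv, hcard]
      have : m₁.card + m₂.card ≤ n := by omega
      push_cast [Nat.cast_sub this]
      linarith))
  have hsub : deviationEvent P y x c₁ c₂ m₁ m₂ ε ⊆
      F ⁻¹' {p | ¬ IsTypical (n * η ^ 2 * v ^ 3) s t p.1 p.2} := by
    intro ω hω htyp
    have hw := isWhitened_of_isUnit hσ hu (fun j : Fin n => y j.succ ω) (fun j i => x j.succ i ω)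
    have hF1 := congrArg Prod.fst (hFω ω)
    have hF2 := congrArg Prod.snd (hFω ω)
    simp only at hF1 hF2
    rw [← hF1, ← hF2, ← hs, ← ht] at hw
    have hrho := hw.rhoSq_eq hmodel hL hσ hA hB hdisj htyp.linInd htyp.linInd_resid c₁ c₂
    have hrho' := hw.rhoHatSq_eq hA hB htyp.linInd htyp.linInd_resid hdisj c₁ c₂
    refine absurd (show ENNReal.ofReal ε ≤ absLog _ from hω) (not_le.2 ?_)
    have hσ2 : 0 < σ ^ 2 := by positivity
    rw [hrho, hrho', mul_div_mul_left _ _ hσ2.ne']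
    refine absLog_lt hε (canonRisk_pos _ _ _ _ _ _) ?_
    have ha0 : 0 ≤ a₁ c₁ (fun j : Fin n => y j.succ ω) (fun j i => x j.succ i ω) m₁ m₂ :=
      le_min zero_le_one (shrink₁_nonneg hc₁ hmn)
    have hb0 : 0 ≤ a₂ c₂ (fun j : Fin n => y j.succ ω) (fun j i => x j.succ i ω) m₁ m₂ :=
      le_min zero_le_one (shrink₂_nonneg hc₂ hmn)
    refine IsTypical.abs_canonEstimate_sub_lt (η := η) (x := v) (L := Λ) hη hη1
      (by simpa [← hcard] using hmn) (by simp [hv, hcard]) (by simpa using htyp) ha0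
      (min_le_left _ _) hb0 (min_le_left _ _) hΛ (by positivity) hδ1 hηΛ ?_
    simpa using hsignal _ _ ha0 (min_le_left _ _)
  -- The set of atypical samples need not be shown measurable: the measure of a preimage is at most
  -- the image measure for arbitrary sets.
  have hP : P (deviationEvent P y x c₁ c₂ m₁ m₂ ε) ≤ 38 * tailProb (n * η ^ 2 * v ^ 3) := by
    calc P (deviationEvent P y x c₁ c₂ m₁ m₂ ε)
        ≤ P (F ⁻¹' {p | ¬ IsTypical (n * η ^ 2 * v ^ 3) s t p.1 p.2}) := measure_mono hsub
      _ ≤ P.map F {p | ¬ IsTypical (n * η ^ 2 * v ^ 3) s t p.1 p.2} := Measure.le_map_apply hF _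
      _ ≤ _ := by rw [hlaw]; exact hbound
  refine (ENNReal.toReal_mono (by simp [tailProb, ENNReal.mul_eq_top]) hP).trans ?_
  simp [tailProb, ENNReal.toReal_ofReal (Real.exp_pos _).le]

end Deviation

/-! ### The two choices of the comparison factor -/

section Bounds

variable {Ω : Type*} [MeasurableSpace Ω] {P : Measure Ω} [IsProbabilityMeasure P]
  {n : ℕ} {y : Fin (n + 1) → Ω → ℝ} {x : Fin (n + 1) → ℕ → Ω → ℝ}
  {u : Ω → ℝ} {β : ℕ → ℝ} {σsq : ℝ} {m₁ m₂ : Finset ℕ}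
  {A : Matrix m₁ m₁ ℝ} {C : Matrix m₂ m₁ ℝ} {B : Matrix m₂ m₂ ℝ} {ξ : m₁ → ℝ} {ζ : m₂ → ℝ} {σ : ℝ}

lemma card_div_le_card_div {p p' n : ℝ} (hp : 0 ≤ p) (hp' : 0 ≤ p') (h : p + p' < n) :
    p / (n - p + 1) ≤ (p + p') / (n - (p + p') + 1) := by
  gcongr <;> linarith

theorem measureReal_deviationEvent_le_of_ratio (hmodel : IsLinearModel P (y 0) (x 0) u β σsq)
    (hident : ∀ j, IdentDistrib (fun ω => (y j ω, fun i => x j i ω))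
      (fun ω => (y 0 ω, fun i => x 0 i ω)) P P)
    (hindep : iIndepFun (fun j ω => (y j ω, fun i => x j i ω)) P)
    (hdisj : Disjoint m₁ m₂) (hm₁ : 3 ≤ m₁.card) (hm₂ : 3 ≤ m₂.card) (hmn : (m₁ ∪ m₂).card < n)
    {c₁ c₂ : ℝ} (hc₁ : 0 ≤ c₁) (hc₂ : 0 ≤ c₂) (hA : IsUnit A.det) (hB : IsUnit B.det) (hσ : σ ≠ 0)
    (hL : momentMatrix P (y 0) (x 0) m₁ m₂ =
      lowerMatrix A C B ξ ζ σ * (lowerMatrix A C B ξ ζ σ)ᵀ) {ε : ℝ} (hε : 0 < ε) :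
    P.real (deviationEvent P y x c₁ c₂ m₁ m₂ ε) ≤
      38 * Real.exp (-((n : ℝ) * ((m₁.card : ℝ) / n) ^ 2 *
        (1 - ((m₁ ∪ m₂).card : ℝ) / n) ^ 5 * (ε ^ 2 / (14397 * (1 + ε) ^ 2)))) := by
  have hcard : ((m₁ ∪ m₂).card : ℝ) = m₁.card + m₂.card := by
    rw [Finset.card_union_of_disjoint hdisj]; push_cast; ring
  have hmn' : (m₁.card : ℝ) + m₂.card < n := by rw [← hcard]; exact_mod_cast hmn
  have hp : (3 : ℝ) ≤ m₁.card := by exact_mod_cast hm₁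
  have hp' : (3 : ℝ) ≤ m₂.card := by exact_mod_cast hm₂
  have hn0 : (0 : ℝ) < n := by linarith
  obtain ⟨r, hr⟩ : ∃ r, r = (m₁.card : ℝ) / n := ⟨_, rfl⟩
  obtain ⟨v, hv⟩ : ∃ v, v = 1 - ((m₁ ∪ m₂).card : ℝ) / n := ⟨_, rfl⟩
  have hr0 : 0 < r := by rw [hr]; positivity
  have hv0 : 0 < v := by rw [hv, sub_pos, div_lt_one hn0, hcard]; exact hmn'
  have hvr : v ≤ 1 - r := by
    rw [hv, hr, hcard, add_div]
    have : 0 ≤ (m₂.card : ℝ) / n := by positivity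
    linarith
  have hvr1 : v * (r + 1) ≤ 1 := by
    calc v * (r + 1) ≤ (1 - r) * (r + 1) := by gcongr
      _ ≤ 1 := by nlinarith
  have hsqrt : (119 : ℝ) ≤ √14397 := Real.le_sqrt_of_sq_le (by norm_num)
  have hs0 : (0 : ℝ) < √14397 := by positivity
  -- Here η (1 + 1/r) is v (r + 1) ε/(1+ε) divided by √14397, where v (r + 1) ≤ (1 - r)(1 + r) ≤ 1
  -- and 119² ≤ 14397. The factors r and v of η, squared, turn v³ into r² v⁵.
  have h := measureReal_deviationEvent_le (η := r * v * (ε / (1 + ε)) / √14397) (Λ := 1 + 1 / r)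
    hmodel hident hindep hdisj hm₁ hm₂ hmn hc₁ hc₂ hA hB hσ hL hε (by positivity)
    (by have : 0 < 1 / r := by positivity
        linarith) ?_ fun a b ha ha1 => ?_
  · refine h.trans (le_of_eq ?_)
    rw [← hv, ← hr]
    congr 3
    rw [div_pow, mul_pow, Real.sq_sqrt (by norm_num)]
    field_simp
  · have h1 : 119 * (r * v * (ε / (1 + ε)) / √14397 * (1 + 1 / r)) =
        (119 / √14397) * (v * (r + 1)) * (ε / (1 + ε)) := by field_simp
    rw [h1]
    have h2 : 119 / √14397 ≤ 1 := (div_le_one hs0).2 hsqrt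
    calc 119 / √14397 * (v * (r + 1)) * (ε / (1 + ε)) ≤ 1 * 1 * (ε / (1 + ε)) := by gcongr
      _ = _ := by ring
  · refine sq_mul_le_mul_refRisk_of_ratio ha ha1 (by positivity) (by positivity) hr0 ?_
      (card_div_le_card_div (by positivity) (by positivity) hmn')
    -- |m₁|/n ≤ |m₁|/(n - |m₁| + 1), because the block has at least one element.
    rw [hr]
    gcongr <;> linarith

theorem measureReal_deviationEvent_le_of_signal (hmodel : IsLinearModel P (y 0) (x 0) u β σsq)
    (hident : ∀ j, IdentDistrib (fun ω => (y j ω, fun i => x j i ω))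
      (fun ω => (y 0 ω, fun i => x 0 i ω)) P P)
    (hindep : iIndepFun (fun j ω => (y j ω, fun i => x j i ω)) P)
    (hdisj : Disjoint m₁ m₂) (hm₁ : 3 ≤ m₁.card) (hm₂ : 3 ≤ m₂.card) (hmn : (m₁ ∪ m₂).card < n)
    {c₁ c₂ : ℝ} (hc₁ : 0 ≤ c₁) (hc₂ : 0 ≤ c₂) (hA : IsUnit A.det) (hB : IsUnit B.det) (hσ : σ ≠ 0)
    (hL : momentMatrix P (y 0) (x 0) m₁ m₂ =
      lowerMatrix A C B ξ ζ σ * (lowerMatrix A C B ξ ζ σ)ᵀ) {ε μ : ℝ} (hε : 0 < ε)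
    (hμ : μ = ‖(WithLp.toLp 2 (σ⁻¹ • ξ) : EuclideanSpace ℝ m₁)‖ ^ 2 +
      ‖(WithLp.toLp 2 (σ⁻¹ • ζ) : EuclideanSpace ℝ m₂)‖ ^ 2) :
    P.real (deviationEvent P y x c₁ c₂ m₁ m₂ ε) ≤
      38 * Real.exp (-((n : ℝ) * (1 - ((m₁ ∪ m₂).card : ℝ) / n) ^ 5 *
        (ε ^ 2 / (28279 * (1 + μ) ^ 2 * (1 + ε) ^ 2)))) := by
  have hcard : ((m₁ ∪ m₂).card : ℝ) = m₁.card + m₂.card := by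
    rw [Finset.card_union_of_disjoint hdisj]; push_cast; ring
  have hmn' : (m₁.card : ℝ) + m₂.card < n := by rw [← hcard]; exact_mod_cast hmn
  have hp : (3 : ℝ) ≤ m₁.card := by exact_mod_cast hm₁
  have hp' : (3 : ℝ) ≤ m₂.card := by exact_mod_cast hm₂
  have hn0 : (0 : ℝ) < n := by linarith
  obtain ⟨v, hv⟩ : ∃ v, v = 1 - ((m₁ ∪ m₂).card : ℝ) / n := ⟨_, rfl⟩
  have hv0 : 0 < v := by rw [hv, sub_pos, div_lt_one hn0, hcard]; exact hmn'
  have hv1 : v ≤ 1 := by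
    have : 0 ≤ ((m₁ ∪ m₂).card : ℝ) / n := by positivity
    linarith
  have hμ0 : 0 ≤ μ := by rw [hμ]; positivity
  have hsqrt : (119 : ℝ) ≤ √28279 := Real.le_sqrt_of_sq_le (by norm_num)
  have hs0 : (0 : ℝ) < √28279 := by positivity
  -- Here 119² ≤ 28279 with room to spare. The factor v in η is not forced by the comparison, where
  -- only v ≤ 1 is used; it produces the fifth power in the exponent.
  have h := measureReal_deviationEvent_le (η := v * (ε / (1 + ε)) / (√28279 * (1 + μ)))
    (Λ := 1 + μ) hmodel hident hindep hdisj hm₁ hm₂ hmn hc₁ hc₂ hA hB hσ hL hε (by positivity)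
    (by linarith) ?_ fun a b ha ha1 => ?_
  · refine h.trans (le_of_eq ?_)
    rw [← hv]
    congr 3
    rw [div_pow, mul_pow, mul_pow, Real.sq_sqrt (by norm_num)]
    field_simp
  · have h1 : 119 * (v * (ε / (1 + ε)) / (√28279 * (1 + μ)) * (1 + μ)) =
        (119 / √28279) * v * (ε / (1 + ε)) := by field_simp
    rw [h1]
    have h2 : 119 / √28279 ≤ 1 := (div_le_one hs0).2 hsqrt
    calc 119 / √28279 * v * (ε / (1 + ε)) ≤ 1 * 1 * (ε / (1 + ε)) := by gcongr
      _ = _ := by ring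
  · rw [hμ]
    exact sq_mul_le_mul_refRisk_of_signal ha ha1 (by positivity) (by positivity)
      (div_nonneg (by positivity) (by linarith))
      (card_div_le_card_div (by positivity) (by positivity) hmn')

end Bounds

end BlockShrinkage

end

theorem theorem1 {Ω : Type*} [MeasurableSpace Ω] (P : Measure Ω) [IsProbabilityMeasure P]
    (n : ℕ) (y : Fin (n + 1) → Ω → ℝ) (x : Fin (n + 1) → ℕ → Ω → ℝ)
    (u : Ω → ℝ) (β : ℕ → ℝ) (σsq : ℝ)
    (hmodel : BlockShrinkage.IsLinearModel P (y 0) (x 0) u β σsq)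
    (hident : ∀ j, IdentDistrib (fun ω => (y j ω, fun i => x j i ω))
      (fun ω => (y 0 ω, fun i => x 0 i ω)) P P)
    (hindep : iIndepFun (fun j ω => (y j ω, fun i => x j i ω)) P)
    (m₁ m₂ : Finset ℕ) (hdisj : Disjoint m₁ m₂)
    (hm₁ : 3 ≤ m₁.card) (hm₂ : 3 ≤ m₂.card) (hmn : (m₁ ∪ m₂).card < n)
    (c₁ c₂ : ℝ) (hc₁ : 0 ≤ c₁) (hc₂ : 0 ≤ c₂) :
    (∀ ε : ℝ, 0 < ε →
      P.real (BlockShrinkage.deviationEvent P y x c₁ c₂ m₁ m₂ ε) ≤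
        31 * ((m₁ ∪ m₂).card : ℝ) * Real.exp (-((n : ℝ) * ((m₁.card : ℝ) / n) ^ 2 *
          (1 - ((m₁ ∪ m₂).card : ℝ) / n) ^ 5 * (ε ^ 2 / (14397 * (1 + ε) ^ 2))))) ∧
    (∃ θ τsq, 0 < τsq ∧ BlockShrinkage.IsSubmodelParam P (y 0) (x 0) (m₁ ∪ m₂) θ τsq) ∧
    (∀ θ τsq, BlockShrinkage.IsSubmodelParam P (y 0) (x 0) (m₁ ∪ m₂) θ τsq →
      ∀ ε : ℝ, 0 < ε →
        P.real (BlockShrinkage.deviationEvent P y x c₁ c₂ m₁ m₂ ε) ≤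
          31 * ((m₁ ∪ m₂).card : ℝ) * Real.exp (-((n : ℝ) *
            (1 - ((m₁ ∪ m₂).card : ℝ) / n) ^ 5 *
            (ε ^ 2 / (28279 * (1 + BlockShrinkage.snr P (x 0) (m₁ ∪ m₂) θ τsq) ^ 2 *
              (1 + ε) ^ 2))))) := by
  obtain ⟨A, C, B, ξ, ζ, σ, hA, hB, hσ, hL⟩ :=
    BlockShrinkage.exists_eq_lowerMatrix_mul_transpose (hmodel.posDef_momentMatrix hdisj)
  have hu := BlockShrinkage.isUnit_det_of_posDef (hmodel.posDef_momentMatrix hdisj) hL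
  -- The number 38 from the union bound is absorbed by 31 |m|, already for |m| ≥ 3.
  have hcard : (38 : ℝ) ≤ 31 * ((m₁ ∪ m₂).card : ℝ) := by
    have : 3 ≤ (m₁ ∪ m₂).card := hm₁.trans (Finset.card_le_card Finset.subset_union_left)
    have : (3 : ℝ) ≤ (m₁ ∪ m₂).card := by exact_mod_cast this
    linarith
  refine ⟨fun ε hε => ?_, ⟨_, σ ^ 2, by positivity, hmodel.isSubmodelParam hdisj hu hL⟩,
    fun θ τsq hθ ε hε => ?_⟩
  · exact (BlockShrinkage.measureReal_deviationEvent_le_of_ratio hmodel hident hindep hdisj hm₁ hm₂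
      hmn hc₁ hc₂ hA hB hσ hL hε).trans (mul_le_mul_of_nonneg_right hcard (Real.exp_pos _).le)
  · exact (BlockShrinkage.measureReal_deviationEvent_le_of_signal hmodel hident hindep hdisj hm₁ hm₂
      hmn hc₁ hc₂ hA hB hσ hL hε (hmodel.snr_eq hdisj hu hL hθ)).trans
        (mul_le_mul_of_nonneg_right hcard (Real.exp_pos _).le)
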